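/- **Model.** Fix $d\ge 0$ and a finite set of orbitals (spin included). A quantum geometric nesting (QGN) flat-band model, with superconducting nesting at zero momentum, consists of the following $2\pi$-periodic data (periodic embedding). * A $C^2$ family of orthogonal projections $P(k)$, $k\in\mathbb R^d$, on orbital space, of constant rank $N_{\rm flat}=2N_0$ (the flat bands, counted with spin). * A nesting matrix $N$ with $N^T=-N$, $P(k)N=NP(-k)^T$, and $N^\dagger v\ne 0$ for every nonzero $v\in\operatorname{ran}P(k)$. * Finitely many local Hermitian fermion bilinears $S_I(R)$ with $C^2$ Bloch matrices $s_I(k,k')=s_I(k',k)^\dagger$, which commute with the order operator $\eta^\dagger=\sum_k\sum_{\alpha\beta}N_{\alpha\beta}c^\dagger_{k\alpha}c^\dagger_{-k\beta}$, that is, $s_I(k,k')N+N s_I(-k',-k)^T=0$. * A continuous family $V(q)$ of positive semidefinite coupling matrices. On the periodic lattice with $L_1\times\dots\times L_d$ cells, $\mathsf V=\prod_i L_i$ and $k_i\in\frac{2\pi}{L_i}\mathbb Z/2\pi\mathbb Z$, in the flat connection $A\in\mathbb R^d$, the Hamiltonian on the flat-band fermionic Fock space is $$H(A)=\frac1{\mathsf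 V}\sum_q\sum_{IJ}V_{IJ}(q)\,\bar S_I(q)^\dagger\bar S_J(q),\qquad \bar S_I(q)=\sum_k c_k^\dagger\,P(k+A)\,s_I(k+A,k+q+A)\,P(k+q+A)\,c_{k+q}.$$ **Stiffness, pair mass, filling.** Fix a direction $e\in\mathbb R^d$. Let $E_N(A)$ be the lowest energy of $N$ particles, and let $4\mathsf V D_s(N)=\partial_t^2E_N(te)|_{t=0}$. Let $E_{\rm pair}(Q)$ be the lowest energy of two particles with total momentum $Q$, i.e. of particles with momenta $k+Q/2$ and $-k+Q/2$, $k$ in the mesh, and let $m_{\rm pair}^{-1}=\partial_t^2E_{\rm pair}(te)|_{t=0}$, for the same system size. Second derivatives are understood through the second-order Taylor expansion at $t=0$. Put $N_p=N_{\rm flat}\mathsf V/2$ and $\nu=N/(N_{\rm flat}\mathsf V)$. Write $D_s^{\rm full}=D_s(2N_p)$ for the completely filled flat bands. **Theorem.** Assume that, at $A=0$, the zero-energy two-particle state with zero total momentum is unique up to a scalar. 1. For every system size, $m_{\rm pair}^{-1}$ and $D_s(N)$ exist for every even $N=2n\le N_{\rm flat}\mathsf V$, and $$\Bigl(1-\tfrac1{N_p}\Bigr)D_s(N)\le\frac{N_{\rm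 flat}}2\,\nu(1-\nu)\,m_{\rm pair}^{-1}+\nu\Bigl(\nu-\tfrac1{N_p}\Bigr)D_s^{\rm full}.$$ 2. For every system size and every $\nu\in[0,1]$, the average of $D_s$ over the pair-number distribution of a BCS state of mean filling $\nu$ satisfies $$\sum_{n=0}^{N_p}\binom{N_p}{n}\nu^n(1-\nu)^{N_p-n}D_s(2n)\le\frac{N_{\rm flat}}2\,\nu(1-\nu)\,m_{\rm pair}^{-1}+\nu^2D_s^{\rm full}.$$ 3. If $d\ge1$, then for every $\varepsilon>0$ there is $L_0$ such that for all system sizes with every $L_i\ge L_0$ (for which the uniqueness assumption holds) and all even $N\le N_{\rm flat}\mathsf V$, $$D_s(N)\le\frac{N_{\rm flat}}2\,\nu(1-\nu)\,m_{\rm pair}^{-1}+\varepsilon,$$ with $m_{\rm pair}^{-1}$ evaluated at the same system size. (In particular $D_s^{\rm full}\to0$.) -/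

import Mathlib

open Filter Topology Asymptotics
open scoped Matrix ComplexOrder

noncomputable section

namespace FlatBand

/-! ### Fermionic Fock space over a finite set of single-particle states -/

/-- Fock space over the single-particle basis `ι`; the occupation-number basis vectors are labelled
by the set of occupied single-particle states. -/
abbrev Fock (ι : Type*) [Fintype ι] : Type _ := EuclideanSpace ℂ (Finset ι)

variable {ι : Type*} [Fintype ι] [DecidableEq ι]

/-- The sign `(-1) ^ #{b ∈ s : b < a}`, for a fixed enumeration of the single-particle basis. -/
def fermiSign (a : ι) (s : Finset ι) : ℂ :=
  (-1) ^ (s.filter fun b => Fintype.equivFin ι b < Fintype.equivFin ι a).card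

/-- The annihilation operator `c_a`. -/
def annihilate (a : ι) : Fock ι →ₗ[ℂ] Fock ι where
  toFun ψ := WithLp.toLp 2 fun s => if a ∈ s then 0 else fermiSign a s * ψ (insert a s)
  map_add' ψ φ := by
    ext s
    by_cases h : a ∈ s <;> simp [h, mul_add]
  map_smul' z ψ := by
    ext s
    by_cases h : a ∈ s <;> simp [h, mul_left_comm]

/-- The creation operator `c_a†`. -/
def create (a : ι) : Fock ι →ₗ[ℂ] Fock ι := LinearMap.adjoint (annihilate a)

/-- The fermion bilinear `∑ T_{ab} c_a† c_b`. -/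
def bilinear (T : Matrix ι ι ℂ) : Fock ι →ₗ[ℂ] Fock ι :=
  ∑ a, ∑ b, T a b • (create a ∘ₗ annihilate b)

/-- States with exactly `N` particles. -/
def numberSector (ι : Type*) [Fintype ι] (N : ℕ) : Set (Fock ι) :=
  {ψ | ∀ s, ψ s ≠ 0 → s.card = N}

/-- States built only from the single-particle states in the range of the orthogonal projection `P`:
every single-particle state in the range of `1 - P` is empty. -/
def supportedOn (P : Matrix ι ι ℂ) : Set (Fock ι) :=
  {ψ | ∀ a, ∑ b, (1 - P) a b • annihilate b ψ = 0}

/-- The lowest energy of `H` among the normalized states of `W` (the lowest eigenvalue of `H` on `W`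
when `W` is a nonzero invariant subspace of the self-adjoint operator `H`). -/
def lowestEnergy (H : Fock ι →ₗ[ℂ] Fock ι) (W : Set (Fock ι)) : ℝ :=
  sInf {x | ∃ ψ ∈ W, ‖ψ‖ = 1 ∧ x = (inner ℂ ψ (H ψ)).re}

/-- `c` is the second derivative of `f` at `0`, in the sense of the second-order Taylor expansion
`f t = f 0 + b t + c t² / 2 + o(t²)`. It is the usual second derivative whenever that exists. -/
def HasSecondDerivAtZero (f : ℝ → ℝ) (c : ℝ) : Prop :=
  ∃ b : ℝ, (fun t : ℝ => f t - f 0 - b * t - c / 2 * t ^ 2) =o[𝓝 0] fun t : ℝ => t ^ 2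

/-! ### Quantum geometric nesting models -/

/-- A flat-band model on the lattice `ℤ^d` with perfect quantum geometric nesting in the
particle-particle channel at zero momentum. `orb` labels the orbitals (spin included) of a unit cell
and `gen` labels the types of local Hermitian fermion bilinears from which the interaction is made.
All functions of momentum are in the periodic embedding. -/
structure QGNModel (d : ℕ) (orb gen : Type*) [Fintype orb] [DecidableEq orb] [Fintype gen] where
  /-- Half the number of flat bands: there are `2 * nPair` flat bands, counting spin. -/
  nPair : ℕ
  /-- The projector `P(k)` onto the flat-band Bloch states. -/
  proj : (Fin d → ℝ) → Matrix orb orb ℂ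
  proj_contDiff : ∀ α β, ContDiff ℝ 2 fun k => proj k α β
  proj_periodic : ∀ (k : Fin d → ℝ) (m : Fin d → ℤ),
    proj (fun i => k i + 2 * Real.pi * m i) = proj k
  proj_isHermitian : ∀ k, (proj k).IsHermitian
  proj_idem : ∀ k, proj k * proj k = proj k
  proj_trace : ∀ k, (proj k).trace = 2 * nPair
  /-- The nesting matrix `N`: the order operator is
  `η† = ∑_k ∑_{αβ} N_{αβ} c†_{k,α} c†_{-k,β}`. -/
  nest : Matrix orb orb ℂ
  nest_antisymm : nestᵀ = -nest
  /-- Perfect nesting: `η†` has no matrix elements between the flat bands and the other bands. -/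
  nest_nesting : ∀ k, proj k * nest = nest * (proj (-k))ᵀ
  /-- Every flat-band state takes part in the pairing. -/
  nest_injective : ∀ k (v : orb → ℂ), proj k *ᵥ v = v → nestᴴ *ᵥ v = 0 → v = 0
  /-- The Bloch matrix `s_I(k, k')` of the `I`-th local bilinear
  `S_I(R) = 𝖵⁻¹ ∑_{k,k'} e^{i (k' - k) R} c†_k s_I(k, k') c_{k'}`. -/
  vertex : gen → (Fin d → ℝ) → (Fin d → ℝ) → Matrix orb orb ℂ
  vertex_contDiff : ∀ I α β,
    ContDiff ℝ 2 fun p : (Fin d → ℝ) × (Fin d → ℝ) => vertex I p.1 p.2 α β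
  vertex_periodic : ∀ I (k k' : Fin d → ℝ) (m m' : Fin d → ℤ),
    vertex I (fun i => k i + 2 * Real.pi * m i) (fun i => k' i + 2 * Real.pi * m' i)
      = vertex I k k'
  /-- `S_I(R)` is Hermitian. -/
  vertex_hermitian : ∀ I k k', (vertex I k k')ᴴ = vertex I k' k
  /-- `[S_I(R), η†] = 0` for every cell `R`. -/
  vertex_commute : ∀ I k k', vertex I k k' * nest + nest * (vertex I (-k') (-k))ᵀ = 0
  /-- The Fourier transform `V_{IJ}(q)` of the positive semidefinite coupling `V_{IJ}(R - R')` in the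
  interaction `∑_{R,R'} ∑_{I,J} V_{IJ}(R - R') S_I(R) S_J(R')`. -/
  coupling : (Fin d → ℝ) → Matrix gen gen ℂ
  coupling_continuous : ∀ I J, Continuous fun q => coupling q I J
  coupling_periodic : ∀ (q : Fin d → ℝ) (m : Fin d → ℤ),
    coupling (fun i => q i + 2 * Real.pi * m i) = coupling q
  coupling_posSemidef : ∀ q, (coupling q).PosSemidef

/-- Crystal momenta of the periodic lattice with `L i` unit cells in direction `i`: the integer
vector `n` stands for the momentum `2π n_i / L_i`. -/
abbrev Mesh {d : ℕ} (L : Fin d → ℕ) : Type := ∀ i, ZMod (L i)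

/-- The momentum `2π n_i / L_i`. -/
def Mesh.val {d : ℕ} {L : Fin d → ℕ} (n : Mesh L) : Fin d → ℝ :=
  fun i => 2 * Real.pi * (n i).val / L i

/-- The number `𝖵` of unit cells. -/
def volume {d : ℕ} (L : Fin d → ℕ) : ℕ := ∏ i, L i

namespace QGNModel

variable {d : ℕ} {orb gen : Type*} [Fintype orb] [DecidableEq orb] [Fintype gen]
  (𝓜 : QGNModel d orb gen) (L : Fin d → ℕ) [∀ i, NeZero (L i)]

/-- The number of flat bands, counting spin. -/
def nFlat : ℕ := 2 * 𝓜.nPair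

/-- The largest number of pairs that fit into the flat bands, `N_flat 𝖵 / 2`. -/
def maxPairs : ℕ := 𝓜.nPair * volume L

/-- The filling `ν = N / (N_flat 𝖵)` of the flat bands by `N` particles. -/
def filling (N : ℕ) : ℝ := N / (𝓜.nFlat * volume L)

/-- The single-particle projection onto the flat bands in the flat connection `A`. -/
def flatProj (A : Fin d → ℝ) : Matrix (Mesh L × orb) (Mesh L × orb) ℂ :=
  Matrix.of fun x y => if x.1 = y.1 then 𝓜.proj (x.1.val + A) x.2 y.2 else 0

/-- The single-particle matrix of `S_I(q) = ∑_k c†_k s_I(k + A, k + q + A) c_{k+q}`. -/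
def vertexMatrix (A : Fin d → ℝ) (I : gen) (q : Mesh L) :
    Matrix (Mesh L × orb) (Mesh L × orb) ℂ :=
  Matrix.of fun x y =>
    if y.1 = x.1 + q then 𝓜.vertex I (x.1.val + A) (y.1.val + A) x.2 y.2 else 0

/-- The bilinear `S_I(q)` projected onto the flat bands. -/
def projectedBilinear (A : Fin d → ℝ) (I : gen) (q : Mesh L) :
    Fock (Mesh L × orb) →ₗ[ℂ] Fock (Mesh L × orb) :=
  bilinear (𝓜.flatProj L A * 𝓜.vertexMatrix L A I q * 𝓜.flatProj L A)

/-- The projected Hamiltonian in the flat connection `A`,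
`H(A) = 𝖵⁻¹ ∑_q ∑_{I,J} V_{IJ}(q) S_I(q)† S_J(q)` with projected bilinears. -/
def hamiltonian (A : Fin d → ℝ) : Fock (Mesh L × orb) →ₗ[ℂ] Fock (Mesh L × orb) :=
  (volume L : ℂ)⁻¹ • ∑ q : Mesh L, ∑ I, ∑ J, 𝓜.coupling q.val I J •
    (LinearMap.adjoint (𝓜.projectedBilinear L A I q) ∘ₗ 𝓜.projectedBilinear L A J q)

/-- The flat-band states with `N` particles. -/
def flatSector (A : Fin d → ℝ) (N : ℕ) : Set (Fock (Mesh L × orb)) :=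
  supportedOn (𝓜.flatProj L A) ∩ numberSector (Mesh L × orb) N

/-- The two-particle flat-band states in which the two particles have opposite crystal momenta
`k` and `-k` (shifted to `k + A` and `-k + A` by the flat connection). -/
def pairSector (A : Fin d → ℝ) : Set (Fock (Mesh L × orb)) :=
  𝓜.flatSector L A 2 ∩ {ψ | ∀ s, ψ s ≠ 0 → ∑ x ∈ s, x.1 = 0}

/-- The ground-state energy of `N` particles in the flat connection `A`. -/
def groundEnergy (N : ℕ) (A : Fin d → ℝ) : ℝ :=
  lowestEnergy (𝓜.hamiltonian L A) (𝓜.flatSector L A N)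

/-- The lowest energy of two particles with total momentum `Q`: the particles have momenta
`k + Q / 2` and `-k + Q / 2`, `k` in the momentum mesh of the system. -/
def pairEnergy (Q : Fin d → ℝ) : ℝ :=
  lowestEnergy (𝓜.hamiltonian L ((1 / 2 : ℝ) • Q)) (𝓜.pairSector L ((1 / 2 : ℝ) • Q))

/-- `D` is the superfluid stiffness in direction `e` of the `N`-particle system:
`4 𝖵 D` is the second derivative of the ground-state energy with respect to the flat connection. -/
def IsStiffness (N : ℕ) (e : Fin d → ℝ) (D : ℝ) : Prop :=
  HasSecondDerivAtZero (fun t => 𝓜.groundEnergy L N (t • e)) (4 * volume L * D)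

/-- `w` is the inverse pair mass in direction `e`: the second derivative of the lowest two-particle
energy with respect to the total momentum. -/
def IsInversePairMass (e : Fin d → ℝ) (w : ℝ) : Prop :=
  HasSecondDerivAtZero (fun t => 𝓜.pairEnergy L (t • e)) w

/-- The lowest two-particle state with zero total momentum is non-degenerate, that is, the
zero-energy states in that sector are the multiples of one state. -/
def HasUniquePair : Prop :=
  ∃ φ : Fock (Mesh L × orb), ∀ ψ ∈ 𝓜.pairSector L 0, 𝓜.hamiltonian L 0 ψ = 0 → ∃ z : ℂ, ψ = z • φ

end QGNModel

end FlatBand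

end

noncomputable section

namespace FlatBand

set_option linter.unusedSectionVars false

variable {ι : Type*} [Fintype ι] [DecidableEq ι]

/-! ### Canonical anticommutation relations -/

/-! The coupling is positive semidefinite, so the Hamiltonian is a sum of squares `∑ T_i(A)† T_i(A)`
of flat-band bilinears (`hamiltonian_apply`). At `A = 0` every `T_i` annihilates the condensed pair
`W`, the nesting matrix restricted to the flat bands. Bilinears act as derivations on products of
pairs, so all powers of the pair operator of `W` applied to the vacuum have zero energy. The lowest
energies are therefore nonnegative and vanish at `A = 0`, and along `A = t e` they behave as `l t² +
o(t²)`. The abstract perturbation theorem `exists_secondOrder` proves this using only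
differentiability at `t = 0`: `l` is the infimum of `‖Z' φ + Z ψ‖²` over normalized zero modes `φ`
and first-order corrections `ψ`.

For one pair of zero total momentum the zero mode is unique, so a nearly optimal first-order curve
is a curve of pair wave functions `C(t)` with `C(0)` proportional to `W`. The trial state for `2n`
particles is `n` copies of this optimal pair. The derivation property reduces the velocity of `T_i`
on it to `n` times the state of `n - 1` condensed pairs and one pair `F_i`, where `F_i` is the
velocity of `T_i` on a single pair.

The norms of these states follow from the quasi-spin algebra. Split `F_i = γ_i W + F_i'` with `F_i'`
orthogonal to `W`. The two parts generate orthogonal ladders whose norms are explicit in `n` and in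
the maximal number `M` of pairs (`norm_sq_pow_pairCreate`). At complete filling the part from `F_i'`
disappears, while each bilinear acts as its trace (`bilinear_apply_of_filled`); this identifies `∑
|γ_i|²` with the curvature of the filled state divided by `M²`. The result is the inequality of
`exists_curvatures` between the curvatures for `2n` particles, for one pair and for the filled
bands.

The quasi-spin algebra closes only if `W` pairs all flat-band states with equal amplitude, that is
`W W† = c P`. This too follows from uniqueness: the adjoints of the `T_i` also annihilate the
nesting pair `N`, so `N N† N`, restricted to the flat bands, is a second zero mode; it must be
proportional to `W` (`exists_condensate_isUniformPairing`).

The BCS average inserts the first two binomial moments into the fixed-number bound. For large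
systems, the stiffness of the filled bands is governed by Riemann sums of derivatives of periodic
functions and tends to zero (`exists_stiffness_filled_le`). The inverse pair mass is bounded
uniformly in the system size by the trial pair `P(t) W P(t)ᵀ` (`exists_inversePairMass_le`), so the
prefactor `1 - 1/M` costs only a small error. -/

lemma fermiSign_mul_self (a : ι) (s : Finset ι) : fermiSign a s * fermiSign a s = 1 := by
  unfold fermiSign
  rw [← mul_pow]; simp

lemma fermiSign_conj (a : ι) (s : Finset ι) :
    (starRingEnd ℂ) (fermiSign a s) = fermiSign a s := by
  simp [fermiSign]

lemma fermiSign_erase_self (a : ι) (s : Finset ι) : fermiSign a (s.erase a) = fermiSign a s := by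
  unfold fermiSign
  congr 2
  ext b
  simp only [Finset.mem_filter, Finset.mem_erase]
  constructor
  · rintro ⟨⟨_, h⟩, h'⟩; exact ⟨h, h'⟩
  · rintro ⟨h, h'⟩
    refine ⟨⟨?_, h⟩, h'⟩
    rintro rfl
    exact lt_irrefl _ h'

lemma fermiSign_insert_self (a : ι) (s : Finset ι) : fermiSign a (insert a s) = fermiSign a s := by
  rw [← fermiSign_erase_self a (insert a s), ← fermiSign_erase_self a s]
  simp

lemma fermiSign_insert_of_lt {a b : ι} (h : Fintype.equivFin ι a < Fintype.equivFin ι b)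
    {s : Finset ι} (ha : a ∉ s) : fermiSign b (insert a s) = -fermiSign b s := by
  unfold fermiSign
  rw [Finset.filter_insert, if_pos h, Finset.card_insert_of_notMem (by simp [ha]), pow_succ]
  ring

lemma fermiSign_insert_of_not_lt {a b : ι} (h : ¬ Fintype.equivFin ι a < Fintype.equivFin ι b)
    (s : Finset ι) : fermiSign b (insert a s) = fermiSign b s := by
  unfold fermiSign
  rw [Finset.filter_insert, if_neg h]

/-- Of two distinct labels exactly one precedes the other in the enumeration, so exactly one of the
two insertions changes a sign. This is the only source of anticommutation. -/
lemma fermiSign_swap {a b : ι} (hab : a ≠ b) {s : Finset ι} (ha : a ∉ s) (hb : b ∉ s) :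
    fermiSign a s * fermiSign b (insert a s) = -(fermiSign b s * fermiSign a (insert b s)) := by
  have hne : Fintype.equivFin ι a ≠ Fintype.equivFin ι b := fun h => hab ((Fintype.equivFin ι).injective h)
  rcases lt_or_gt_of_ne hne with h | h
  · rw [fermiSign_insert_of_lt h ha, fermiSign_insert_of_not_lt h.asymm]; ring
  · rw [fermiSign_insert_of_lt h hb, fermiSign_insert_of_not_lt h.asymm]; ring

lemma annihilate_apply (a : ι) (ψ : Fock ι) (s : Finset ι) :
    annihilate a ψ s = if a ∈ s then 0 else fermiSign a s * ψ (insert a s) := rfl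

lemma create_apply (a : ι) (ψ : Fock ι) (s : Finset ι) :
    create a ψ s = if a ∈ s then fermiSign a s * ψ (s.erase a) else 0 := by
  have h1 : create a ψ s = inner ℂ (EuclideanSpace.single s (1 : ℂ)) (create a ψ) := by
    simp [EuclideanSpace.inner_single_left]
  rw [h1, create, LinearMap.adjoint_inner_right, PiLp.inner_apply]
  simp only [annihilate_apply, PiLp.single_apply, RCLike.inner_apply]
  by_cases h : a ∈ s
  · rw [if_pos h, Finset.sum_eq_single (s.erase a)]
    · simp [Finset.insert_erase h, fermiSign_erase_self, fermiSign_conj, mul_comm]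
    · intro t _ ht
      by_cases hat : a ∈ t
      · simp [hat]
      · have : insert a t ≠ s := by
          rintro rfl; exact ht (by simp [hat])
        simp [hat, this]
    · simp
  · rw [if_neg h]
    refine Finset.sum_eq_zero fun t _ => ?_
    have : insert a t ≠ s := by rintro rfl; simp at h
    simp [this]

lemma annihilate_mul_annihilate (a b : ι) :
    annihilate a * annihilate b = -(annihilate b * annihilate a : Module.End ℂ (Fock ι)) := by
  ext ψ s
  simp only [Module.End.mul_apply, LinearMap.neg_apply, PiLp.neg_apply, annihilate_apply,
    Finset.mem_insert]
  by_cases hab : a = b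
  · subst hab; simp
  by_cases ha : a ∈ s
  · simp [ha]
  by_cases hb : b ∈ s
  · simp [hb]
  have hba : ¬ b = a := fun h => hab h.symm
  simp only [ha, hb, hab, hba, or_self, if_false]
  rw [Finset.insert_comm b a, ← mul_assoc, ← mul_assoc, fermiSign_swap hab ha hb]
  ring

lemma adjoint_annihilate (a : ι) : LinearMap.adjoint (annihilate a) = create a := rfl

lemma adjoint_create (a : ι) : LinearMap.adjoint (create a) = annihilate a := by
  rw [create, LinearMap.adjoint_adjoint]

lemma create_mul_create (a b : ι) :
    create a * create b = -(create b * create a : Module.End ℂ (Fock ι)) := by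
  have := congrArg LinearMap.adjoint (annihilate_mul_annihilate b a)
  simpa only [Module.End.mul_eq_comp, LinearMap.adjoint_comp, map_neg, adjoint_annihilate] using this

lemma annihilate_mul_create (a b : ι) :
    annihilate a * create b
      = (if a = b then 1 else 0) - (create b * annihilate a : Module.End ℂ (Fock ι)) := by
  ext ψ s
  by_cases hab : a = b
  · subst hab
    simp only [Module.End.mul_apply, LinearMap.sub_apply, PiLp.sub_apply, annihilate_apply,
      create_apply, Finset.mem_insert_self, if_true, Module.End.one_apply]
    by_cases ha : a ∈ s
    · simp [ha, fermiSign_erase_self, ← mul_assoc, fermiSign_mul_self]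
    · simp [ha, fermiSign_insert_self, ← mul_assoc, fermiSign_mul_self]
  · have hba : ¬ b = a := fun h => hab h.symm
    rw [if_neg hab, zero_sub]
    simp only [Module.End.mul_apply, LinearMap.neg_apply, PiLp.neg_apply, annihilate_apply,
      create_apply, Finset.mem_insert, Finset.mem_erase, hba, hab, false_or, ne_eq,
      not_false_eq_true, true_and]
    by_cases ha : a ∈ s
    · simp [ha]
    by_cases hb : b ∈ s
    · simp only [ha, hb, if_true, if_false]
      rw [Finset.erase_insert_of_ne hab]
      have h2 := fermiSign_swap (s := s.erase b) hab (by simp [ha]) (by simp)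
      have h3 : fermiSign b (insert a s) = fermiSign b (insert a (s.erase b)) := by
        rw [← fermiSign_erase_self b (insert a s), Finset.erase_insert_of_ne hab]
      have h4 : fermiSign b s = fermiSign b (s.erase b) := (fermiSign_erase_self b s).symm
      rw [Finset.insert_erase hb] at h2
      have h5 := fermiSign_mul_self a s
      have h6 := fermiSign_mul_self a (s.erase b)
      rw [← h3, ← h4] at h2
      have h7 : fermiSign a s * fermiSign b (insert a s)
          = -(fermiSign b s * fermiSign a (s.erase b)) := by
        linear_combination (fermiSign a s * fermiSign a (s.erase b)) * h2
          - fermiSign a s * fermiSign b (insert a s) * h6 - fermiSign b s * fermiSign a (s.erase b) * h5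
      rw [← mul_assoc, h7]; ring
    · simp [ha, hb]

/-- The state without particles. -/
def vacuum (ι : Type*) [Fintype ι] [DecidableEq ι] : Fock ι := EuclideanSpace.single ∅ 1

@[simp] lemma norm_vacuum : ‖vacuum ι‖ = 1 := by simp [vacuum]

@[simp] lemma annihilate_vacuum (a : ι) : annihilate a (vacuum ι) = 0 := by
  ext s
  simp [annihilate_apply, vacuum]

lemma inner_create_left (a : ι) (ψ φ : Fock ι) :
    inner ℂ (create a ψ) φ = inner ℂ ψ (annihilate a φ) := by
  rw [create, LinearMap.adjoint_inner_left]

lemma inner_annihilate_left (a : ι) (ψ φ : Fock ι) :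
    inner ℂ (annihilate a ψ) φ = inner ℂ ψ (create a φ) := by
  rw [create, LinearMap.adjoint_inner_right]

/-! ### Bilinears and pair operators -/

/-- The pair creation operator `∑ C_{ab} c_a† c_b†`. -/
def pairCreate (C : Matrix ι ι ℂ) : Module.End ℂ (Fock ι) :=
  ∑ a, ∑ b, C a b • (create a * create b)

/-- The pair annihilation operator `∑ conj(C_{ab}) c_b c_a`. -/
def pairAnnihilate (C : Matrix ι ι ℂ) : Module.End ℂ (Fock ι) :=
  ∑ a, ∑ b, star (C a b) • (annihilate b * annihilate a)

lemma bilinear_eq (T : Matrix ι ι ℂ) :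
    (bilinear T : Module.End ℂ (Fock ι)) = ∑ a, ∑ b, T a b • (create a * annihilate b) := rfl

lemma bilinear_apply (T : Matrix ι ι ℂ) (ψ : Fock ι) :
    bilinear T ψ = ∑ a, ∑ b, T a b • create a (annihilate b ψ) := by
  simp [bilinear]

lemma pairCreate_apply (C : Matrix ι ι ℂ) (ψ : Fock ι) :
    pairCreate C ψ = ∑ a, ∑ b, C a b • create a (create b ψ) := by
  simp [pairCreate]

lemma adjoint_pairCreate (C : Matrix ι ι ℂ) :
    LinearMap.adjoint (pairCreate C) = pairAnnihilate C := by
  simp only [pairCreate, pairAnnihilate, map_sum, map_smulₛₗ, LinearMap.adjoint_comp,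
    adjoint_create, Module.End.mul_eq_comp]
  rfl

lemma inner_pairCreate_left (C : Matrix ι ι ℂ) (ψ φ : Fock ι) :
    inner ℂ (pairCreate C ψ) φ = inner ℂ ψ (pairAnnihilate C φ) := by
  rw [← adjoint_pairCreate, LinearMap.adjoint_inner_right]

@[simp] lemma bilinear_vacuum (T : Matrix ι ι ℂ) : bilinear T (vacuum ι) = 0 := by
  simp [bilinear_apply]

lemma bilinear_sub (S T : Matrix ι ι ℂ) : bilinear (S - T) = bilinear S - bilinear T := by
  simp only [bilinear, Matrix.sub_apply, sub_smul, Finset.sum_sub_distrib]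

lemma bilinear_smul (z : ℂ) (T : Matrix ι ι ℂ) : bilinear (z • T) = z • bilinear T := by
  simp only [bilinear, Matrix.smul_apply, smul_eq_mul, mul_smul, Finset.smul_sum]

lemma bilinear_sum {κ : Type*} (s : Finset κ) (T : κ → Matrix ι ι ℂ) :
    bilinear (∑ i ∈ s, T i) = ∑ i ∈ s, bilinear (T i) := by
  classical
  induction s using Finset.induction_on with
  | empty => simp [bilinear]
  | insert i s hi ih =>
    rw [Finset.sum_insert hi, Finset.sum_insert hi, ← ih]
    simp only [bilinear, Matrix.add_apply, add_smul, Finset.sum_add_distrib]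

lemma pairCreate_add (C D : Matrix ι ι ℂ) : pairCreate (C + D) = pairCreate C + pairCreate D := by
  simp only [pairCreate, Matrix.add_apply, add_smul, Finset.sum_add_distrib]

lemma pairCreate_smul (z : ℂ) (C : Matrix ι ι ℂ) : pairCreate (z • C) = z • pairCreate C := by
  simp only [pairCreate, Matrix.smul_apply, smul_eq_mul, mul_smul, Finset.smul_sum]

lemma pairCreate_zero : pairCreate (0 : Matrix ι ι ℂ) = 0 := by
  simp [pairCreate]

lemma bilinear_mul_create (T : Matrix ι ι ℂ) (x : ι) :
    (bilinear T : Module.End ℂ (Fock ι)) * create x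
      = create x * bilinear T + ∑ a, T a x • create a := by
  have h : ∀ a b, (create a * annihilate b * create x : Module.End ℂ (Fock ι))
      = create x * (create a * annihilate b) + if b = x then create a else 0 := by
    intro a b
    rw [mul_assoc, annihilate_mul_create, mul_sub, ← mul_assoc, create_mul_create a x]
    split_ifs <;> noncomm_ring
  rw [bilinear_eq]
  simp only [Finset.sum_mul, Finset.mul_sum, smul_mul_assoc, mul_smul_comm, h, smul_add,
    Finset.sum_add_distrib]
  simp

lemma pairCreate_mul_create (C : Matrix ι ι ℂ) (x : ι) :
    pairCreate C * create x = create x * pairCreate C := by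
  have h : ∀ a b, (create a * create b * create x : Module.End ℂ (Fock ι))
      = create x * (create a * create b) := by
    intro a b
    rw [mul_assoc, create_mul_create b x, mul_neg, ← mul_assoc, create_mul_create a x]
    noncomm_ring
  simp only [pairCreate, Finset.sum_mul, Finset.mul_sum, smul_mul_assoc, mul_smul_comm, h]

lemma commute_pairCreate (C D : Matrix ι ι ℂ) : Commute (pairCreate C) (pairCreate D) := by
  have h : ∀ x, Commute (pairCreate C) (create x) := fun x => pairCreate_mul_create C x
  unfold pairCreate at *
  exact Commute.sum_right _ _ _ fun a _ => Commute.sum_right _ _ _ fun b _ =>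
    (((h a).mul_right (h b)).smul_right _)

/-- `[∑ T c†c, ∑ C c†c†] = ∑ (T C + C Tᵀ) c†c†`. -/
lemma bilinear_mul_pairCreate (T C : Matrix ι ι ℂ) :
    (bilinear T : Module.End ℂ (Fock ι)) * pairCreate C
      = pairCreate C * bilinear T + pairCreate (T * C + C * Tᵀ) := by
  have h : ∀ x y, (bilinear T : Module.End ℂ (Fock ι)) * (create x * create y)
      = create x * create y * bilinear T + ∑ a, T a x • (create a * create y)
        + ∑ a, T a y • (create x * create a) := by
    intro x y
    rw [← mul_assoc, bilinear_mul_create, add_mul, mul_assoc, bilinear_mul_create]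
    simp only [Finset.sum_mul, Finset.mul_sum, smul_mul_assoc, mul_smul_comm, mul_add, mul_assoc]
    abel
  simp only [pairCreate, Finset.mul_sum, mul_smul_comm, h, smul_add, Finset.sum_add_distrib,
    Finset.sum_mul, smul_mul_assoc, Matrix.add_apply, add_smul, add_assoc]
  congr 1
  congr 1
  · simp only [Matrix.mul_apply, Finset.sum_smul, Finset.smul_sum, smul_smul]
    rw [Finset.sum_comm]
    rw [Finset.sum_congr rfl fun y _ => Finset.sum_comm, Finset.sum_comm]
    refine Finset.sum_congr rfl fun a _ => Finset.sum_congr rfl fun b _ =>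
      Finset.sum_congr rfl fun c _ => by rw [mul_comm]
  · simp only [Matrix.mul_apply, Finset.sum_smul, Finset.smul_sum, smul_smul, Matrix.transpose_apply]
    refine Finset.sum_congr rfl fun a _ => Finset.sum_comm

/-- The creator can be contracted with either annihilator of the pair. Antisymmetry of `D` makes the
two contractions equal, whence the factor 2. -/
lemma pairAnnihilate_mul_create {D : Matrix ι ι ℂ} (hD : Dᵀ = -D) (x : ι) :
    pairAnnihilate D * create x
      = create x * pairAnnihilate D + (2 : ℂ) • ∑ b, star (D x b) • annihilate b := by
  have h : ∀ a b, (annihilate b * annihilate a * create x : Module.End ℂ (Fock ι))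
      = create x * (annihilate b * annihilate a) + ((if a = x then annihilate b else 0)
        - if b = x then annihilate a else 0) := by
    intro a b
    rw [mul_assoc, annihilate_mul_create, mul_sub, ← mul_assoc, annihilate_mul_create b x]
    split_ifs <;> noncomm_ring
  have hD' : ∀ a, D a x = - D x a := fun a => congrFun (congrFun hD x) a
  simp only [pairAnnihilate, Finset.sum_mul, Finset.mul_sum, smul_mul_assoc, mul_smul_comm, h,
    smul_add, smul_sub, Finset.sum_add_distrib, Finset.sum_sub_distrib]
  congr 1
  simp only [smul_ite, smul_zero, Finset.sum_ite_eq', Finset.mem_univ, if_true, hD', star_neg,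
    neg_smul, Finset.sum_neg_distrib, sub_neg_eq_add, two_smul]
  congr 1
  rw [Finset.sum_comm]
  simp

/-- Contracting both particles gives the scalar, contracting one gives the bilinear; antisymmetry of
`C` and `D` accounts for the multiplicities 2 and 4. When `C * Dᴴ` is a multiple of a projection the
bilinear counts particles, and the relation becomes that of raising and lowering operators of
`su(2)`. -/
lemma pairAnnihilate_mul_pairCreate {C D : Matrix ι ι ℂ} (hC : Cᵀ = -C) (hD : Dᵀ = -D) :
    pairAnnihilate D * pairCreate C
      = pairCreate C * pairAnnihilate D + (2 * (Dᴴ * C).trace) • 1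
        - (4 : ℂ) • (bilinear (C * Dᴴ) : Module.End ℂ (Fock ι)) := by
  have h : ∀ x y, pairAnnihilate D * (create x * create y)
      = create x * create y * pairAnnihilate D
        + (2 : ℂ) • ((∑ b, star (D y b) • (create x * annihilate b))
          + star (D x y) • 1 - ∑ b, star (D x b) • (create y * annihilate b)) := by
    intro x y
    rw [← mul_assoc, pairAnnihilate_mul_create hD, add_mul, mul_assoc,
      pairAnnihilate_mul_create hD]
    simp only [Finset.sum_mul, Finset.mul_sum, smul_mul_assoc, mul_smul_comm, mul_add,
      annihilate_mul_create, smul_sub, Finset.sum_sub_distrib, smul_add, mul_assoc]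
    simp only [smul_ite, smul_zero, Finset.sum_ite_eq', Finset.mem_univ, if_true]
    abel
  have hC' : ∀ a x, C a x = - C x a := fun a x => congrFun (congrFun hC x) a
  have hD' : ∀ a x, D a x = - D x a := fun a x => congrFun (congrFun hD x) a
  have h1 : ∑ x, ∑ y, C x y • ∑ b, star (D y b) • (create x * annihilate b : Module.End ℂ (Fock ι))
      = -bilinear (C * Dᴴ) := by
    simp only [bilinear_eq, Matrix.mul_apply, Finset.sum_smul, Finset.smul_sum, smul_smul,
      Matrix.conjTranspose_apply, ← Finset.sum_neg_distrib]
    refine Finset.sum_congr rfl fun a _ => ?_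
    rw [Finset.sum_comm]
    refine Finset.sum_congr rfl fun b _ => Finset.sum_congr rfl fun c _ => ?_
    rw [hD' b c]; simp
  have h2 : ∑ x, ∑ y, C x y • ∑ b, star (D x b) • (create y * annihilate b : Module.End ℂ (Fock ι))
      = bilinear (C * Dᴴ) := by
    simp only [bilinear_eq, Matrix.mul_apply, Finset.sum_smul, Finset.smul_sum, smul_smul,
      Matrix.conjTranspose_apply]
    rw [Finset.sum_comm]
    refine Finset.sum_congr rfl fun a _ => ?_
    rw [Finset.sum_comm]
    refine Finset.sum_congr rfl fun b _ => Finset.sum_congr rfl fun c _ => ?_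
    rw [hD' b c, hC' c a]; simp
  have h3 : ∑ x, ∑ y, C x y • star (D x y) • (1 : Module.End ℂ (Fock ι)) = (Dᴴ * C).trace • 1 := by
    simp only [Matrix.trace, Matrix.diag, Matrix.mul_apply, Finset.sum_smul, smul_smul,
      Matrix.conjTranspose_apply]
    rw [Finset.sum_comm]
    refine Finset.sum_congr rfl fun a _ => Finset.sum_congr rfl fun b _ => by rw [mul_comm]
  have h4 : pairAnnihilate D * pairCreate C
      = ∑ x, ∑ y, C x y • (pairAnnihilate D * (create x * create y)) := by
    simp only [pairCreate, Finset.mul_sum, mul_smul_comm]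
  have h5 : ∑ x, ∑ y, C x y • (create x * create y * pairAnnihilate D)
      = pairCreate C * pairAnnihilate D := by
    simp only [pairCreate, Finset.sum_mul, smul_mul_assoc]
  have h6 : ∀ α β γ δ : ι → ι → Module.End ℂ (Fock ι),
      ∑ x, ∑ y, C x y • (α x y + (2 : ℂ) • (β x y + γ x y - δ x y))
        = ∑ x, ∑ y, C x y • α x y + (2 : ℂ) • (∑ x, ∑ y, C x y • β x y
          + ∑ x, ∑ y, C x y • γ x y - ∑ x, ∑ y, C x y • δ x y) := by
    intro α β γ δ
    simp only [smul_add, smul_sub, Finset.sum_add_distrib, Finset.sum_sub_distrib,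
      Finset.smul_sum, smul_comm _ (2 : ℂ)]
  simp only [h4, h, h6, h1, h2, h3, h5]
  module

/-! ### Quasi-spin -/

@[simp] lemma pairAnnihilate_vacuum (C : Matrix ι ι ℂ) : pairAnnihilate C (vacuum ι) = 0 := by
  simp [pairAnnihilate]

/-- `bilinear T` acts as a derivation on pair states. -/
lemma bilinear_pairCreate_vacuum (T C : Matrix ι ι ℂ) :
    bilinear T (pairCreate C (vacuum ι)) = pairCreate (T * C + C * Tᵀ) (vacuum ι) := by
  have := LinearMap.congr_fun (bilinear_mul_pairCreate T C) (vacuum ι)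
  simpa using this

/-- The commutator of a bilinear with a pair operator is again a pair operator, and pair operators
commute, so each of the `n` factors contributes the same term. At `n = 0` the truncated exponent is
harmless because its coefficient vanishes. -/
lemma bilinear_pairCreate_pow (T C : Matrix ι ι ℂ) (n : ℕ) (ψ : Fock ι) :
    bilinear T ((pairCreate C ^ n) ψ) = (pairCreate C ^ n) (bilinear T ψ)
      + (n : ℂ) • (pairCreate C ^ (n - 1)) (pairCreate (T * C + C * Tᵀ) ψ) := by
  induction n with
  | zero => simp
  | succ n ih =>
    have h1 := LinearMap.congr_fun (bilinear_mul_pairCreate T C) ((pairCreate C ^ n) ψ)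
    simp only [Module.End.mul_apply, LinearMap.add_apply] at h1
    rw [pow_succ', Module.End.mul_apply, h1, ih, map_add, map_smul]
    have h2 : pairCreate (T * C + C * Tᵀ) ((pairCreate C ^ n) ψ)
        = (pairCreate C ^ n) (pairCreate (T * C + C * Tᵀ) ψ) :=
      LinearMap.congr_fun ((commute_pairCreate _ C).pow_right n).eq ψ
    rw [h2, Module.End.mul_apply]
    rcases n with _ | n
    · simp
    · rw [Nat.add_sub_cancel, Nat.add_sub_cancel, ← Module.End.mul_apply (pairCreate C)
        (pairCreate C ^ n), ← pow_succ', Nat.cast_succ (n + 1)]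
      module

/-- States built from `n` identical pairs. -/
lemma bilinear_pairCreate_pow_vacuum (T C : Matrix ι ι ℂ) (n : ℕ) :
    bilinear T ((pairCreate C ^ n) (vacuum ι))
      = (n : ℂ) • (pairCreate C ^ (n - 1)) (pairCreate (T * C + C * Tᵀ) (vacuum ι)) := by
  rw [bilinear_pairCreate_pow]; simp

lemma inner_pairCreate_vacuum {C D : Matrix ι ι ℂ} (hC : Cᵀ = -C) (hD : Dᵀ = -D) :
    inner ℂ (pairCreate D (vacuum ι)) (pairCreate C (vacuum ι)) = 2 * (Dᴴ * C).trace := by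
  rw [inner_pairCreate_left]
  have := LinearMap.congr_fun (pairAnnihilate_mul_pairCreate hC hD) (vacuum ι)
  simp only [Module.End.mul_apply, LinearMap.add_apply, LinearMap.sub_apply, LinearMap.smul_apply,
    pairAnnihilate_vacuum, bilinear_vacuum, map_zero, smul_zero, sub_zero, zero_add,
    Module.End.one_apply] at this
  rw [this, inner_smul_right]
  simp

lemma trace_conjTranspose_mul_self_re (C : Matrix ι ι ℂ) :
    (Cᴴ * C).trace = ((∑ a, ∑ b, ‖C a b‖ ^ 2 : ℝ) : ℂ) := by
  rw [Finset.sum_comm]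
  simp only [Matrix.trace, Matrix.diag, Matrix.mul_apply, Matrix.conjTranspose_apply]
  push_cast
  refine Finset.sum_congr rfl fun a _ => Finset.sum_congr rfl fun b _ => ?_
  rw [← Complex.conj_mul']; rfl

lemma norm_sq_pairCreate_vacuum {C : Matrix ι ι ℂ} (hC : Cᵀ = -C) :
    ‖pairCreate C (vacuum ι)‖ ^ 2 = 2 * ∑ a, ∑ b, ‖C a b‖ ^ 2 := by
  have h := inner_pairCreate_vacuum hC hC
  rw [trace_conjTranspose_mul_self_re, inner_self_eq_norm_sq_to_K] at h
  refine Complex.ofReal_injective ?_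
  push_cast at h ⊢
  exact h

/-- On antisymmetric matrices the squared norm of the pair state is twice the squared Frobenius
norm, so the difference of the matrices vanishes entrywise. -/
lemma pairCreate_vacuum_injective {C D : Matrix ι ι ℂ} (hC : Cᵀ = -C) (hD : Dᵀ = -D)
    (h : pairCreate C (vacuum ι) = pairCreate D (vacuum ι)) : C = D := by
  have h1 : pairCreate (C + (-1 : ℂ) • D) (vacuum ι) = 0 := by
    rw [pairCreate_add, pairCreate_smul]; simp [h]
  have h2 := norm_sq_pairCreate_vacuum (C := C + (-1 : ℂ) • D)
    (by rw [Matrix.transpose_add, Matrix.transpose_smul, hC, hD]; module)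
  rw [h1] at h2
  simp only [norm_zero, ne_eq, OfNat.ofNat_ne_zero, not_false_eq_true, zero_pow, zero_eq_mul,
    false_or] at h2
  rw [Finset.sum_eq_zero_iff_of_nonneg (fun a _ => by positivity)] at h2
  ext a b
  have h3 := h2 a (Finset.mem_univ _)
  rw [Finset.sum_eq_zero_iff_of_nonneg (fun a _ => by positivity)] at h3
  have h4 := h3 b (Finset.mem_univ _)
  simp only [Matrix.add_apply, Matrix.smul_apply, smul_eq_mul, ne_eq, OfNat.ofNat_ne_zero,
    not_false_eq_true, pow_eq_zero_iff, norm_eq_zero] at h4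
  linear_combination h4

/-- `W` pairs up the states in the range of the projection `P`, with the same amplitude `√κ` for
every pair. -/
structure IsUniformPairing (P W : Matrix ι ι ℂ) (κ : ℝ) (M : ℕ) : Prop where
  antisymm : Wᵀ = -W
  mul_left : P * W = W
  mul_conjTranspose : W * Wᴴ = (κ : ℂ) • P
  trace : P.trace = 2 * M

namespace IsUniformPairing

variable {P W : Matrix ι ι ℂ} {κ : ℝ} {M : ℕ} (h : IsUniformPairing P W κ M)

include h

lemma mul_right : W * Pᵀ = W := by
  have := congrArg Matrix.transpose h.mul_left
  rwa [Matrix.transpose_mul, h.antisymm, Matrix.neg_mul, neg_inj] at this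

lemma trace_mul : (Wᴴ * W).trace = 2 * M * κ := by
  rw [Matrix.trace_mul_comm, h.mul_conjTranspose, Matrix.trace_smul, h.trace, smul_eq_mul]; ring

/-- Moving the annihilator through one creator costs `4 κ (M - number)`. After `j` creators the
number is `r + 2 j`, and the coefficient is the sum of this arithmetic progression for `j = 0, …,
m`. -/
lemma pairAnnihilate_pow {χ : Fock ι} {r : ℂ} (hη : pairAnnihilate W χ = 0)
    (hr : bilinear P χ = r • χ) (m : ℕ) :
    pairAnnihilate W ((pairCreate W ^ (m + 1)) χ)
      = (4 * κ * (m + 1) * (M - r - m) : ℂ) • (pairCreate W ^ m) χ := by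
  have hN : ∀ m : ℕ, bilinear P ((pairCreate W ^ m) χ) = (r + 2 * m) • (pairCreate W ^ m) χ := by
    intro m
    rw [bilinear_pairCreate_pow, hr, h.mul_left, h.mul_right, map_smul, ← two_smul ℂ W,
      pairCreate_smul, LinearMap.smul_apply, map_smul]
    rcases m with _ | m
    · simp
    · rw [Nat.add_sub_cancel, ← Module.End.mul_apply, ← pow_succ]
      module
  have hc : ∀ φ, pairAnnihilate W (pairCreate W φ)
      = pairCreate W (pairAnnihilate W φ) + (4 * κ * M : ℂ) • φ - (4 * κ : ℂ) • bilinear P φ := by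
    intro φ
    have := LinearMap.congr_fun (pairAnnihilate_mul_pairCreate h.antisymm h.antisymm) φ
    rw [h.trace_mul, h.mul_conjTranspose, bilinear_smul] at this
    simp only [Module.End.mul_apply, LinearMap.add_apply, LinearMap.sub_apply,
      LinearMap.smul_apply, Module.End.one_apply] at this
    rw [this]; module
  induction m with
  | zero => simp only [zero_add, pow_one, pow_zero, Module.End.one_apply, hc, hη, hr]; simp; module
  | succ m ih =>
    rw [pow_succ', Module.End.mul_apply, hc, ih, hN, map_smul, ← Module.End.mul_apply, ← pow_succ']
    push_cast
    module

lemma norm_sq_pow_succ {χ : Fock ι} {r : ℝ} (hη : pairAnnihilate W χ = 0)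
    (hr : bilinear P χ = (r : ℂ) • χ) (m : ℕ) :
    ‖(pairCreate W ^ (m + 1)) χ‖ ^ 2
      = 4 * κ * (m + 1) * (M - r - m) * ‖(pairCreate W ^ m) χ‖ ^ 2 := by
  have h1 : (inner ℂ ((pairCreate W ^ (m + 1)) χ) ((pairCreate W ^ (m + 1)) χ) : ℂ)
      = (4 * κ * (m + 1) * (M - r - m) : ℂ) *
        inner ℂ ((pairCreate W ^ m) χ) ((pairCreate W ^ m) χ) := by
    nth_rw 1 [pow_succ', Module.End.mul_apply]
    rw [inner_pairCreate_left, h.pairAnnihilate_pow hη hr, inner_smul_right]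
  rw [inner_self_eq_norm_sq_to_K, inner_self_eq_norm_sq_to_K] at h1
  refine Complex.ofReal_injective ?_
  push_cast at h1 ⊢
  exact h1

lemma norm_sq_pow_vacuum_succ (m : ℕ) :
    ‖(pairCreate W ^ (m + 1)) (vacuum ι)‖ ^ 2
      = 4 * κ * (m + 1) * (M - m) * ‖(pairCreate W ^ m) (vacuum ι)‖ ^ 2 := by
  have := h.norm_sq_pow_succ (r := 0) (pairAnnihilate_vacuum W) (by simp) m
  simpa using this

lemma norm_sq_pow_vacuum_pos (hκ : 0 < κ) {n : ℕ} (hn : n ≤ M) :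
    0 < ‖(pairCreate W ^ n) (vacuum ι)‖ ^ 2 := by
  induction n with
  | zero => simp
  | succ n ih =>
    rw [h.norm_sq_pow_vacuum_succ]
    have : (n : ℝ) + 1 ≤ M := by exact_mod_cast hn
    have h1 : (0 : ℝ) < M - n := by linarith
    have h2 := ih (by omega)
    positivity

/-- Norm of a state of `n` pairs, one of which is not in the condensate. -/
lemma norm_sq_pow_pairCreate {F : Matrix ι ι ℂ} (hF : Fᵀ = -F)
    (hPF : P * F = F) {γ : ℂ} (hγ : (Wᴴ * F).trace = 2 * M * κ * γ) (n : ℕ) :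
    (M - 1) * (n + 1) ^ 2 * ‖(pairCreate W ^ n) (pairCreate F (vacuum ι))‖ ^ 2
        * ‖pairCreate W (vacuum ι)‖ ^ 2
      = ‖(pairCreate W ^ (n + 1)) (vacuum ι)‖ ^ 2 *
        ((n + 1) * (M - (n + 1)) * (‖pairCreate F (vacuum ι)‖ ^ 2
          - ‖γ‖ ^ 2 * ‖pairCreate W (vacuum ι)‖ ^ 2)
          + (M - 1) * (n + 1) ^ 2 * ‖γ‖ ^ 2 * ‖pairCreate W (vacuum ι)‖ ^ 2) := by
  -- `F'` is the component of `F` orthogonal to `W`. Its pair state `χ` is killed by the pair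
  -- annihilator and so is the bottom of a second ladder, orthogonal to that of the vacuum.
  set F' := F + (-γ) • W with hF'
  set χ := pairCreate F' (vacuum ι) with hχ
  have hFanti : F'ᵀ = -F' := by
    rw [hF', Matrix.transpose_add, Matrix.transpose_smul, hF, h.antisymm]; module
  have hPF' : P * F' = F' := by
    rw [hF', Matrix.mul_add, Matrix.mul_smul, hPF, h.mul_left]
  have hF'P : F' * Pᵀ = F' := by
    have := congrArg Matrix.transpose hPF'
    rwa [Matrix.transpose_mul, hFanti, Matrix.neg_mul, neg_inj] at this
  have hη : pairAnnihilate W χ = 0 := by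
    have := LinearMap.congr_fun (pairAnnihilate_mul_pairCreate hFanti h.antisymm) (vacuum ι)
    simp only [Module.End.mul_apply, LinearMap.add_apply, LinearMap.sub_apply,
      LinearMap.smul_apply, pairAnnihilate_vacuum, bilinear_vacuum, map_zero, smul_zero, sub_zero,
      zero_add, Module.End.one_apply] at this
    rw [hχ, this, hF', Matrix.mul_add, Matrix.mul_smul, Matrix.trace_add, Matrix.trace_smul, hγ,
      h.trace_mul, smul_eq_mul]
    have : 2 * (2 * M * κ * γ + -γ * (2 * M * κ) : ℂ) = 0 := by ring
    rw [this, zero_smul]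
  have hr : bilinear P χ = ((2 : ℝ) : ℂ) • χ := by
    rw [hχ, bilinear_pairCreate_vacuum, hPF', hF'P, ← two_smul ℂ F', pairCreate_smul]; simp
  have horth : ∀ m, inner ℂ ((pairCreate W ^ (m + 1)) (vacuum ι)) ((pairCreate W ^ m) χ) = 0 := by
    intro m
    induction m with
    | zero =>
      rw [pow_succ', Module.End.mul_apply, inner_pairCreate_left]; simp [hη]
    | succ m ih =>
      rw [pow_succ', Module.End.mul_apply, inner_pairCreate_left, h.pairAnnihilate_pow hη hr,
        inner_smul_right, ih, mul_zero]
  have hsplit : ∀ m, (pairCreate W ^ m) (pairCreate F (vacuum ι))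
      = γ • (pairCreate W ^ (m + 1)) (vacuum ι) + (pairCreate W ^ m) χ := by
    intro m
    have : F = γ • W + F' := by rw [hF']; module
    rw [this, pairCreate_add, pairCreate_smul, LinearMap.add_apply, LinearMap.smul_apply, map_add,
      map_smul, pow_succ, Module.End.mul_apply]
  have hnorm : ∀ m, ‖(pairCreate W ^ m) (pairCreate F (vacuum ι))‖ ^ 2
      = ‖γ‖ ^ 2 * ‖(pairCreate W ^ (m + 1)) (vacuum ι)‖ ^ 2 + ‖(pairCreate W ^ m) χ‖ ^ 2 := by
    intro m
    rw [hsplit, sq, sq ‖(pairCreate W ^ m) χ‖,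
      norm_add_sq_eq_norm_sq_add_norm_sq_of_inner_eq_zero (𝕜 := ℂ) _ _
        (by rw [inner_smul_left, horth, mul_zero]), norm_smul]
    ring
  -- The ladder over `χ` starts with two particles present, `r = 2`, the other one with none. Their
  -- ratio telescopes to a factor linear in `m`; it is written without division so that `M = 1` is
  -- allowed.
  have hrec : ∀ m : ℕ, 4 * κ * (m + 1) * M * (M - 1) * ‖(pairCreate W ^ m) χ‖ ^ 2
      = (M - (m + 1)) * ‖χ‖ ^ 2 * ‖(pairCreate W ^ (m + 1)) (vacuum ι)‖ ^ 2 := by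
    intro m
    induction m with
    | zero =>
      rw [h.norm_sq_pow_vacuum_succ]; simp; ring
    | succ m ih =>
      rw [h.norm_sq_pow_succ hη hr, h.norm_sq_pow_vacuum_succ]
      push_cast
      linear_combination (4 * κ * (m + 2) * (M - 2 - m)) * ih
  have ha : ‖pairCreate W (vacuum ι)‖ ^ 2 = 4 * κ * M := by
    have := h.norm_sq_pow_vacuum_succ 0
    simpa using this
  have h0 := hnorm 0
  simp only [pow_zero, Module.End.one_apply, zero_add, pow_one] at h0
  rw [h0, hnorm n, ha]
  linear_combination (n + 1) * hrec n

end IsUniformPairing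

/-! ### Graded sectors of Fock space -/

/-- States in which the additive charges `g` of the occupied single-particle states sum to `γ`. -/
def gradedSector {G : Type*} [AddCommGroup G] (g : ι → G) (γ : G) : Submodule ℂ (Fock ι) where
  carrier := {ψ | ∀ s, ψ s ≠ 0 → ∑ x ∈ s, g x = γ}
  zero_mem' := by intro s hs; simp at hs
  add_mem' := by
    intro ψ φ hψ hφ s hs
    by_cases h : ψ s = 0
    · exact hφ s fun h' => hs (by simp [h, h'])
    · exact hψ s h
  smul_mem' := by
    intro z ψ hψ s hs
    exact hψ s fun h => hs (by simp [h])

section Graded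

variable {G : Type*} [AddCommGroup G] {g : ι → G} {γ : G} {ψ : Fock ι}

lemma mem_gradedSector : ψ ∈ gradedSector g γ ↔ ∀ s, ψ s ≠ 0 → ∑ x ∈ s, g x = γ := Iff.rfl

lemma create_mem_gradedSector (hψ : ψ ∈ gradedSector g γ) (a : ι) :
    create a ψ ∈ gradedSector g (γ + g a) := by
  intro s hs
  rw [create_apply] at hs
  split_ifs at hs with ha
  · rw [← hψ _ (right_ne_zero_of_mul hs), Finset.sum_erase_add _ _ ha]
  · exact absurd rfl hs

lemma annihilate_mem_gradedSector (hψ : ψ ∈ gradedSector g γ) (a : ι) :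
    annihilate a ψ ∈ gradedSector g (γ - g a) := by
  intro s hs
  rw [annihilate_apply] at hs
  split_ifs at hs with ha
  · exact absurd rfl hs
  · rw [← hψ _ (right_ne_zero_of_mul hs), Finset.sum_insert ha]; abel

lemma vacuum_mem_gradedSector : vacuum ι ∈ gradedSector g 0 := by
  intro s hs
  have : s = ∅ := by
    by_contra h
    exact hs (by simp [vacuum, h])
  simp [this]

lemma bilinear_mem_gradedSector {T : Matrix ι ι ℂ} (hT : ∀ a b, T a b ≠ 0 → g a = g b)
    (hψ : ψ ∈ gradedSector g γ) : bilinear T ψ ∈ gradedSector g γ := by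
  rw [bilinear_apply]
  refine Submodule.sum_mem _ fun a _ => Submodule.sum_mem _ fun b _ => ?_
  by_cases h : T a b = 0
  · simp [h]
  · refine Submodule.smul_mem _ _ ?_
    have := create_mem_gradedSector (annihilate_mem_gradedSector hψ b) a
    rwa [hT a b h, sub_add_cancel] at this

lemma pairCreate_mem_gradedSector {C : Matrix ι ι ℂ} {δ : G}
    (hC : ∀ a b, C a b ≠ 0 → g a + g b = δ) (hψ : ψ ∈ gradedSector g γ) :
    pairCreate C ψ ∈ gradedSector g (γ + δ) := by
  rw [pairCreate_apply]
  refine Submodule.sum_mem _ fun a _ => Submodule.sum_mem _ fun b _ => ?_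
  by_cases h : C a b = 0
  · simp [h]
  · refine Submodule.smul_mem _ _ ?_
    have := create_mem_gradedSector (create_mem_gradedSector hψ b) a
    rwa [add_assoc, add_comm (g b), hC a b h] at this

end Graded

/-- With charge 1 on every state the grading counts particles. Grading by crystal momentum is the
other instance, so one set of invariance lemmas serves both. -/
lemma mem_numberSector_iff {N : ℕ} {ψ : Fock ι} :
    ψ ∈ numberSector ι N ↔ ψ ∈ gradedSector (fun _ => (1 : ℤ)) (N : ℤ) := by
  simp [numberSector, mem_gradedSector]

lemma annihilate_mem_numberSector {N : ℕ} {ψ : Fock ι} (hψ : ψ ∈ numberSector ι (N + 1)) (a : ι) :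
    annihilate a ψ ∈ numberSector ι N := by
  rw [mem_numberSector_iff] at *
  simpa using annihilate_mem_gradedSector hψ a

lemma pairCreate_pow_vacuum_mem_numberSector (C : Matrix ι ι ℂ) (n : ℕ) :
    (pairCreate C ^ n) (vacuum ι) ∈ numberSector ι (2 * n) := by
  rw [mem_numberSector_iff]
  induction n with
  | zero => simpa using vacuum_mem_gradedSector
  | succ n ih =>
    rw [pow_succ', Module.End.mul_apply]
    have := pairCreate_mem_gradedSector (C := C) (δ := 2) (fun _ _ _ => by norm_num) ih
    push_cast at this ⊢
    rwa [mul_add, mul_one]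

lemma number_apply {N : ℕ} {ψ : Fock ι} (hψ : ψ ∈ numberSector ι N) :
    ∑ a, create a (annihilate a ψ) = (N : ℂ) • ψ := by
  ext s
  have h : ∀ a, create a (annihilate a ψ) s = if a ∈ s then ψ s else 0 := by
    intro a
    rw [create_apply, annihilate_apply]
    by_cases ha : a ∈ s
    · simp [ha, fermiSign_erase_self, ← mul_assoc, fermiSign_mul_self]
    · simp [ha]
  simp only [WithLp.ofLp_sum, Finset.sum_apply, h, PiLp.smul_apply, smul_eq_mul]
  by_cases hs : ψ s = 0
  · simp [hs]
  · simp [hψ s hs]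

lemma eq_smul_vacuum {ψ : Fock ι} (hψ : ψ ∈ numberSector ι 0) : ψ = ψ ∅ • vacuum ι := by
  ext s
  by_cases h : s = ∅
  · simp [h, vacuum]
  · have : ψ s = 0 := by
      by_contra h'
      exact h (Finset.card_eq_zero.mp (hψ s h'))
    simp [vacuum, h, this]

/-- Every two-particle state is created by a pair operator. -/
lemma exists_pairCreate_vacuum {ψ : Fock ι} (hψ : ψ ∈ numberSector ι 2) :
    ∃ C : Matrix ι ι ℂ, Cᵀ = -C ∧ ψ = pairCreate C (vacuum ι) := by
  -- The wave function is read off by removing two particles. Since `∑ c_a† c_a` acts as 2, the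
  -- factor `1 / 2` restores the state.
  set β : ι → ι → ℂ := fun a b => annihilate b (annihilate a ψ) ∅ with hβ
  refine ⟨Matrix.of fun a b => (1 / 2) * β a b, ?_, ?_⟩
  · ext a b
    have := LinearMap.congr_fun (annihilate_mul_annihilate a b) ψ
    simp only [Module.End.mul_apply, LinearMap.neg_apply] at this
    simp [hβ, this]
  · have h2 := number_apply hψ
    have h1 : ∀ a, annihilate a ψ = ∑ b, β a b • create b (vacuum ι) := by
      intro a
      have h := number_apply (annihilate_mem_numberSector hψ a)
      rw [Nat.cast_one, one_smul] at h
      rw [← h]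
      refine Finset.sum_congr rfl fun b _ => ?_
      rw [eq_smul_vacuum (annihilate_mem_numberSector (annihilate_mem_numberSector hψ a) b), map_smul]
    have h3 : ψ = (1 / 2 : ℂ) • ((2 : ℕ) : ℂ) • ψ := by simp
    rw [h3, ← h2, pairCreate_apply, Finset.smul_sum]
    refine Finset.sum_congr rfl fun a _ => ?_
    rw [h1 a, map_sum, Finset.smul_sum]
    refine Finset.sum_congr rfl fun b _ => ?_
    rw [map_smul, smul_smul, Matrix.of_apply]

/-! ### Filled subspaces -/

lemma inner_self_eq_ofReal (ψ : Fock ι) : inner ℂ ψ ψ = ((‖ψ‖ ^ 2 : ℝ) : ℂ) := by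
  rw [inner_self_eq_norm_sq_to_K]
  push_cast
  rfl

/-- A Gram matrix turns the expectation value into a sum of squared norms, so its vanishing forces
every single annihilation condition. -/
lemma inner_bilinear_conjTranspose_mul (A : Matrix ι ι ℂ) (ψ : Fock ι) :
    inner ℂ ψ (bilinear (Aᴴ * A) ψ) = ((∑ e, ‖∑ b, A e b • annihilate b ψ‖ ^ 2 : ℝ) : ℂ) := by
  have h : bilinear (Aᴴ * A) ψ = ∑ e, ∑ a, star (A e a) • create a (∑ b, A e b • annihilate b ψ) := by
    rw [bilinear_apply]
    simp only [Matrix.mul_apply, Matrix.conjTranspose_apply, Finset.sum_smul, map_sum, map_smul,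
      Finset.smul_sum, smul_smul]
    rw [Finset.sum_comm' (s := Finset.univ) (t := fun _ => Finset.univ) (t' := Finset.univ)
      (s' := fun _ => Finset.univ) (by simp)]
    rw [Finset.sum_congr rfl fun b _ => Finset.sum_congr rfl fun a _ => rfl]
    rw [Finset.sum_comm]
    rw [Finset.sum_congr rfl fun a _ => Finset.sum_comm, Finset.sum_comm]
  rw [h, inner_sum]
  rw [Complex.ofReal_sum]
  refine Finset.sum_congr rfl fun e _ => ?_
  rw [← inner_self_eq_ofReal, inner_sum, sum_inner]
  refine Finset.sum_congr rfl fun a _ => ?_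
  rw [inner_smul_right, inner_smul_left, inner_annihilate_left]
  rfl

/-- The complement `1 - P` is its own Gram matrix, so the family of annihilation conditions is
equivalent to the vanishing of one number operator on `ψ`. -/
lemma mem_supportedOn_iff {P : Matrix ι ι ℂ} (hP : P.IsHermitian) (hPP : P * P = P) {ψ : Fock ι} :
    ψ ∈ supportedOn P ↔ bilinear (1 - P) ψ = 0 := by
  have hK : (1 - P)ᴴ * (1 - P) = 1 - P := by
    rw [Matrix.conjTranspose_sub, hP.eq, Matrix.conjTranspose_one]
    simp [Matrix.mul_sub, Matrix.sub_mul, hPP]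
  constructor
  · intro h
    rw [bilinear_apply]
    refine Finset.sum_eq_zero fun a _ => ?_
    rw [← map_zero (create a), ← h a, map_sum]
    simp
  · intro h a
    have h1 := inner_bilinear_conjTranspose_mul (1 - P) ψ
    rw [hK, h, inner_zero_right, eq_comm, Complex.ofReal_eq_zero,
      Finset.sum_eq_zero_iff_of_nonneg fun _ _ => by positivity] at h1
    simpa using h1 a (Finset.mem_univ _)

lemma pairCreate_pow_vacuum_mem_supportedOn {P C : Matrix ι ι ℂ} (hP : P.IsHermitian)
    (hPP : P * P = P) (hC : Cᵀ = -C) (hPC : P * C = C) (n : ℕ) :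
    (pairCreate C ^ n) (vacuum ι) ∈ supportedOn P := by
  have hCP : C * Pᵀ = C := by
    have := congrArg Matrix.transpose hPC
    rwa [Matrix.transpose_mul, hC, Matrix.neg_mul, neg_inj] at this
  rw [mem_supportedOn_iff hP hPP, bilinear_pairCreate_pow_vacuum, Matrix.sub_mul, hPC,
    Matrix.transpose_sub, Matrix.mul_sub, hCP]
  simp [pairCreate_zero]

/-- The completely filled state is an eigenstate of every bilinear within the filled subspace. -/
lemma bilinear_apply_of_filled {P T : Matrix ι ι ℂ} (hP : P.IsHermitian) (hPP : P * P = P)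
    (hT : P * T = T) {N : ℕ} (hN : P.trace = N) {ψ : Fock ι} (hψ : ψ ∈ supportedOn P)
    (hψN : ψ ∈ numberSector ι N) : bilinear T ψ = T.trace • ψ := by
  -- Opposite operator ordering: `c_a† c_b = δ_{ab} - c_b c_a†`.
  have hcr : ∀ S : Matrix ι ι ℂ, bilinear S ψ
      = S.trace • ψ - ∑ b, annihilate b (∑ a, S a b • create a ψ) := by
    intro S
    have h : ∀ a b, annihilate b (create a ψ)
        = (if b = a then ψ else 0) - create a (annihilate b ψ) := by
      intro a b
      have := LinearMap.congr_fun (annihilate_mul_create b a) ψ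
      simp only [Module.End.mul_apply, LinearMap.sub_apply] at this
      rw [this]
      split_ifs <;> simp
    simp only [map_sum, map_smul, h, smul_sub, Finset.sum_sub_distrib, bilinear_apply]
    simp only [smul_ite, smul_zero, Finset.sum_ite_eq, Finset.mem_univ, if_true]
    rw [← Finset.sum_smul, Finset.sum_comm, Matrix.trace]
    simp
  have h1 : bilinear P ψ = (N : ℂ) • ψ := by
    have h2 := (mem_supportedOn_iff hP hPP).mp hψ
    rw [bilinear_sub, LinearMap.sub_apply, sub_eq_zero] at h2
    rw [← h2, ← number_apply hψN, bilinear_apply]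
    refine Finset.sum_congr rfl fun a _ => ?_
    simp [Matrix.one_apply]
  -- The particle number equals the rank of `P`, so the operator counting holes in the range of `P`
  -- gives zero. Its expectation is a sum of squares, hence no further particle can be created in
  -- that range.
  have h2 : ∀ e, ∑ a, P a e • create a ψ = 0 := by
    have h3 := hcr P
    rw [h1, hN, eq_comm, sub_eq_self] at h3
    have h4 : ∑ b, annihilate b (∑ a, P a b • create a ψ)
        = ∑ e, ∑ b, star (P b e) • annihilate b (∑ a, P a e • create a ψ) := by
      have : ∀ b, ∑ a, P a b • create a ψ = ∑ e, P e b • ∑ a, P a e • create a ψ := by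
        intro b
        conv_lhs => rw [← hPP]
        simp only [Matrix.mul_apply, Finset.sum_smul, Finset.smul_sum, smul_smul]
        rw [Finset.sum_comm]
        simp only [mul_comm]
      rw [Finset.sum_congr rfl fun b _ => congrArg (annihilate b) (this b), Finset.sum_comm]
      refine Finset.sum_congr rfl fun b _ => ?_
      rw [map_sum]
      refine Finset.sum_congr rfl fun e _ => ?_
      rw [map_smul, hP.apply]
    rw [h4] at h3
    have h5 : ∑ e, ‖∑ a, P a e • create a ψ‖ ^ 2 = 0 := by
      have h6 := congrArg (fun φ => inner ℂ ψ φ) h3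
      simp only [inner_sum, inner_smul_right, inner_zero_right] at h6
      have h7 : ((∑ e, ‖∑ a, P a e • create a ψ‖ ^ 2 : ℝ) : ℂ) = 0 := by
        rw [← h6]
        rw [Complex.ofReal_sum]
        refine Finset.sum_congr rfl fun e _ => ?_
        rw [← inner_self_eq_ofReal]
        conv_lhs => rw [sum_inner]
        refine Finset.sum_congr rfl fun b _ => ?_
        rw [inner_smul_left, inner_create_left]
        rfl
      exact_mod_cast h7
    rw [Finset.sum_eq_zero_iff_of_nonneg fun _ _ => by positivity] at h5
    intro e
    simpa using h5 e (Finset.mem_univ _)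
  rw [hcr T]
  have h3 : ∀ b, ∑ a, T a b • create a ψ = 0 := by
    intro b
    have : ∑ a, T a b • create a ψ = ∑ e, T e b • ∑ a, P a e • create a ψ := by
      conv_lhs => rw [← hT]
      simp only [Matrix.mul_apply, Finset.sum_smul, Finset.smul_sum, smul_smul]
      rw [Finset.sum_comm]
      simp only [mul_comm]
    rw [this]
    simp [h2]
  simp [h3]

/-! ### Projection onto the states of a filled subspace -/

lemma aeval_mul_of_mul_eq {A A' B : Module.End ℂ (Fock ι)} (h : A * B = B * A')
    (p : Polynomial ℂ) : Polynomial.aeval A p * B = B * Polynomial.aeval A' p := by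
  induction p using Polynomial.induction_on' with
  | add p q hp hq => simp only [map_add, add_mul, mul_add, hp, hq]
  | monomial n z =>
    have hn : A ^ n * B = B * A' ^ n := (SemiconjBy.pow_right (a := B) (x := A') (y := A) h.symm n).eq.symm
    simp only [Polynomial.aeval_monomial, ← Algebra.smul_def, smul_mul_assoc, mul_smul_comm, hn]

lemma aeval_mem {S : Submodule ℂ (Fock ι)} {A : Module.End ℂ (Fock ι)} (h : ∀ ψ ∈ S, A ψ ∈ S)
    (p : Polynomial ℂ) {ψ : Fock ι} (hψ : ψ ∈ S) : Polynomial.aeval A p ψ ∈ S := by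
  induction p using Polynomial.induction_on' with
  | add p q hp hq => simpa using S.add_mem hp hq
  | monomial n z =>
    simp only [Polynomial.aeval_monomial, ← Algebra.smul_def, LinearMap.smul_apply]
    refine S.smul_mem _ ?_
    induction n with
    | zero => simpa
    | succ n ih => rw [pow_succ', Module.End.mul_apply]; exact h _ ih

/-- The creation operator of the single-particle state `v`. -/
def createVec (v : ι → ℂ) : Module.End ℂ (Fock ι) := ∑ a, v a • create a

lemma bilinear_mul_createVec (T : Matrix ι ι ℂ) (v : ι → ℂ) :
    (bilinear T : Module.End ℂ (Fock ι)) * createVec v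
      = createVec v * bilinear T + createVec (T *ᵥ v) := by
  simp only [createVec, Finset.mul_sum, mul_smul_comm, bilinear_mul_create, smul_add,
    Finset.sum_add_distrib, Finset.sum_mul, smul_mul_assoc, Matrix.mulVec, dotProduct,
    Finset.sum_smul, Finset.smul_sum, smul_smul]
  congr 1
  rw [Finset.sum_comm]
  simp only [mul_comm]

/-- In a sector with `N` particles, the number of particles in the range of a projection is one of
`0, …, N`. -/
lemma aeval_descPochhammer_bilinear {K : Matrix ι ι ℂ} (hK : K * K = K) {N : ℕ} {ψ : Fock ι}
    (hψ : ψ ∈ numberSector ι N) :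
    Polynomial.aeval (A := Module.End ℂ (Fock ι)) (bilinear K) (descPochhammer ℂ (N + 1)) ψ = 0 := by
  induction N generalizing ψ with
  | zero =>
    rw [eq_smul_vacuum hψ]
    simp
  | succ N ih =>
    set A : Module.End ℂ (Fock ι) := bilinear K with hA
    -- A particle added in the range of `K` raises the count by one. The shifted polynomial still
    -- contains the polynomial of the induction hypothesis as a factor.
    have h1 : ∀ v φ, K *ᵥ v = v → φ ∈ numberSector ι N →
        Polynomial.aeval A (descPochhammer ℂ (N + 1 + 1)) (createVec v φ) = 0 := by
      intro v φ hv hφ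
      have h : A * createVec v = createVec v * (A + 1) := by
        rw [hA, bilinear_mul_createVec, hv, mul_add, mul_one]
      have h2 := LinearMap.congr_fun (aeval_mul_of_mul_eq h (descPochhammer ℂ (N + 1 + 1))) φ
      rw [Module.End.mul_apply, Module.End.mul_apply] at h2
      rw [h2]
      have h3 : Polynomial.aeval (A + 1) (descPochhammer ℂ (N + 1 + 1))
          = (A + 1) * Polynomial.aeval A (descPochhammer ℂ (N + 1)) := by
        rw [descPochhammer_succ_left, map_mul, Polynomial.aeval_X, Polynomial.aeval_comp]
        congr 2
        simp
      rw [h3, Module.End.mul_apply, ih hφ, map_zero, map_zero]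
    -- A particle added in the kernel of `K` leaves the count unchanged.
    have h2 : ∀ v φ, K *ᵥ v = 0 → φ ∈ numberSector ι N →
        Polynomial.aeval A (descPochhammer ℂ (N + 1 + 1)) (createVec v φ) = 0 := by
      intro v φ hv hφ
      have h : A * createVec v = createVec v * A := by
        rw [hA, bilinear_mul_createVec, hv]
        simp [createVec]
      have h2 := LinearMap.congr_fun (aeval_mul_of_mul_eq h (descPochhammer ℂ (N + 1 + 1))) φ
      rw [Module.End.mul_apply, Module.End.mul_apply] at h2
      rw [h2, descPochhammer_succ_right, mul_comm, map_mul, Module.End.mul_apply, ih hφ, map_zero,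
        map_zero]
    have h3 : ∀ a, create a = createVec (K *ᵥ Pi.single a 1)
        + createVec (Pi.single a 1 - K *ᵥ Pi.single a 1) := by
      intro a
      rw [createVec, createVec, ← Finset.sum_add_distrib, Finset.sum_eq_single a]
      · rw [← add_smul]; simp
      · intro b _ hb
        rw [← add_smul]; simp [hb]
      · simp
    -- The number operator writes `(N + 1) ψ` as a sum of states with one particle added to an
    -- `N`-particle state; each added particle is split along the range and the kernel of `K`.
    have h4 : ((N + 1 : ℕ) : ℂ) • Polynomial.aeval A (descPochhammer ℂ (N + 1 + 1)) ψ = 0 := by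
      rw [← map_smul, ← number_apply hψ, map_sum]
      refine Finset.sum_eq_zero fun a _ => ?_
      have ha := annihilate_mem_numberSector hψ a
      rw [h3 a, LinearMap.add_apply, map_add, h1 _ _ (by rw [Matrix.mulVec_mulVec, hK]) ha,
        h2 _ _ (by rw [Matrix.mulVec_sub, Matrix.mulVec_mulVec, hK, sub_self]) ha, add_zero]
    exact (smul_eq_zero.mp h4).resolve_left (by exact_mod_cast Nat.succ_ne_zero N)

/-- A polynomial `p` with `p(0) = 1` and `p(1) = ⋯ = p(N) = 0`. -/
def vacantPoly (N : ℕ) : Polynomial ℂ :=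
  ((descPochhammer ℂ N).eval (-1))⁻¹ • (descPochhammer ℂ N).comp (Polynomial.X - 1)

lemma descPochhammer_eval_neg_one_ne_zero (N : ℕ) : (descPochhammer ℂ N).eval (-1) ≠ 0 := by
  rw [descPochhammer_eval_eq_prod_range, Finset.prod_ne_zero_iff]
  intro j _ h
  have : ((j + 1 : ℕ) : ℂ) = 0 := by push_cast; linear_combination -h
  exact Nat.succ_ne_zero j (by exact_mod_cast this)

lemma vacantPoly_eval_zero (N : ℕ) : (vacantPoly N).eval 0 = 1 := by
  simp [vacantPoly, descPochhammer_eval_neg_one_ne_zero N]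

/-- On `N`-particle states, the projection onto the states with no particle in the range of the
projection `K`. -/
def vacate (N : ℕ) (K : Matrix ι ι ℂ) : Module.End ℂ (Fock ι) :=
  Polynomial.aeval (A := Module.End ℂ (Fock ι)) (bilinear K) (vacantPoly N)

/-- Multiplying `vacantPoly N` by `X` gives a multiple of the descending Pochhammer polynomial of
degree `N + 1`, which vanishes on the sector. -/
lemma bilinear_vacate {K : Matrix ι ι ℂ} (hK : K * K = K) {N : ℕ} {ψ : Fock ι}
    (hψ : ψ ∈ numberSector ι N) : bilinear K (vacate N K ψ) = 0 := by
  have h := aeval_descPochhammer_bilinear hK hψ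
  rw [descPochhammer_succ_left, map_mul, Polynomial.aeval_X, Module.End.mul_apply] at h
  rw [vacate, vacantPoly, map_smul, LinearMap.smul_apply, map_smul, h, smul_zero]

lemma vacate_eq_self {K : Matrix ι ι ℂ} {N : ℕ} {ψ : Fock ι} (h : bilinear K ψ = 0) :
    vacate N K ψ = ψ := by
  have := Module.End.aeval_apply_of_mem_apply_eq_smul (f := (bilinear K : Module.End ℂ (Fock ι)))
    (x := ψ) (μ := 0) (p := vacantPoly N) (by rw [h, zero_smul])
  rw [vacate, this, vacantPoly_eval_zero, one_smul]

lemma vacate_mem {S : Submodule ℂ (Fock ι)} {K : Matrix ι ι ℂ} {N : ℕ}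
    (h : ∀ ψ ∈ S, bilinear K ψ ∈ S) {ψ : Fock ι} (hψ : ψ ∈ S) : vacate N K ψ ∈ S :=
  aeval_mem h _ hψ

/-- For two particles the polynomial is `(x - 1)(x - 2) / 2`, and expanding it on a pair removes the
`K` component from each of the two legs. The projected state is therefore again a state created by
one pair operator. -/
lemma vacate_pairCreate_vacuum {K : Matrix ι ι ℂ} (hK : K * K = K) (C : Matrix ι ι ℂ) :
    vacate 2 K (pairCreate C (vacuum ι)) = pairCreate ((1 - K) * C * (1 - K)ᵀ) (vacuum ι) := by
  have h0 : vacate 2 K = (1 : Module.End ℂ (Fock ι)) - (3 / 2 : ℂ) • (bilinear K : Module.End ℂ (Fock ι))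
      + (1 / 2 : ℂ) • ((bilinear K : Module.End ℂ (Fock ι)) * bilinear K) := by
    have h1 : descPochhammer ℂ 2 = Polynomial.X * (Polynomial.X - 1) := by
      rw [descPochhammer_succ_right]; simp
    rw [vacate, vacantPoly, h1, map_smul, Polynomial.aeval_comp, map_mul]
    simp only [Polynomial.aeval_X, map_sub, map_one, Polynomial.eval_mul, Polynomial.eval_X,
      Polynomial.eval_sub, mul_sub, sub_mul, mul_one, one_mul]
    norm_num
    module
  have hKT : Kᵀ * Kᵀ = Kᵀ := by rw [← Matrix.transpose_mul, hK]
  rw [h0]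
  simp only [LinearMap.add_apply, LinearMap.sub_apply, LinearMap.smul_apply, Module.End.one_apply,
    Module.End.mul_apply, bilinear_pairCreate_vacuum]
  have h2 : K * (K * C + C * Kᵀ) + (K * C + C * Kᵀ) * Kᵀ
      = (K * C + C * Kᵀ) + (2 : ℂ) • (K * C * Kᵀ) := by
    rw [Matrix.mul_add, Matrix.add_mul, ← Matrix.mul_assoc, hK, Matrix.mul_assoc C, hKT,
      ← Matrix.mul_assoc K C]
    module
  have h3 : (1 - K) * C * (1 - K)ᵀ = C - (K * C + C * Kᵀ) + K * C * Kᵀ := by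
    rw [Matrix.transpose_sub, Matrix.transpose_one, Matrix.sub_mul, Matrix.one_mul,
      Matrix.mul_sub, Matrix.mul_one, Matrix.sub_mul]
    abel
  have h4 : C - (K * C + C * Kᵀ) + K * C * Kᵀ = C + (-1 : ℂ) • (K * C + C * Kᵀ) + K * C * Kᵀ := by
    module
  rw [h2, h3, h4]
  simp only [pairCreate_add, pairCreate_smul, LinearMap.add_apply]
  simp only [LinearMap.smul_apply, LinearMap.add_apply]
  module

/-! ### Dependence on a parameter -/

lemma hasDerivAt_linearMap {E F : Type*} [NormedAddCommGroup E] [NormedSpace ℂ E]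
    [FiniteDimensional ℂ E] [NormedAddCommGroup F] [NormedSpace ℂ F] (A : E →ₗ[ℂ] F) {u : ℝ → E}
    {u' : E} {t : ℝ} (hu : HasDerivAt u u' t) : HasDerivAt (fun t => A (u t)) (A u') t :=
  ((A.toContinuousLinearMap.restrictScalars ℝ).hasFDerivAt).comp_hasDerivAt t hu

lemma hasDerivAt_bilinear {T : ℝ → Matrix ι ι ℂ} {T' : Matrix ι ι ℂ} {u : ℝ → Fock ι} {u' : Fock ι}
    {t : ℝ} (hT : ∀ a b, HasDerivAt (fun t => T t a b) (T' a b) t) (hu : HasDerivAt u u' t) :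
    HasDerivAt (fun t => bilinear (T t) (u t)) (bilinear (T t) u' + bilinear T' (u t)) t := by
  simp only [bilinear_apply, ← Finset.sum_add_distrib]
  exact HasDerivAt.fun_sum fun a _ => HasDerivAt.fun_sum fun b _ =>
    (hT a b).smul (hasDerivAt_linearMap (create a ∘ₗ annihilate b) hu)

lemma hasDerivAt_pairCreate {C : ℝ → Matrix ι ι ℂ} {C' : Matrix ι ι ℂ} {u : ℝ → Fock ι}
    {u' : Fock ι} {t : ℝ} (hC : ∀ a b, HasDerivAt (fun t => C t a b) (C' a b) t)
    (hu : HasDerivAt u u' t) :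
    HasDerivAt (fun t => pairCreate (C t) (u t)) (pairCreate (C t) u' + pairCreate C' (u t)) t := by
  simp only [pairCreate_apply, ← Finset.sum_add_distrib]
  exact HasDerivAt.fun_sum fun a _ => HasDerivAt.fun_sum fun b _ =>
    (hC a b).smul (hasDerivAt_linearMap (create a ∘ₗ create b) hu)

lemma differentiableAt_bilinear {T : ℝ → Matrix ι ι ℂ} {u : ℝ → Fock ι} {t : ℝ}
    (hT : ∀ a b, DifferentiableAt ℝ (fun t => T t a b) t) (hu : DifferentiableAt ℝ u t) :
    DifferentiableAt ℝ (fun t => bilinear (T t) (u t)) t :=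
  (hasDerivAt_bilinear (T' := Matrix.of fun a b => deriv (fun t => T t a b) t)
    (fun a b => (hT a b).hasDerivAt) hu.hasDerivAt).differentiableAt

/-- The projection is a polynomial with fixed coefficients in a bilinear, so its regularity is that
of the matrix entries and no spectral perturbation theory is needed. -/
lemma differentiableAt_vacate {K : ℝ → Matrix ι ι ℂ} {u : ℝ → Fock ι} {t : ℝ}
    (hK : ∀ a b, DifferentiableAt ℝ (fun t => K t a b) t) (hu : DifferentiableAt ℝ u t) (N : ℕ) :
    DifferentiableAt ℝ (fun t => vacate N (K t) (u t)) t := by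
  unfold vacate
  induction vacantPoly N using Polynomial.induction_on' with
  | add p q hp hq =>
    simp only [map_add, LinearMap.add_apply]
    exact hp.fun_add hq
  | monomial n z =>
    simp only [Polynomial.aeval_monomial, ← Algebra.smul_def, LinearMap.smul_apply]
    refine DifferentiableAt.fun_const_smul ?_ z
    induction n with
    | zero => simpa
    | succ n ih =>
      simp only [pow_succ', Module.End.mul_apply]
      exact differentiableAt_bilinear hK ih

/-- Because `u` vanishes at `0`, the product rule leaves only the term in which `u` is
differentiated; the derivative of `C` never enters. -/
lemma hasDerivAt_pairCreate_pow {C : ℝ → Matrix ι ι ℂ} {u : ℝ → Fock ι} {u' : Fock ι}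
    (hC : ∀ a b, DifferentiableAt ℝ (fun t => C t a b) 0) (hu : HasDerivAt u u' 0) (h0 : u 0 = 0)
    (n : ℕ) :
    HasDerivAt (fun t => (pairCreate (C t) ^ n) (u t)) ((pairCreate (C 0) ^ n) u') 0 := by
  induction n with
  | zero => simpa
  | succ n ih =>
    simp only [pow_succ', Module.End.mul_apply]
    have := hasDerivAt_pairCreate (C' := Matrix.of fun a b => deriv (fun t => C t a b) 0)
      (fun a b => (hC a b).hasDerivAt) ih
    simpa [h0] using this

lemma differentiableAt_pairCreate_pow {C : ℝ → Matrix ι ι ℂ}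
    (hC : ∀ a b, DifferentiableAt ℝ (fun t => C t a b) 0) (ψ : Fock ι) (n : ℕ) :
    DifferentiableAt ℝ (fun t => (pairCreate (C t) ^ n) ψ) 0 := by
  induction n with
  | zero => simp
  | succ n ih =>
    simp only [pow_succ', Module.End.mul_apply]
    exact (hasDerivAt_pairCreate (C' := Matrix.of fun a b => deriv (fun t => C t a b) 0)
      (fun a b => (hC a b).hasDerivAt) ih.hasDerivAt).differentiableAt

/-! ### Lowest energy to second order -/

lemma hasSecondDerivAtZero_of_isLittleO {f : ℝ → ℝ} {l : ℝ} (h0 : f 0 = 0)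
    (h : (fun t => f t - l * t ^ 2) =o[𝓝 0] fun t : ℝ => t ^ 2) :
    HasSecondDerivAtZero f (2 * l) := by
  refine ⟨0, h.congr_left fun t => ?_⟩
  rw [h0]; ring

/-- Needed with `r = 1 / 2`, since a pair of total momentum `Q` sees the flat connection `Q / 2`. -/
lemma isLittleO_comp_const_mul {f : ℝ → ℝ} {l : ℝ}
    (h : (fun t => f t - l * t ^ 2) =o[𝓝 0] fun t : ℝ => t ^ 2) (r : ℝ) :
    (fun t => f (r * t) - (l * r ^ 2) * t ^ 2) =o[𝓝 0] fun t : ℝ => t ^ 2 := by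
  have hr : Tendsto (fun t : ℝ => r * t) (𝓝 0) (𝓝 0) := by
    have : Continuous fun t : ℝ => r * t := by fun_prop
    simpa using this.tendsto 0
  have h1 := h.comp_tendsto hr
  refine (h1.congr_left fun t => ?_).trans_isBigO ?_
  · simp only [Function.comp]; ring
  · refine (isBigO_const_mul_self (r ^ 2) (fun t : ℝ => t ^ 2) _).congr_left fun t => ?_
    simp only [Function.comp]; ring

/-- The difference of two expansions is a linear plus quadratic polynomial that is `o(t²)`. The
linear coefficient vanishes first, because `t²` is `o(t)`, and then the quadratic one. -/
lemma HasSecondDerivAtZero.unique {f : ℝ → ℝ} {c c' : ℝ} (h : HasSecondDerivAtZero f c)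
    (h' : HasSecondDerivAtZero f c') : c = c' := by
  obtain ⟨b, hb⟩ := h
  obtain ⟨b', hb'⟩ := h'
  have h1 : (fun t : ℝ => (b - b') * t + (c - c') / 2 * t ^ 2) =o[𝓝 0] fun t : ℝ => t ^ 2 :=
    (hb'.sub hb).congr_left fun t => by ring
  have hsq : (fun t : ℝ => t ^ 2) =o[𝓝 0] fun t : ℝ => t := by
    simpa using isLittleO_pow_pow (𝕜 := ℝ) (m := 1) (n := 2) (by norm_num)
  have key : ∀ (r : ℝ) (m : ℕ), ((fun t : ℝ => r * t ^ m) =o[𝓝 0] fun t : ℝ => t ^ m) → r = 0 := by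
    intro r m hr
    by_contra hne
    have h2 := (isLittleO_const_mul_left_iff hne).mp hr
    have h3 : (fun t : ℝ => t ^ m) =o[𝓝[≠] 0] fun t : ℝ => t ^ m := h2.mono nhdsWithin_le_nhds
    refine isLittleO_irrefl (f'' := fun t : ℝ => t ^ m) (l := 𝓝[≠] (0 : ℝ)) ?_ h3
    · refine Eventually.frequently ?_
      filter_upwards [self_mem_nhdsWithin] with t ht
      exact pow_ne_zero m ht
  have h2 : b - b' = 0 := by
    refine key _ 1 ?_
    have h3 := (h1.trans hsq).sub ((isBigO_const_mul_self ((c - c') / 2) (fun t : ℝ => t ^ 2)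
      (𝓝 0)).trans_isLittleO hsq)
    simpa using h3.congr_left fun t => by ring
  have h3 : (c - c') / 2 = 0 := by
    refine key _ 2 (h1.congr_left fun t => ?_)
    rw [h2]; ring
  linarith

/-- A trial state bounds the second-order coefficient of the lowest energy. -/
lemma secondOrder_le_of_trial {E F : Type*} [NormedAddCommGroup E] [NormedSpace ℝ E]
    [NormedAddCommGroup F] [NormedSpace ℝ F] {f : ℝ → ℝ} {l : ℝ}
    (h : (fun t => f t - l * t ^ 2) =o[𝓝 0] fun t : ℝ => t ^ 2) {u : ℝ → E} {N : ℝ → F} {v : F}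
    (hu : ContinuousAt u 0) (hu0 : u 0 ≠ 0) (hN : HasDerivAt N v 0) (hN0 : N 0 = 0)
    (hf : ∀ t, u t ≠ 0 → f t * ‖u t‖ ^ 2 ≤ ‖N t‖ ^ 2) : l * ‖u 0‖ ^ 2 ≤ ‖v‖ ^ 2 := by
  have h1 : Tendsto (fun t => (f t / t ^ 2) * ‖u t‖ ^ 2) (𝓝[≠] 0) (𝓝 (l * ‖u 0‖ ^ 2)) := by
    have h2 : Tendsto (fun t => (f t - l * t ^ 2) / t ^ 2) (𝓝[≠] 0) (𝓝 0) :=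
      (h.mono nhdsWithin_le_nhds).tendsto_div_nhds_zero
    have h3 : Tendsto (fun t => f t / t ^ 2) (𝓝[≠] 0) (𝓝 l) := by
      have h4 := h2.add_const l
      rw [zero_add] at h4
      refine h4.congr' ?_
      filter_upwards [self_mem_nhdsWithin] with t ht
      have ht : t ≠ 0 := ht
      field_simp
      ring
    exact h3.mul ((hu.norm.pow 2).tendsto.mono_left nhdsWithin_le_nhds)
  have h2 : Tendsto (fun t => ‖t⁻¹ • N t‖ ^ 2) (𝓝[≠] 0) (𝓝 (‖v‖ ^ 2)) := by
    have := hasDerivAt_iff_tendsto_slope_zero.mp hN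
    simp only [zero_add, hN0, sub_zero] at this
    exact this.norm.pow 2
  refine le_of_tendsto_of_tendsto h1 h2 ?_
  have h3 : ∀ᶠ t in 𝓝[≠] (0 : ℝ), u t ≠ 0 := (hu.eventually_ne hu0).filter_mono nhdsWithin_le_nhds
  filter_upwards [self_mem_nhdsWithin, h3] with t ht hut
  have ht : t ≠ 0 := ht
  rw [norm_smul, mul_pow, norm_inv, inv_pow, Real.norm_eq_abs, sq_abs, div_mul_eq_mul_div,
    div_eq_inv_mul]
  have := hf t hut
  gcongr

/-- Projecting a fixed unit vector keeps it nonzero for small `t`. This excludes the default value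
of an infimum over the empty set. -/
lemma eventually_exists_unit {E : Type*} [NormedAddCommGroup E] [NormedSpace ℝ E]
    {Q : ℝ → E →L[ℝ] E} (hQ : DifferentiableAt ℝ Q 0) (hQQ : ∀ t ψ, Q t (Q t ψ) = Q t ψ)
    (hK : ∃ φ, Q 0 φ = φ ∧ ‖φ‖ = 1) : ∀ᶠ t in 𝓝 (0 : ℝ), ∃ ψ, Q t ψ = ψ ∧ ‖ψ‖ = 1 := by
  obtain ⟨φ, h1, h2⟩ := hK
  have hc : ContinuousAt (fun t => Q t φ) 0 :=
    (hQ.clm_apply (differentiableAt_const φ)).continuousAt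
  filter_upwards [hc.eventually_ne (show Q 0 φ ≠ 0 by rw [h1]; rintro rfl; simp at h2)] with t ht
  have hn : 0 < ‖Q t φ‖ := norm_pos_iff.mpr ht
  refine ⟨‖Q t φ‖⁻¹ • Q t φ, by rw [map_smul, hQQ], ?_⟩
  rw [norm_smul, norm_inv, norm_norm, inv_mul_cancel₀ hn.ne']

set_option maxHeartbeats 1000000 in
/-- A family `Z t` of linear maps with `Z t ∘ Q t = Z t`, restricted to the range of a projection
`Q t`: if `Z 0` has a kernel in this range, then the lowest value of `‖Z t ψ‖²` on normalized `ψ`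
has a second-order expansion, given by second-order perturbation theory. -/
theorem exists_secondOrder {E F : Type*} [NormedAddCommGroup E] [NormedSpace ℝ E]
    [FiniteDimensional ℝ E] [NormedAddCommGroup F] [NormedSpace ℝ F]
    [FiniteDimensional ℝ F] {Q : ℝ → E →L[ℝ] E} {Z : ℝ → E →L[ℝ] F} {Z' : E →L[ℝ] F}
    (hQ : DifferentiableAt ℝ Q 0) (hZ : HasDerivAt Z Z' 0)
    (hQQ : ∀ t ψ, Q t (Q t ψ) = Q t ψ) (hZQ : ∀ t ψ, Z t (Q t ψ) = Z t ψ)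
    (hK : ∃ φ, Q 0 φ = φ ∧ Z 0 φ = 0 ∧ ‖φ‖ = 1) :
    ∃ l : ℝ, 0 ≤ l ∧
      ((fun t => sInf {x | ∃ ψ, Q t ψ = ψ ∧ ‖ψ‖ = 1 ∧ x = ‖Z t ψ‖ ^ 2} - l * t ^ 2)
        =o[𝓝 0] fun t : ℝ => t ^ 2) ∧
      ∀ ε > 0, ∃ φ ψ, Q 0 φ = φ ∧ Q 0 ψ = ψ ∧ Z 0 φ = 0 ∧ ‖φ‖ = 1 ∧
        ‖Z' φ + Z 0 ψ‖ ^ 2 < l + ε := by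
  set S : Set ℝ := {x | ∃ φ ψ, Q 0 φ = φ ∧ Q 0 ψ = ψ ∧ Z 0 φ = 0 ∧ ‖φ‖ = 1 ∧
    x = ‖Z' φ + Z 0 ψ‖ ^ 2} with hS
  set f : ℝ → ℝ := fun t => sInf {x | ∃ ψ, Q t ψ = ψ ∧ ‖ψ‖ = 1 ∧ x = ‖Z t ψ‖ ^ 2} with hf
  have hSne : S.Nonempty := by
    obtain ⟨φ, h1, h2, h3⟩ := hK
    exact ⟨_, φ, 0, h1, map_zero _, h2, h3, rfl⟩
  have hSb : BddBelow S := ⟨0, by rintro x ⟨φ, ψ, -, -, -, -, rfl⟩; positivity⟩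
  have hfle : ∀ t ψ, Q t ψ = ψ → ψ ≠ 0 → f t * ‖ψ‖ ^ 2 ≤ ‖Z t ψ‖ ^ 2 := by
    intro t ψ hψ hψ0
    have hn : 0 < ‖ψ‖ := norm_pos_iff.mpr hψ0
    have h1 : f t ≤ ‖Z t (‖ψ‖⁻¹ • ψ)‖ ^ 2 := by
      refine csInf_le ⟨0, by rintro x ⟨φ, -, -, rfl⟩; positivity⟩ ⟨‖ψ‖⁻¹ • ψ, ?_, ?_, rfl⟩
      · rw [map_smul, hψ]
      · rw [norm_smul, norm_inv, norm_norm, inv_mul_cancel₀ hn.ne']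
    rw [map_smul, norm_smul, norm_inv, norm_norm, mul_pow, inv_pow] at h1
    calc f t * ‖ψ‖ ^ 2 ≤ ((‖ψ‖ ^ 2)⁻¹ * ‖Z t ψ‖ ^ 2) * ‖ψ‖ ^ 2 := by gcongr
      _ = ‖Z t ψ‖ ^ 2 := by field_simp
  have happrox : ∀ ε > 0, ∃ φ ψ, Q 0 φ = φ ∧ Q 0 ψ = ψ ∧ Z 0 φ = 0 ∧ ‖φ‖ = 1 ∧
      ‖Z' φ + Z 0 ψ‖ ^ 2 < sInf S + ε := by
    intro ε hε
    obtain ⟨x, ⟨φ, ψ, h1, h2, h3, h4, rfl⟩, hx⟩ := exists_lt_of_csInf_lt hSne (lt_add_of_pos_right (sInf S) hε)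
    exact ⟨φ, ψ, h1, h2, h3, h4, hx⟩
  have hl0 : 0 ≤ sInf S := Real.sInf_nonneg (by rintro x ⟨φ, ψ, -, -, -, -, rfl⟩; positivity)
  refine ⟨sInf S, hl0, ?_, happrox⟩
  set a := Real.sqrt (sInf S) with ha
  have ha2 : a ^ 2 = sInf S := Real.sq_sqrt hl0
  have ha0 : 0 ≤ a := Real.sqrt_nonneg _
  -- upper bound
  have hupper : ∀ ε > 0, ∀ᶠ t in 𝓝 (0 : ℝ), f t ≤ (sInf S + ε) * t ^ 2 := by
    intro ε hε
    obtain ⟨φ, ψ, h1, h2, h3, h4, h5⟩ := happrox ε hε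
    -- The trial vector is the projection of the straight line `φ + t ψ`. As `Z t ∘ Q t = Z t`, its
    -- energy involves only the derivative of `Z`; from `Q`, continuity of the norm suffices.
    have hu : HasDerivAt (fun t : ℝ => φ + t • ψ) ψ 0 := by
      simpa using ((hasDerivAt_id (0 : ℝ)).smul_const ψ).const_add φ
    have hZu : HasDerivAt (fun t : ℝ => Z t (φ + t • ψ)) (Z' φ + Z 0 ψ) 0 := by
      simpa using hZ.clm_apply hu
    have hQu : ContinuousAt (fun t : ℝ => Q t (φ + t • ψ)) 0 :=
      (hQ.clm_apply hu.differentiableAt).continuousAt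
    have h6 : Tendsto (fun t : ℝ => ‖t⁻¹ • Z t (φ + t • ψ)‖ ^ 2) (𝓝[≠] 0)
        (𝓝 (‖Z' φ + Z 0 ψ‖ ^ 2)) := by
      have := hasDerivAt_iff_tendsto_slope_zero.mp hZu
      simp only [zero_add, zero_smul, add_zero, h3, sub_zero] at this
      exact this.norm.pow 2
    have h7 : Tendsto (fun t : ℝ => (sInf S + ε) * ‖Q t (φ + t • ψ)‖ ^ 2) (𝓝[≠] 0)
        (𝓝 (sInf S + ε)) := by
      have h8 : ContinuousAt (fun t : ℝ => (sInf S + ε) * ‖Q t (φ + t • ψ)‖ ^ 2) 0 :=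
        (hQu.norm.pow 2).const_mul (sInf S + ε)
      have h9 := h8.tendsto.mono_left (nhdsWithin_le_nhds (s := {0}ᶜ))
      simpa [h1, h4] using h9
    have h9 := h6.eventually_lt h7 h5
    have h10 : ∀ᶠ t in 𝓝[≠] (0 : ℝ), Q t (φ + t • ψ) ≠ 0 :=
      (hQu.eventually_ne (by simp only [zero_smul, add_zero, h1]; rintro rfl; simp at h4)).filter_mono nhdsWithin_le_nhds
    have h11 : ∀ᶠ t in 𝓝[≠] (0 : ℝ), f t ≤ (sInf S + ε) * t ^ 2 := by
      filter_upwards [h9, h10, self_mem_nhdsWithin] with t ht1 ht2 ht3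
      have ht3 : t ≠ 0 := ht3
      have ht4 := hfle t _ (hQQ t (φ + t • ψ)) ht2
      rw [hZQ] at ht4
      rw [norm_smul, mul_pow, norm_inv, inv_pow, Real.norm_eq_abs, sq_abs] at ht1
      have hp : 0 < ‖Q t (φ + t • ψ)‖ ^ 2 := by positivity
      have ht5 : 0 < t ^ 2 := by positivity
      rw [inv_mul_lt_iff₀ ht5] at ht1
      nlinarith
    rw [eventually_nhdsWithin_iff] at h11
    filter_upwards [h11] with t ht
    by_cases h0 : t = 0
    · subst h0
      obtain ⟨φ, h1, h2, h3⟩ := hK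
      have := hfle 0 φ h1 (by rintro rfl; simp at h3)
      simp [h2, h3] at this
      simpa using this
    · exact ht h0
  -- lower bound
  have hlower : ∀ δ > 0, ∀ᶠ t in 𝓝 (0 : ℝ), ∀ ψ, Q t ψ = ψ → ‖ψ‖ = 1 →
      |t| * (a - δ) ≤ ‖Z t ψ‖ := by
    obtain ⟨C₁, hC₁⟩ := hZ.differentiableAt.isBigO_sub.bound
    obtain ⟨C₂, hC₂⟩ := hQ.isBigO_sub.bound
    -- The kernel of `L` consists of the zero modes in the range of `Q 0`. In finite dimensions a
    -- right inverse on the range of `L` is bounded, so the distance to these zero modes is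
    -- controlled linearly by `Z 0 ψ` and `Q 0 ψ - ψ`.
    set L : E →ₗ[ℝ] F × E := (Z 0 : E →ₗ[ℝ] F).prod ((Q 0 : E →ₗ[ℝ] E) - LinearMap.id) with hL
    obtain ⟨s, hs⟩ := L.rangeRestrict.exists_rightInverse_of_surjective
      (LinearMap.range_eq_top.mpr L.surjective_rangeRestrict)
    set s' : LinearMap.range L →L[ℝ] E := s.toContinuousLinearMap with hs'
    have hproj : ∀ ψ, ∃ φ, Q 0 φ = φ ∧ Z 0 φ = 0 ∧
        ‖ψ - φ‖ ≤ ‖s'‖ * max ‖Z 0 ψ‖ ‖Q 0 ψ - ψ‖ := by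
      intro ψ
      have h1 : L (ψ - s (L.rangeRestrict ψ)) = 0 := by
        have : L (s (L.rangeRestrict ψ)) = L ψ :=
          congrArg Subtype.val (LinearMap.congr_fun hs (L.rangeRestrict ψ))
        rw [map_sub, this, sub_self]
      have h2 : Z 0 (ψ - s (L.rangeRestrict ψ)) = 0 := congrArg Prod.fst h1
      have h3 : Q 0 (ψ - s (L.rangeRestrict ψ)) - (ψ - s (L.rangeRestrict ψ)) = 0 :=
        congrArg Prod.snd h1
      refine ⟨ψ - s (L.rangeRestrict ψ), sub_eq_zero.mp h3, h2, ?_⟩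
      rw [sub_sub_cancel]
      exact s'.le_opNorm (L.rangeRestrict ψ)
    -- The definition of the infimum, extended by homogeneity. Here `ψ` need not lie in the range of
    -- `Q 0`, since replacing it by `Q 0 ψ` leaves `Z 0 ψ` unchanged.
    have hhom : ∀ φ ψ, Q 0 φ = φ → Z 0 φ = 0 → a * ‖φ‖ ≤ ‖Z' φ + Z 0 ψ‖ := by
      intro φ ψ h1 h2
      by_cases h0 : φ = 0
      · simp [h0]
      have hn : 0 < ‖φ‖ := norm_pos_iff.mpr h0
      have h3 : sInf S ≤ ‖Z' (‖φ‖⁻¹ • φ) + Z 0 (Q 0 (‖φ‖⁻¹ • ψ))‖ ^ 2 := by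
        refine csInf_le hSb ⟨‖φ‖⁻¹ • φ, Q 0 (‖φ‖⁻¹ • ψ), ?_, hQQ _ _, ?_, ?_, rfl⟩
        · rw [map_smul, h1]
        · rw [map_smul, h2, smul_zero]
        · rw [norm_smul, norm_inv, norm_norm, inv_mul_cancel₀ hn.ne']
      rw [hZQ, map_smul, map_smul, ← smul_add, norm_smul, norm_inv, norm_norm] at h3
      have h4 := Real.sqrt_le_sqrt h3
      rw [Real.sqrt_sq (by positivity)] at h4
      rw [← ha] at h4
      rw [inv_mul_eq_div, le_div_iff₀ hn] at h4
      exact h4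
    intro δ hδ
    set M := ‖s'‖ * max (a + |C₁|) |C₂| with hM
    have hM0 : 0 ≤ M := by positivity
    have hd := (hasDerivAt_iff_isLittleO.mp hZ).bound (c := δ / 4) (by positivity)
    have hsmall : ∀ᶠ t in 𝓝 (0 : ℝ), |t| * (M + |C₁| * M + a * M) ≤ δ / 4 ∧ |t| * M ≤ 1 := by
      have h1 : Tendsto (fun t : ℝ => |t| * (M + |C₁| * M + a * M)) (𝓝 0) (𝓝 0) := by
        have : Continuous fun t : ℝ => |t| * (M + |C₁| * M + a * M) := by fun_prop
        simpa using this.tendsto 0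
      have h2 : Tendsto (fun t : ℝ => |t| * M) (𝓝 0) (𝓝 0) := by
        have : Continuous fun t : ℝ => |t| * M := by fun_prop
        simpa using this.tendsto 0
      exact (h1.eventually_le_const (by positivity)).and (h2.eventually_le_const one_pos)
    filter_upwards [hC₁, hC₂, hd, hsmall] with t ht1 ht2 ht3 ht4 ψ hψ hψ1
    simp only [sub_zero] at ht1 ht2 ht3
    rw [Real.norm_eq_abs] at ht1 ht2 ht3
    have ht1' : ‖Z t - Z 0‖ ≤ |C₁| * |t| := ht1.trans (by gcongr; exact le_abs_self _)
    have ht2' : ‖Q t - Q 0‖ ≤ |C₂| * |t| := ht2.trans (by gcongr; exact le_abs_self _)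
    -- Either the bound already holds, or `ψ` has small energy and is then within `O(t)` of a zero
    -- mode `φ`.
    by_cases hcase : a * |t| ≤ ‖Z t ψ‖
    · refine le_trans ?_ hcase
      nlinarith [abs_nonneg t]
    push Not at hcase
    have h1 : ‖Z 0 ψ‖ ≤ (a + |C₁|) * |t| := by
      have h2 : Z 0 ψ = Z t ψ - (Z t - Z 0) ψ := by simp
      have h3 := (Z t - Z 0).le_opNorm ψ
      rw [hψ1, mul_one] at h3
      calc ‖Z 0 ψ‖ ≤ ‖Z t ψ‖ + ‖(Z t - Z 0) ψ‖ := by rw [h2]; exact norm_sub_le _ _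
        _ ≤ (a + |C₁|) * |t| := by linarith
    have h2 : ‖Q 0 ψ - ψ‖ ≤ |C₂| * |t| := by
      have h3 := (Q t - Q 0).le_opNorm ψ
      rw [hψ1, mul_one, sub_apply, hψ, norm_sub_rev] at h3
      exact h3.trans ht2'
    obtain ⟨φ, hφ1, hφ2, hφ3⟩ := hproj ψ
    have h3 : ‖ψ - φ‖ ≤ M * |t| := by
      refine hφ3.trans ?_
      rw [hM, mul_assoc]
      gcongr
      refine max_le (h1.trans ?_) (h2.trans ?_)
      · gcongr; exact le_max_left _ _
      · gcongr; exact le_max_right _ _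
    have h4 : 1 - M * |t| ≤ ‖φ‖ := by
      have := norm_sub_norm_le ψ φ
      rw [hψ1] at this
      linarith
    have h4' : ‖φ‖ ≤ 2 := by
      have := norm_sub_norm_le φ ψ
      rw [hψ1, norm_sub_rev] at this
      linarith [ht4.2]
    have hmain : a * ‖t • φ‖ ≤ ‖Z' (t • φ) + Z 0 (ψ - φ)‖ :=
      hhom (t • φ) (ψ - φ) (by rw [map_smul, hφ1]) (by rw [map_smul, hφ2, smul_zero])
    -- With `Z 0 φ = 0`, the quantity bounded below by `hhom` equals `Z t ψ` up to a differentiation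
    -- remainder of order `o(t)` and a product of two `O(t)` errors.
    have hdec : Z' (t • φ) + Z 0 (ψ - φ)
        = Z t ψ - (Z t - Z 0 - t • Z') φ - (Z t - Z 0) (ψ - φ) := by
      simp only [map_smul, map_sub, sub_apply, smul_apply,
        hφ2]
      abel
    have h5 : ‖(Z t - Z 0 - t • Z') φ‖ ≤ δ / 4 * |t| * 2 := by
      refine ((Z t - Z 0 - t • Z').le_opNorm φ).trans ?_
      gcongr
    have h6 : ‖(Z t - Z 0) (ψ - φ)‖ ≤ (|C₁| * |t|) * (M * |t|) := by
      refine ((Z t - Z 0).le_opNorm _).trans ?_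
      gcongr
    have h7 : a * (|t| * ‖φ‖) ≤ ‖Z t ψ‖ + δ / 4 * |t| * 2 + (|C₁| * |t|) * (M * |t|) := by
      rw [norm_smul, Real.norm_eq_abs] at hmain
      refine hmain.trans ?_
      rw [hdec]
      refine (norm_sub_le _ _).trans ?_
      have := norm_sub_le (Z t ψ) ((Z t - Z 0 - t • Z') φ)
      linarith
    have h8 : a * (|t| * (1 - M * |t|)) ≤ a * (|t| * ‖φ‖) := by gcongr
    have h9 : |t| * (|t| * (M + |C₁| * M + a * M)) ≤ |t| * (δ / 4) := by
      gcongr; exact ht4.1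
    have h10 : 0 ≤ |t| * |t| * M := by positivity
    have h11 : 0 ≤ δ * |t| := by positivity
    linarith
  rw [isLittleO_iff]
  intro ε hε
  -- This choice makes `(a - δ)² ≥ a² - ε`. If `a < δ` the required bound has a nonpositive left
  -- side and is trivial.
  obtain ⟨δ, hδ, hδ'⟩ : ∃ δ > 0, 2 * a * δ ≤ ε := by
    refine ⟨ε / (2 * a + 1), by positivity, ?_⟩
    rw [mul_div_assoc', div_le_iff₀ (by positivity)]
    nlinarith
  filter_upwards [hupper ε hε, hlower δ hδ, eventually_exists_unit hQ hQQ
    (hK.imp fun φ h => ⟨h.1, h.2.2⟩)] with t h1 h2 h3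
  have h4 : (sInf S - ε) * t ^ 2 ≤ f t := by
    obtain ⟨ψ, hψ⟩ := h3
    refine le_csInf ⟨_, ψ, hψ.1, hψ.2, rfl⟩ ?_
    rintro x ⟨ψ, h5, h6, rfl⟩
    have h7 := h2 ψ h5 h6
    have h8 : (sInf S - ε) * t ^ 2 ≤ (a ^ 2 - 2 * a * δ) * t ^ 2 := by
      rw [ha2]; gcongr
    refine h8.trans ?_
    by_cases hc : a < δ
    · have : (a ^ 2 - 2 * a * δ) * t ^ 2 ≤ 0 :=
        mul_nonpos_of_nonpos_of_nonneg (by nlinarith) (by positivity)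
      exact this.trans (by positivity)
    · have h9 : (|t| * (a - δ)) ^ 2 ≤ ‖Z t ψ‖ ^ 2 := by
        have : 0 ≤ |t| * (a - δ) := mul_nonneg (abs_nonneg _) (by linarith)
        gcongr
      rw [mul_pow, sq_abs] at h9
      nlinarith [mul_nonneg (sq_nonneg t) (sq_nonneg δ)]
  rw [Real.norm_eq_abs, Real.norm_eq_abs, abs_of_nonneg (sq_nonneg t), abs_le]
  constructor <;> linarith

/-! ### Families of projected bilinears -/

lemma differentiableAt_clm_of_apply {E F : Type*} [NormedAddCommGroup E] [NormedSpace ℝ E]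
    [FiniteDimensional ℝ E] [NormedAddCommGroup F] [NormedSpace ℝ F] {f : ℝ → E →L[ℝ] F} {t : ℝ}
    (h : ∀ y, DifferentiableAt ℝ (fun t => f t y) t) : DifferentiableAt ℝ f t := by
  let d := Module.finrank ℝ E
  have hd : d = Module.finrank ℝ (Fin d → ℝ) := (Module.finrank_fin_fun ℝ).symm
  let e₁ := ContinuousLinearEquiv.ofFinrankEq hd
  let e₂ := (e₁.arrowCongr (1 : F ≃L[ℝ] F)).trans (ContinuousLinearEquiv.piRing (Fin d))
  have h1 : DifferentiableAt ℝ (e₂ ∘ f) t := differentiableAt_pi.mpr fun i => h _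
  exact e₂.comp_differentiableAt_iff.mp h1

lemma hasDerivAt_toLp {κ E : Type*} [Fintype κ] [NormedAddCommGroup E] [NormedSpace ℝ E]
    {N : ℝ → κ → E} {v : κ → E} {t : ℝ} (h : ∀ i, HasDerivAt (fun t => N t i) (v i) t) :
    HasDerivAt (fun t => (WithLp.toLp 2 (N t) : PiLp 2 fun _ : κ => E)) (WithLp.toLp 2 v) t :=
  ((PiLp.continuousLinearEquiv 2 ℝ fun _ : κ => E).symm.hasFDerivAt).comp_hasDerivAt t
    (hasDerivAt_pi.mpr h)

/-- A family of filled subspaces, the ranges of `P t`, together with single-particle operators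
`T i t` which map into the filled subspaces. -/
structure IsProjectedFamily {κ : Type*} (P : ℝ → Matrix ι ι ℂ) (T : κ → ℝ → Matrix ι ι ℂ) :
    Prop where
  isHermitian : ∀ t, (P t).IsHermitian
  idem : ∀ t, P t * P t = P t
  differentiableAt : ∀ a b, DifferentiableAt ℝ (fun t => P t a b) 0
  mul_left : ∀ i t, P t * T i t = T i t
  differentiableAt_op : ∀ i a b, DifferentiableAt ℝ (fun t => T i t a b) 0

/-- The `N`-particle states in `S` in which only single-particle states in the range of
`P` are filled. -/
def filledStates (P : Matrix ι ι ℂ) (S : Submodule ℂ (Fock ι)) (N : ℕ) : Set (Fock ι) :=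
  {ψ | ψ ∈ supportedOn P ∧ ψ ∈ numberSector ι N ∧ ψ ∈ S}

variable {κ : Type*} [Fintype κ]

/-- The lowest value of `∑ ‖T_i ψ‖²` on normalized filled states. -/
def familyEnergy (P : ℝ → Matrix ι ι ℂ) (T : κ → ℝ → Matrix ι ι ℂ) (S : Submodule ℂ (Fock ι))
    (N : ℕ) (t : ℝ) : ℝ :=
  sInf {x | ∃ ψ ∈ filledStates (P t) S N, ‖ψ‖ = 1 ∧ x = ∑ i, ‖bilinear (T i t) ψ‖ ^ 2}

lemma smul_mem_filledStates {P : Matrix ι ι ℂ} {S : Submodule ℂ (Fock ι)} {N : ℕ} {ψ : Fock ι}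
    (z : ℂ) (h : ψ ∈ filledStates P S N) : z • ψ ∈ filledStates P S N := by
  refine ⟨fun a => ?_, fun s hs => h.2.1 s fun h' => hs ?_, S.smul_mem z h.2.2⟩
  · simp only [map_smul, smul_comm _ z, ← Finset.smul_sum, h.1 a, smul_zero]
  · simp [h']

lemma familyEnergy_mul_le {P : ℝ → Matrix ι ι ℂ} {T : κ → ℝ → Matrix ι ι ℂ}
    {S : Submodule ℂ (Fock ι)} {N : ℕ} {t : ℝ} {ψ : Fock ι} (h : ψ ∈ filledStates (P t) S N)
    (h0 : ψ ≠ 0) : familyEnergy P T S N t * ‖ψ‖ ^ 2 ≤ ∑ i, ‖bilinear (T i t) ψ‖ ^ 2 := by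
  have hn : 0 < ‖ψ‖ := norm_pos_iff.mpr h0
  have hb : BddBelow {x | ∃ ψ ∈ filledStates (P t) S N, ‖ψ‖ = 1 ∧
      x = ∑ i, ‖bilinear (T i t) ψ‖ ^ 2} := by
    refine ⟨0, fun x hx => ?_⟩
    obtain ⟨φ, -, -, hx⟩ := hx
    rw [hx]
    exact Finset.sum_nonneg fun i _ => sq_nonneg _
  have hu : ‖((‖ψ‖⁻¹ : ℝ) : ℂ) • ψ‖ = 1 := by
    rw [norm_smul, Complex.norm_real, norm_inv, norm_norm, inv_mul_cancel₀ hn.ne']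
  have h1 : familyEnergy P T S N t ≤ ∑ i, ‖bilinear (T i t) (((‖ψ‖⁻¹ : ℝ) : ℂ) • ψ)‖ ^ 2 :=
    csInf_le hb ⟨_, smul_mem_filledStates _ h, hu, Eq.refl _⟩
  have h2 : ∀ i, ‖bilinear (T i t) (((‖ψ‖⁻¹ : ℝ) : ℂ) • ψ)‖ ^ 2
      = (‖ψ‖ ^ 2)⁻¹ * ‖bilinear (T i t) ψ‖ ^ 2 := by
    intro i
    rw [map_smul, norm_smul, Complex.norm_real, norm_inv, norm_norm, mul_pow, inv_pow]
  rw [Finset.sum_congr rfl fun i _ => h2 i, ← Finset.mul_sum, inv_mul_eq_div,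
    le_div_iff₀ (by positivity)] at h1
  exact h1

namespace IsProjectedFamily

variable {P : ℝ → Matrix ι ι ℂ} {T : κ → ℝ → Matrix ι ι ℂ} (h : IsProjectedFamily P T)

include h

lemma one_sub_idem (t : ℝ) : (1 - P t) * (1 - P t) = 1 - P t := by
  simp [Matrix.mul_sub, Matrix.sub_mul, h.idem]

lemma differentiableAt_one_sub (a b : ι) : DifferentiableAt ℝ (fun t => (1 - P t) a b) 0 := by
  simp only [Matrix.sub_apply]
  exact (h.differentiableAt a b).const_sub _

lemma vacate_mem_filledStates {S : Submodule ℂ (Fock ι)} {t : ℝ} {N : ℕ}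
    (hS : ∀ ψ ∈ S, bilinear (1 - P t) ψ ∈ S) {ψ : Fock ι} (hψ : ψ ∈ numberSector ι N)
    (hψS : ψ ∈ S) : vacate N (1 - P t) ψ ∈ filledStates (P t) S N := by
  refine ⟨?_, ?_, vacate_mem hS hψS⟩
  · rw [mem_supportedOn_iff (h.isHermitian t) (h.idem t)]
    exact bilinear_vacate (h.one_sub_idem t) hψ
  · rw [mem_numberSector_iff] at *
    exact vacate_mem (fun φ hφ => bilinear_mem_gradedSector (fun _ _ _ => rfl) hφ) hψ

lemma vacate_eq_of_mem {S : Submodule ℂ (Fock ι)} {t : ℝ} {N : ℕ} {ψ : Fock ι}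
    (hψ : ψ ∈ filledStates (P t) S N) : vacate N (1 - P t) ψ = ψ :=
  vacate_eq_self ((mem_supportedOn_iff (h.isHermitian t) (h.idem t)).mp hψ.1)

/-- Second-order perturbation theory for the lowest energy of a projected family. -/
theorem exists_familyEnergy_secondOrder {S : Submodule ℂ (Fock ι)} {N : ℕ}
    (hS : ∀ t, ∀ ψ ∈ S, bilinear (1 - P t) ψ ∈ S)
    (hK : ∃ φ ∈ filledStates (P 0) S N, ‖φ‖ = 1 ∧ ∀ i, bilinear (T i 0) φ = 0) :
    ∃ l : ℝ, 0 ≤ l ∧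
      ((fun t => familyEnergy P T S N t - l * t ^ 2) =o[𝓝 0] fun t : ℝ => t ^ 2) ∧
      (∀ᶠ t in 𝓝 (0 : ℝ), ∃ ψ ∈ filledStates (P t) S N, ‖ψ‖ = 1) ∧
      ∀ ε > 0, ∃ φ ∈ filledStates (P 0) S N, ∃ ψ ∈ filledStates (P 0) S N, ∃ v : κ → Fock ι,
        ‖φ‖ = 1 ∧ (∀ i, bilinear (T i 0) φ = 0) ∧
        (∀ i, HasDerivAt (fun t : ℝ => bilinear (T i t) (vacate N (1 - P t) (φ + t • ψ)))
          (v i) 0) ∧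
        ∑ i, ‖v i‖ ^ 2 < l + ε := by
  set S' : Submodule ℂ (Fock ι) := S ⊓ gradedSector (fun _ => (1 : ℤ)) (N : ℤ) with hS'
  have hmemS' : ∀ ψ, ψ ∈ S' ↔ ψ ∈ S ∧ ψ ∈ numberSector ι N := by
    intro ψ; rw [hS', Submodule.mem_inf, mem_numberSector_iff]
  -- `vacate` is a projection only on the `N`-particle sector. Composing it with the fixed
  -- projection onto `S'` gives a projection of the whole Fock space whose range is exactly the set
  -- of filled states.
  set q : ℝ → Fock ι →ₗ[ℂ] Fock ι := fun t =>
    vacate N (1 - P t) ∘ₗ (S'.starProjection : Fock ι →ₗ[ℂ] Fock ι) with hq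
  have hqapp : ∀ t ψ, q t ψ = vacate N (1 - P t) (S'.starProjection ψ) := fun _ _ => rfl
  have hqmem : ∀ t ψ, q t ψ ∈ filledStates (P t) S N := by
    intro t ψ
    have := (hmemS' _).mp (S'.starProjection_apply_mem ψ)
    exact h.vacate_mem_filledStates (hS t) this.2 this.1
  have hqeq : ∀ t ψ, ψ ∈ filledStates (P t) S N → q t ψ = ψ := by
    intro t ψ hψ
    rw [hqapp, Submodule.starProjection_eq_self_iff.mpr ((hmemS' _).mpr ⟨hψ.2.2, hψ.2.1⟩),
      h.vacate_eq_of_mem hψ]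
  have hqiff : ∀ t ψ, q t ψ = ψ ↔ ψ ∈ filledStates (P t) S N :=
    fun t ψ => ⟨fun h => h ▸ hqmem t ψ, hqeq t ψ⟩
  set Q : ℝ → Fock ι →L[ℝ] Fock ι := fun t =>
    ((q t).restrictScalars ℝ).toContinuousLinearMap with hQ
  have hQapp : ∀ t ψ, Q t ψ = q t ψ := fun _ _ => rfl
  -- All bilinears are assembled into one map into an `ℓ²` sum, so that its squared norm is the
  -- energy; precomposition with `q t` gives `Z t ∘ Q t = Z t`.
  set z : ℝ → Fock ι →ₗ[ℝ] PiLp 2 fun _ : κ => Fock ι := fun t =>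
    (WithLp.linearEquiv 2 ℝ (κ → Fock ι)).symm.toLinearMap ∘ₗ
      LinearMap.pi fun i => (bilinear (T i t) ∘ₗ q t).restrictScalars ℝ with hz
  set Z : ℝ → Fock ι →L[ℝ] PiLp 2 fun _ : κ => Fock ι := fun t =>
    (z t).toContinuousLinearMap with hZ
  have hZapp : ∀ t ψ, Z t ψ = WithLp.toLp 2 fun i => bilinear (T i t) (q t ψ) := fun _ _ => rfl
  have hqd : ∀ ψ, DifferentiableAt ℝ (fun t => q t ψ) 0 := fun ψ =>
    differentiableAt_vacate h.differentiableAt_one_sub (differentiableAt_const _) N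
  have hQd : DifferentiableAt ℝ Q 0 := differentiableAt_clm_of_apply hqd
  have hZd : DifferentiableAt ℝ Z 0 := by
    refine differentiableAt_clm_of_apply fun ψ => ?_
    simp only [hZapp]
    exact (hasDerivAt_toLp fun i =>
      (differentiableAt_bilinear (h.differentiableAt_op i) (hqd ψ)).hasDerivAt).differentiableAt
  have hQQ : ∀ t ψ, Q t (Q t ψ) = Q t ψ := fun t ψ => hqeq t _ (hqmem t ψ)
  have hZQ : ∀ t ψ, Z t (Q t ψ) = Z t ψ := fun t ψ => by
    rw [hZapp, hZapp, hQapp, hqeq t _ (hqmem t ψ)]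
  have hZn : ∀ t ψ, ψ ∈ filledStates (P t) S N → ‖Z t ψ‖ ^ 2 = ∑ i, ‖bilinear (T i t) ψ‖ ^ 2 := by
    intro t ψ hψ
    rw [hZapp, PiLp.norm_sq_eq_of_L2, hqeq t ψ hψ]
  have hK' : ∃ φ, Q 0 φ = φ ∧ Z 0 φ = 0 ∧ ‖φ‖ = 1 := by
    obtain ⟨φ, h1, h2, h3⟩ := hK
    refine ⟨φ, hqeq _ _ h1, ?_, h2⟩
    rw [hZapp, hqeq _ _ h1]
    simp only [h3]
    rfl
  obtain ⟨l, hl0, hl, happ⟩ := exists_secondOrder hQd hZd.hasDerivAt hQQ hZQ hK'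
  refine ⟨l, hl0, hl.congr_left fun t => ?_, ?_, fun ε hε => ?_⟩
  · congr 2
    ext x
    constructor
    · rintro ⟨ψ, h1, h2, rfl⟩
      have h1 := (hqiff t ψ).mp h1
      exact ⟨ψ, h1, h2, hZn t ψ h1⟩
    · rintro ⟨ψ, h1, h2, rfl⟩
      exact ⟨ψ, hqeq t ψ h1, h2, (hZn t ψ h1).symm⟩
  · filter_upwards [eventually_exists_unit hQd hQQ (hK'.imp fun φ h => ⟨h.1, h.2.2⟩)] with t ht
    obtain ⟨ψ, h1, h2⟩ := ht
    exact ⟨ψ, (hqiff t ψ).mp h1, h2⟩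
  · obtain ⟨φ, ψ, h1, h2, h3, h4, h5⟩ := happ ε hε
    have h1 := (hqiff 0 φ).mp h1
    have h2 := (hqiff 0 ψ).mp h2
    refine ⟨φ, h1, ψ, h2, fun i => (deriv Z 0 φ + Z 0 ψ) i, h4, fun i => ?_, fun i => ?_, ?_⟩
    · have := congrArg (fun x : PiLp 2 fun _ : κ => Fock ι => x i) h3
      rw [hZapp, hqeq _ _ h1] at this
      exact this
    · have hu : HasDerivAt (fun t : ℝ => φ + t • ψ) ψ 0 := by
        simpa using ((hasDerivAt_id (0 : ℝ)).smul_const ψ).const_add φ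
      have hd := hZd.hasDerivAt.clm_apply hu
      rw [zero_smul, add_zero] at hd
      have hd' := ((PiLp.continuousLinearEquiv 2 ℝ fun _ : κ => Fock ι).hasFDerivAt).comp_hasDerivAt
        (0 : ℝ) hd
      have hd'' := hasDerivAt_pi.mp hd' i
      refine hd''.congr_of_eventuallyEq (Eventually.of_forall fun t => ?_)
      have hmem : φ + t • ψ ∈ S' := by
        refine S'.add_mem ((hmemS' _).mpr ⟨h1.2.2, h1.2.1⟩) ?_
        exact S'.smul_of_tower_mem t ((hmemS' _).mpr ⟨h2.2.2, h2.2.1⟩)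
      have h6 : q t (φ + t • ψ) = vacate N (1 - P t) (φ + t • ψ) := by
        rw [hqapp, Submodule.starProjection_eq_self_iff.mpr hmem]
      show bilinear (T i t) (vacate N (1 - P t) (φ + t • ψ)) = bilinear (T i t) (q t (φ + t • ψ))
      rw [h6]
    · rw [← PiLp.norm_sq_eq_of_L2 (fun _ : κ => Fock ι)]
      exact h5

/-- A trial state bounds the second-order energy of a projected family. -/
lemma familyEnergy_le_of_trial {S : Submodule ℂ (Fock ι)} {N : ℕ} {l : ℝ}
    (hl : (fun t => familyEnergy P T S N t - l * t ^ 2) =o[𝓝 0] fun t : ℝ => t ^ 2)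
    {u : ℝ → Fock ι} (hu : ContinuousAt u 0) (hu0 : u 0 ≠ 0)
    (hmem : ∀ t, u t ∈ filledStates (P t) S N) {v : κ → Fock ι}
    (hv : ∀ i, HasDerivAt (fun t => bilinear (T i t) (u t)) (v i) 0)
    (hv0 : ∀ i, bilinear (T i 0) (u 0) = 0) : l * ‖u 0‖ ^ 2 ≤ ∑ i, ‖v i‖ ^ 2 := by
  have := secondOrder_le_of_trial hl hu hu0 (hasDerivAt_toLp hv)
    (by simp only [hv0]; rfl) (fun t ht => by
      rw [PiLp.norm_sq_eq_of_L2 (fun _ : κ => Fock ι)]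
      exact familyEnergy_mul_le (hmem t) ht)
  rwa [PiLp.norm_sq_eq_of_L2 (fun _ : κ => Fock ι)] at this

end IsProjectedFamily

/-! ### Condensates of pairs as trial states -/

variable {κ : Type*} [Fintype κ]

lemma vacuum_ne_zero : vacuum ι ≠ 0 := by
  intro h
  simpa [h] using norm_vacuum (ι := ι)

lemma differentiableAt_mul_entry {l m n : Type*} [Fintype m] {A : ℝ → Matrix l m ℂ}
    {B : ℝ → Matrix m n ℂ} {t : ℝ}
    (hA : ∀ a b, DifferentiableAt ℝ (fun t => A t a b) t)
    (hB : ∀ a b, DifferentiableAt ℝ (fun t => B t a b) t) (a : l) (b : n) :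
    DifferentiableAt ℝ (fun t => (A t * B t) a b) t := by
  simp only [Matrix.mul_apply]
  exact DifferentiableAt.fun_sum fun c _ => (hA a c).mul (hB c b)

lemma hasDerivAt_mul_entry {l m n : Type*} [Fintype m] {A : ℝ → Matrix l m ℂ}
    {B : ℝ → Matrix m n ℂ} {A' : Matrix l m ℂ} {B' : Matrix m n ℂ} {t : ℝ}
    (hA : ∀ a b, HasDerivAt (fun t => A t a b) (A' a b) t)
    (hB : ∀ a b, HasDerivAt (fun t => B t a b) (B' a b) t) (a : l) (b : n) :
    HasDerivAt (fun t => (A t * B t) a b) ((A' * B t + A t * B') a b) t := by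
  simp only [Matrix.mul_apply, Matrix.add_apply, ← Finset.sum_add_distrib]
  exact HasDerivAt.fun_sum fun c _ => (hA a c).mul (hB c b)

lemma hasDerivAt_unique_entry {A : ℝ → Matrix ι ι ℂ} {A' A'' : Matrix ι ι ℂ} {t : ℝ}
    (h : ∀ a b, HasDerivAt (fun t => A t a b) (A' a b) t)
    (h' : ∀ a b, HasDerivAt (fun t => A t a b) (A'' a b) t) : A' = A'' := by
  ext a b; exact (h a b).unique (h' a b)

/-- The action of a single-particle operator on pair wave functions. -/
def pairAction (T C : Matrix ι ι ℂ) : Matrix ι ι ℂ := T * C + C * Tᵀ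

lemma pairAction_antisymm {T C : Matrix ι ι ℂ} (hC : Cᵀ = -C) :
    (pairAction T C)ᵀ = -pairAction T C := by
  simp only [pairAction, Matrix.transpose_add, Matrix.transpose_mul, hC, Matrix.transpose_transpose,
    Matrix.neg_mul, Matrix.mul_neg]
  abel

/-- A differentiable family of pair wave functions in the range of `P t`, on which the operators
`T i t` act trivially at `t = 0` and with derivative `F i`. -/
structure IsPairFamily (P : ℝ → Matrix ι ι ℂ) (T : κ → ℝ → Matrix ι ι ℂ)
    (C : ℝ → Matrix ι ι ℂ) (F : κ → Matrix ι ι ℂ) : Prop where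
  antisymm : ∀ t, (C t)ᵀ = -C t
  mul_left : ∀ t, P t * C t = C t
  differentiableAt : ∀ a b, DifferentiableAt ℝ (fun t => C t a b) 0
  zero : ∀ i, pairAction (T i 0) (C 0) = 0
  hasDerivAt : ∀ i a b, HasDerivAt (fun t => pairAction (T i t) (C t) a b) (F i a b) 0

namespace IsPairFamily

variable {P : ℝ → Matrix ι ι ℂ} {T : κ → ℝ → Matrix ι ι ℂ} {C : ℝ → Matrix ι ι ℂ}
  {F : κ → Matrix ι ι ℂ} (hC : IsPairFamily P T C F)

include hC

lemma deriv_antisymm (i : κ) : (F i)ᵀ = -F i := by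
  ext a b
  have h1 := hC.hasDerivAt i b a
  have h2 := (hC.hasDerivAt i a b).neg
  refine h1.unique (h2.congr_of_eventuallyEq (Eventually.of_forall fun t => ?_))
  exact congrFun (congrFun (pairAction_antisymm (T := T i t) (hC.antisymm t)) a) b

/-- Differentiating the invariance under `P t`: the pair action vanishes at `t = 0`, so the
derivative of `P` drops out. -/
lemma deriv_mul_left (h : IsProjectedFamily P T) (i : κ) : P 0 * F i = F i := by
  have h1 : ∀ t, P t * pairAction (T i t) (C t) = pairAction (T i t) (C t) := by
    intro t
    rw [pairAction, Matrix.mul_add, ← Matrix.mul_assoc, h.mul_left, ← Matrix.mul_assoc, hC.mul_left]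
  have h2 := hasDerivAt_mul_entry (fun a b => (h.differentiableAt a b).hasDerivAt)
    (A' := Matrix.of fun a b => deriv (fun t => P t a b) 0) (hC.hasDerivAt i)
  simp only [h1, hC.zero, Matrix.mul_zero, zero_add] at h2
  exact hasDerivAt_unique_entry h2 (hC.hasDerivAt i)

lemma pow_mem_filledStates (h : IsProjectedFamily P T) (t : ℝ) (n : ℕ) :
    (pairCreate (C t) ^ n) (vacuum ι) ∈ filledStates (P t) ⊤ (2 * n) :=
  ⟨pairCreate_pow_vacuum_mem_supportedOn (h.isHermitian t) (h.idem t) (hC.antisymm t)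
    (hC.mul_left t) n, pairCreate_pow_vacuum_mem_numberSector _ _, trivial⟩

lemma bilinear_pow (i : κ) (t : ℝ) (n : ℕ) : bilinear (T i t) ((pairCreate (C t) ^ n) (vacuum ι))
    = (n : ℂ) • (pairCreate (C t) ^ (n - 1)) (pairCreate (pairAction (T i t) (C t)) (vacuum ι)) :=
  bilinear_pairCreate_pow_vacuum _ _ _

lemma bilinear_pow_zero (i : κ) (n : ℕ) :
    bilinear (T i 0) ((pairCreate (C 0) ^ n) (vacuum ι)) = 0 := by
  rw [hC.bilinear_pow, hC.zero, pairCreate_zero]; simp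

lemma hasDerivAt_bilinear_pow (i : κ) (n : ℕ) :
    HasDerivAt (fun t => bilinear (T i t) ((pairCreate (C t) ^ n) (vacuum ι)))
      ((n : ℂ) • (pairCreate (C 0) ^ (n - 1)) (pairCreate (F i) (vacuum ι))) 0 := by
  simp only [hC.bilinear_pow]
  refine HasDerivAt.fun_const_smul (n : ℂ) ?_
  refine hasDerivAt_pairCreate_pow hC.differentiableAt ?_ (by rw [hC.zero, pairCreate_zero]; simp) _
  have := hasDerivAt_pairCreate (hC.hasDerivAt i) (hasDerivAt_const (0 : ℝ) (vacuum ι))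
  simpa using this

/-- The `n` pairs of the condensate contribute identical terms to the velocity of each bilinear,
which gives the factor `n ^ 2`. -/
lemma le_of_condensate (h : IsProjectedFamily P T) {n : ℕ} {l : ℝ}
    (hl : (fun t => familyEnergy P T ⊤ (2 * n) t - l * t ^ 2) =o[𝓝 0] fun t : ℝ => t ^ 2)
    (h0 : (pairCreate (C 0) ^ n) (vacuum ι) ≠ 0) :
    l * ‖(pairCreate (C 0) ^ n) (vacuum ι)‖ ^ 2
      ≤ n ^ 2 * ∑ i, ‖(pairCreate (C 0) ^ (n - 1)) (pairCreate (F i) (vacuum ι))‖ ^ 2 := by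
  have := h.familyEnergy_le_of_trial hl
    (differentiableAt_pairCreate_pow hC.differentiableAt (vacuum ι) n).continuousAt h0
    (fun t => hC.pow_mem_filledStates h t n) (fun i => hC.hasDerivAt_bilinear_pow i n)
    (fun i => hC.bilinear_pow_zero i n)
  simpa only [norm_smul, mul_pow, Complex.norm_natCast, ← Finset.mul_sum] using this

/-- Comparison with the completely filled state, where the bilinears act as their traces. -/
lemma norm_deriv_trace (h : IsProjectedFamily P T) {M : ℕ} (htr : ∀ t, (P t).trace = 2 * M)
    (h0 : (pairCreate (C 0) ^ M) (vacuum ι) ≠ 0) (i : κ) :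
    (T i 0).trace = 0 ∧
    M ^ 2 * ‖(pairCreate (C 0) ^ (M - 1)) (pairCreate (F i) (vacuum ι))‖ ^ 2
      = ‖deriv (fun t => (T i t).trace) 0‖ ^ 2 * ‖(pairCreate (C 0) ^ M) (vacuum ι)‖ ^ 2 := by
  have h1 : ∀ t, bilinear (T i t) ((pairCreate (C t) ^ M) (vacuum ι))
      = (T i t).trace • (pairCreate (C t) ^ M) (vacuum ι) := fun t =>
    bilinear_apply_of_filled (h.isHermitian t) (h.idem t) (h.mul_left i t) (N := 2 * M)
      (by rw [htr]; push_cast; ring) (hC.pow_mem_filledStates h t M).1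
      (hC.pow_mem_filledStates h t M).2.1
  have h2 : (T i 0).trace = 0 := by
    have h3 := h1 0
    rw [hC.bilinear_pow_zero, eq_comm, smul_eq_zero] at h3
    exact h3.resolve_right h0
  refine ⟨h2, ?_⟩
  have h3 := hC.hasDerivAt_bilinear_pow i M
  simp only [h1] at h3
  have htd : DifferentiableAt ℝ (fun t => (T i t).trace) 0 := by
    simp only [Matrix.trace, Matrix.diag]
    exact DifferentiableAt.fun_sum fun a _ => h.differentiableAt_op i a a
  have h4 := htd.hasDerivAt.smul
    (differentiableAt_pairCreate_pow hC.differentiableAt (vacuum ι) M).hasDerivAt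
  rw [h2, zero_smul, zero_add] at h4
  have h5 := congrArg (fun x => ‖x‖ ^ 2) (h3.unique h4)
  simpa only [norm_smul, mul_pow, Complex.norm_natCast] using h5

end IsPairFamily

/-- A difference of squares is an `o(t)` difference of norms times an `O(t)` sum. -/
lemma isLittleO_norm_sq {E : Type*} [NormedAddCommGroup E] [NormedSpace ℝ E] {g : ℝ → E} {v : E}
    (hg : HasDerivAt g v 0) (h0 : g 0 = 0) :
    (fun t => ‖g t‖ ^ 2 - ‖v‖ ^ 2 * t ^ 2) =o[𝓝 0] fun t : ℝ => t ^ 2 := by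
  have h1 : (fun t : ℝ => ‖g t‖ - ‖t • v‖) =o[𝓝 0] fun t : ℝ => t := by
    have h2 := hasDerivAt_iff_isLittleO.mp hg
    simp only [h0, sub_zero] at h2
    refine (IsBigO.of_bound 1 (Eventually.of_forall fun t => ?_)).trans_isLittleO h2
    rw [one_mul, Real.norm_eq_abs]
    exact abs_norm_sub_norm_le _ _
  have h3 : (fun t : ℝ => ‖g t‖ + ‖t • v‖) =O[𝓝 0] fun t : ℝ => t := by
    have h4 : (fun t : ℝ => ‖t • v‖) =O[𝓝 0] fun t : ℝ => t :=
      IsBigO.of_bound ‖v‖ (Eventually.of_forall fun t => by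
        rw [norm_norm, norm_smul, mul_comm])
    have h5 := (h1.isBigO.add h4).add h4
    exact h5.congr_left fun t => by ring
  have h6 := h1.mul_isBigO h3
  refine (h6.congr_left fun t => ?_).congr_right fun t => ?_
  · rw [norm_smul, Real.norm_eq_abs]
    have := sq_abs t
    linear_combination (‖v‖ ^ 2) * (-this)
  · ring

/-- Quantum geometric nesting bound for a projected family: the curvature `l n` of the energy of
`2 n` particles is bounded by those of a single pair, `lp`, and of the filled state, `l M`. -/
theorem exists_curvatures {P : ℝ → Matrix ι ι ℂ} {T : κ → ℝ → Matrix ι ι ℂ}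
    (h : IsProjectedFamily P T) {M : ℕ} (hM : 1 ≤ M) (htr : ∀ t, (P t).trace = 2 * M)
    {W : Matrix ι ι ℂ} {c : ℝ} (hW : IsUniformPairing (P 0) W c M) (hc : 0 < c)
    (hzero : ∀ i, pairAction (T i 0) W = 0) {S : Submodule ℂ (Fock ι)}
    (hS : ∀ t, ∀ ψ ∈ S, bilinear (1 - P t) ψ ∈ S) (hWS : pairCreate W (vacuum ι) ∈ S)
    (huniq : ∀ ψ ∈ filledStates (P 0) S 2, (∀ i, bilinear (T i 0) ψ = 0) →
      ∃ z : ℂ, ψ = z • pairCreate W (vacuum ι)) :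
    ∃ (lp : ℝ) (l : ℕ → ℝ), 0 ≤ lp ∧
      ((fun t => familyEnergy P T S 2 t - lp * t ^ 2) =o[𝓝 0] fun t : ℝ => t ^ 2) ∧
      (∀ n ≤ M, (fun t => familyEnergy P T ⊤ (2 * n) t - l n * t ^ 2)
        =o[𝓝 0] fun t : ℝ => t ^ 2) ∧
      (∀ n ≤ M, (M - 1) * l n
        ≤ n * (M - n) * (lp - l M / M ^ 2) + (M - 1) * n ^ 2 * (l M / M ^ 2)) ∧
      l M = ∑ i, ‖deriv (fun t => (T i t).trace) 0‖ ^ 2 ∧ l 1 ≤ lp ∧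
      ∀ F : κ → Matrix ι ι ℂ,
        (∀ i a b, HasDerivAt (fun t => pairAction (T i t) (P t * W * (P t)ᵀ) a b) (F i a b) 0) →
          lp * ‖pairCreate W (vacuum ι)‖ ^ 2 ≤ ∑ i, ‖pairCreate (F i) (vacuum ι)‖ ^ 2 := by
  have hM0 : (0 : ℝ) < M := by exact_mod_cast hM
  have hW0 : pairCreate W (vacuum ι) ≠ 0 := by
    have := hW.norm_sq_pow_vacuum_pos hc hM
    rw [pow_one] at this
    intro h0; simp [h0] at this
  -- smooth families of pairs
  have hfam : ∀ (z : ℂ) (B : Matrix ι ι ℂ), Bᵀ = -B →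
      ∃ F, IsPairFamily P T (fun t => P t * (z • W + (t : ℂ) • B) * (P t)ᵀ) F := by
    intro z B hB
    have hd : ∀ a b, DifferentiableAt ℝ (fun t => (P t * (z • W + (t : ℂ) • B) * (P t)ᵀ) a b) 0 := by
      refine differentiableAt_mul_entry (differentiableAt_mul_entry h.differentiableAt ?_)
        fun a b => h.differentiableAt b a
      intro a b
      simp only [Matrix.add_apply, Matrix.smul_apply, smul_eq_mul]
      exact ((Complex.ofRealCLM.differentiableAt (x := (0 : ℝ))).mul_const (B a b)).const_add
        (z * W a b)
    have hC0 : P 0 * (z • W + ((0 : ℝ) : ℂ) • B) * (P 0)ᵀ = z • W := by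
      rw [Complex.ofReal_zero, zero_smul, add_zero, Matrix.mul_smul, hW.mul_left, Matrix.smul_mul,
        hW.mul_right]
    refine ⟨fun i => Matrix.of fun a b => deriv (fun t => pairAction (T i t)
      (P t * (z • W + (t : ℂ) • B) * (P t)ᵀ) a b) 0, ?_, ?_, hd, ?_, ?_⟩
    · intro t
      simp only [Matrix.transpose_mul, Matrix.transpose_transpose, Matrix.transpose_add,
        Matrix.transpose_smul, hW.antisymm, hB, smul_neg, ← neg_add, Matrix.neg_mul,
        Matrix.mul_neg, Matrix.mul_assoc]
    · intro t
      rw [← Matrix.mul_assoc, ← Matrix.mul_assoc, h.idem]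
    · intro i
      rw [hC0]
      have := hzero i
      rw [pairAction] at this ⊢
      rw [Matrix.mul_smul, Matrix.smul_mul, ← smul_add, this, smul_zero]
    · intro i a b
      refine DifferentiableAt.hasDerivAt ?_
      simp only [pairAction, Matrix.add_apply]
      exact (differentiableAt_mul_entry (h.differentiableAt_op i) hd a b).add
        (differentiableAt_mul_entry hd (fun a b => h.differentiableAt_op i b a) a b)
  have hC0 : ∀ (z : ℂ) (B : Matrix ι ι ℂ), P 0 * (z • W + ((0 : ℝ) : ℂ) • B) * (P 0)ᵀ = z • W := by
    intro z B
    rw [Complex.ofReal_zero, zero_smul, add_zero, Matrix.mul_smul, hW.mul_left, Matrix.smul_mul,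
      hW.mul_right]
  have hpow0 : ∀ n ≤ M, (pairCreate W ^ n) (vacuum ι) ≠ 0 := by
    intro n hn h0
    have := hW.norm_sq_pow_vacuum_pos hc hn
    simp [h0] at this
  -- The plain projected pair, without first-order correction, already supplies the zero modes
  -- needed for the existence of all curvatures.
  obtain ⟨F₁, hF₁⟩ := hfam 1 0 (by simp)
  have hC1 : P 0 * ((1 : ℂ) • W + ((0 : ℝ) : ℂ) • (0 : Matrix ι ι ℂ)) * (P 0)ᵀ = W := by
    rw [hC0, one_smul]
  -- existence of the expansions
  have hexist : ∀ n ≤ M, ∃ l : ℝ,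
      ((fun t => familyEnergy P T ⊤ (2 * n) t - l * t ^ 2) =o[𝓝 0] fun t : ℝ => t ^ 2) ∧
      ∀ᶠ t in 𝓝 (0 : ℝ), ∃ ψ ∈ filledStates (P t) ⊤ (2 * n), ‖ψ‖ = 1 := by
    intro n hn
    have hmem := hF₁.pow_mem_filledStates h 0 n
    have hz : ∀ i, _ := fun i => hF₁.bilinear_pow_zero i n
    simp only [hC1] at hmem hz
    have hnorm : 0 < ‖(pairCreate W ^ n) (vacuum ι)‖ := norm_pos_iff.mpr (hpow0 n hn)
    obtain ⟨l, -, hl, hl', -⟩ := h.exists_familyEnergy_secondOrder (S := ⊤) (N := 2 * n)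
      (fun _ _ _ => trivial) ⟨((‖(pairCreate W ^ n) (vacuum ι)‖⁻¹ : ℝ) : ℂ) • _,
        smul_mem_filledStates _ hmem, by
          rw [norm_smul, Complex.norm_real, norm_inv, norm_norm, inv_mul_cancel₀ hnorm.ne'], by
          intro i; rw [map_smul, hz, smul_zero]⟩
    exact ⟨l, hl, hl'⟩
  choose! l hl hlne using hexist
  have hWmem : pairCreate W (vacuum ι) ∈ filledStates (P 0) S 2 := by
    have hmem := hF₁.pow_mem_filledStates h 0 1
    simp only [hC1, pow_one] at hmem
    exact ⟨hmem.1, hmem.2.1, hWS⟩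
  have hWzero : ∀ i, bilinear (T i 0) (pairCreate W (vacuum ι)) = 0 := by
    intro i
    have := hF₁.bilinear_pow_zero i 1
    simpa only [hC1, pow_one] using this
  obtain ⟨lp, hlp0, hlp, -, happ⟩ := h.exists_familyEnergy_secondOrder (S := S) (N := 2) hS
    ⟨((‖pairCreate W (vacuum ι)‖⁻¹ : ℝ) : ℂ) • _, smul_mem_filledStates _ hWmem, by
      rw [norm_smul, Complex.norm_real, norm_inv, norm_norm,
        inv_mul_cancel₀ (norm_pos_iff.mpr hW0).ne'], by
      intro i; rw [map_smul, hWzero, smul_zero]⟩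
  have hvac : ∀ t (B : Matrix ι ι ℂ), vacate 2 (1 - P t) (pairCreate B (vacuum ι))
      = pairCreate (P t * B * (P t)ᵀ) (vacuum ι) := by
    intro t B
    rw [vacate_pairCreate_vacuum (h.one_sub_idem t), sub_sub_cancel]
  -- the filled state
  have hfull : l M = ∑ i, ‖deriv (fun t => (T i t).trace) 0‖ ^ 2 := by
    have htrace : ∀ i, (T i 0).trace = 0 := fun i =>
      (hF₁.norm_deriv_trace h htr (by rw [hC1]; exact hpow0 M le_rfl) i).1
    have htd : ∀ i, HasDerivAt (fun t => (T i t).trace) (deriv (fun t => (T i t).trace) 0) 0 := by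
      intro i
      refine DifferentiableAt.hasDerivAt ?_
      simp only [Matrix.trace, Matrix.diag]
      exact DifferentiableAt.fun_sum fun a _ => h.differentiableAt_op i a a
    have h1 : (fun t => ∑ i, ‖(T i t).trace‖ ^ 2
        - (∑ i, ‖deriv (fun t => (T i t).trace) 0‖ ^ 2) * t ^ 2) =o[𝓝 0] fun t : ℝ => t ^ 2 := by
      simp only [Finset.sum_mul, ← Finset.sum_sub_distrib]
      exact IsLittleO.fun_sum fun i _ => isLittleO_norm_sq (htd i) (htrace i)
    have h2 : (fun t => ∑ i, ‖(T i t).trace‖ ^ 2) =ᶠ[𝓝 0] familyEnergy P T ⊤ (2 * M) := by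
      filter_upwards [hlne M le_rfl] with t ht
      have h3 : ∀ ψ ∈ filledStates (P t) ⊤ (2 * M), ‖ψ‖ = 1 →
          ∑ i, ‖bilinear (T i t) ψ‖ ^ 2 = ∑ i, ‖(T i t).trace‖ ^ 2 := by
        intro ψ hψ hψ1
        refine Finset.sum_congr rfl fun i _ => ?_
        rw [bilinear_apply_of_filled (h.isHermitian t) (h.idem t) (h.mul_left i t) (N := 2 * M)
          (by rw [htr]; push_cast; ring) hψ.1 hψ.2.1, norm_smul, hψ1, mul_one]
      have h4 : {x | ∃ ψ ∈ filledStates (P t) ⊤ (2 * M), ‖ψ‖ = 1 ∧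
          x = ∑ i, ‖bilinear (T i t) ψ‖ ^ 2} = {∑ i, ‖(T i t).trace‖ ^ 2} := by
        ext x
        constructor
        · rintro ⟨ψ, h5, h6, rfl⟩
          exact h3 ψ h5 h6
        · intro hx
          obtain ⟨ψ, h5, h6⟩ := ht
          exact ⟨ψ, h5, h6, by rw [h3 ψ h5 h6]; exact hx⟩
      rw [familyEnergy, h4, csInf_singleton]
    have h3 : (fun t => familyEnergy P T ⊤ (2 * M) t
        - (∑ i, ‖deriv (fun t => (T i t).trace) 0‖ ^ 2) * t ^ 2) =o[𝓝 0] fun t : ℝ => t ^ 2 :=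
      h1.congr' (by filter_upwards [h2] with t ht; rw [ht]) EventuallyEq.rfl
    have h4 : familyEnergy P T ⊤ (2 * M) 0 = 0 := by
      rw [← h2.self_of_nhds]
      simp [htrace]
    have h5 := (hasSecondDerivAtZero_of_isLittleO h4 (hl M le_rfl)).unique
      (hasSecondDerivAtZero_of_isLittleO h4 h3)
    linarith
  -- condensates built from a nearly optimal pair
  have hopt : ∀ ε > 0, ∃ (z : ℂ) (B : Matrix ι ι ℂ) (F : κ → Matrix ι ι ℂ), z ≠ 0 ∧
      ‖pairCreate (z • W) (vacuum ι)‖ = 1 ∧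
      IsPairFamily P T (fun t => P t * (z • W + (t : ℂ) • B) * (P t)ᵀ) F ∧
      ∑ i, ‖pairCreate (F i) (vacuum ι)‖ ^ 2 < lp + ε := by
    intro ε hε
    obtain ⟨φ, hφ, ψ, hψ, v, hφ1, hφ0, hv, hlt⟩ := happ ε hε
    -- Uniqueness enters here: the zero mode of a nearly optimal pair is the condensed pair up to a
    -- scalar, so its powers are again zero-energy states of known norm.
    obtain ⟨z, rfl⟩ := huniq φ hφ hφ0
    obtain ⟨B, hB, rfl⟩ := exists_pairCreate_vacuum hψ.2.1
    obtain ⟨F, hF⟩ := hfam z B hB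
    have hz : z ≠ 0 := by rintro rfl; simp at hφ1
    refine ⟨z, B, F, hz, by rw [pairCreate_smul]; exact hφ1, hF, ?_⟩
    -- The projected first-order curve is itself created by a pair operator, with wave function `P
    -- (z W + t B) Pᵀ`. It can therefore be repeated `n` times in a many-particle trial state.
    have hvF : ∀ i, v i = pairCreate (F i) (vacuum ι) := by
      intro i
      have h1 := hF.hasDerivAt_bilinear_pow i 1
      simp only [pow_one, Nat.cast_one, one_smul, Nat.sub_self, pow_zero,
        Module.End.one_apply] at h1
      refine (hv i).unique (h1.congr_of_eventuallyEq (Eventually.of_forall fun t => ?_))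
      have : (t : ℝ) • pairCreate B (vacuum ι) = (t : ℂ) • pairCreate B (vacuum ι) := by
        exact (Complex.coe_smul t _).symm
      simp only [this]
      rw [← LinearMap.smul_apply, ← LinearMap.smul_apply, ← pairCreate_smul, ← pairCreate_smul,
        ← LinearMap.add_apply, ← pairCreate_add, hvac]
    simpa only [hvF] using hlt
  have hscale : ∀ z : ℂ, z ≠ 0 → IsUniformPairing (P 0) (z • W) (‖z‖ ^ 2 * c) M := by
    intro z hz
    refine ⟨by rw [Matrix.transpose_smul, hW.antisymm, smul_neg],
      by rw [Matrix.mul_smul, hW.mul_left], ?_, hW.trace⟩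
    rw [Matrix.conjTranspose_smul, Matrix.smul_mul, Matrix.mul_smul, hW.mul_conjTranspose,
      smul_smul, smul_smul]
    congr 1
    push_cast
    rw [← Complex.mul_conj']
    simp
  refine ⟨lp, l, hlp0, hlp, hl, ?_, hfull, ?_, ?_⟩
  · intro n hn
    rcases Nat.lt_or_ge M 2 with hM2 | hM2
    · obtain rfl : M = 1 := by omega
      have : n = 0 ∨ n = 1 := by omega
      rcases this with rfl | rfl <;> simp
    have hM2' : (2 : ℝ) ≤ M := by exact_mod_cast hM2
    have hn' : (n : ℝ) ≤ M := by exact_mod_cast hn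
    have key : ∀ ε > 0, (M - 1) * l n
        ≤ n * (M - n) * (lp + ε - l M / M ^ 2) + (M - 1) * n ^ 2 * (l M / M ^ 2) := by
      intro ε hε
      obtain ⟨z, B, F, hz, hz1, hF, hlt⟩ := hopt ε hε
      have hU := hscale z hz
      have hc' : 0 < ‖z‖ ^ 2 * c := by positivity
      -- The coefficient of `F i` along the condensed pair.
      set γ : κ → ℂ := fun i => ((z • W)ᴴ * F i).trace / (2 * M * ((‖z‖ ^ 2 * c : ℝ) : ℂ)) with hγ
      have hγ' : ∀ i, ((z • W)ᴴ * F i).trace = 2 * M * ((‖z‖ ^ 2 * c : ℝ) : ℂ) * γ i := by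
        intro i
        have h1 : (M : ℂ) ≠ 0 := by exact_mod_cast hM0.ne'
        have h2 : ((‖z‖ ^ 2 * c : ℝ) : ℂ) ≠ 0 := by exact_mod_cast hc'.ne'
        rw [hγ]; field_simp
      have hnorm : ∀ i, ∀ m : ℕ, _ := fun i m => hU.norm_sq_pow_pairCreate (hF.deriv_antisymm i)
        (hF.deriv_mul_left h i) (hγ' i) m
      simp only [hz1, one_pow, mul_one] at hnorm
      -- At complete filling the weight `M - n` of the orthogonal component is zero, so comparison
      -- with the action by the trace determines `γ i` in modulus. Cancelling `M - 1` is possible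
      -- because `M ≥ 2` here.
      have hγM : ∀ i, M ^ 2 * ‖γ i‖ ^ 2 = ‖deriv (fun t => (T i t).trace) 0‖ ^ 2 := by
        intro i
        have h1 := hU.norm_sq_pow_vacuum_pos hc' (le_refl M)
        have h2 := (hF.norm_deriv_trace h htr (by
          rw [hC0]; intro h0; simp [h0] at h1) i).2
        rw [hC0] at h2
        have h3 := hnorm i (M - 1)
        have h4 : ((M - 1 : ℕ) : ℝ) + 1 = M := by
          rw [Nat.cast_sub hM, Nat.cast_one]; ring
        rw [h4, Nat.sub_add_cancel hM, sub_self, mul_zero, zero_mul, zero_add,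
          mul_assoc ((M : ℝ) - 1), h2] at h3
        have h5 : (M : ℝ) - 1 ≠ 0 := by linarith
        have h6 : ((M : ℝ) - 1) * ‖(pairCreate (z • W) ^ M) (vacuum ι)‖ ^ 2 ≠ 0 :=
          mul_ne_zero h5 h1.ne'
        refine mul_left_cancel₀ h6 ?_
        linear_combination -h3
      have hΓ : ∑ i, ‖γ i‖ ^ 2 = l M / M ^ 2 := by
        rw [hfull, eq_div_iff (by positivity), Finset.sum_mul]
        exact Finset.sum_congr rfl fun i _ => by rw [mul_comm]; exact hγM i
      rw [← hΓ]
      rcases n with _ | n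
      · have h1 := hF.le_of_condensate h (hl 0 hn) (by simp [vacuum_ne_zero])
        simp at h1 ⊢
        nlinarith
      have h1 := hU.norm_sq_pow_vacuum_pos hc' hn
      have h2 := hF.le_of_condensate h (hl (n + 1) hn) (by
        rw [hC0]; intro h0; simp [h0] at h1)
      rw [hC0, Nat.add_sub_cancel] at h2
      push_cast at h2 hn' ⊢
      set a := ‖(pairCreate (z • W) ^ (n + 1)) (vacuum ι)‖ ^ 2 with ha
      have h3 : ((M : ℝ) - 1) * ((n + 1) ^ 2 *
          ∑ i, ‖(pairCreate (z • W) ^ n) (pairCreate (F i) (vacuum ι))‖ ^ 2)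
          = a * ((n + 1) * (M - (n + 1)) * (∑ i, ‖pairCreate (F i) (vacuum ι)‖ ^ 2
            - ∑ i, ‖γ i‖ ^ 2) + (M - 1) * (n + 1) ^ 2 * ∑ i, ‖γ i‖ ^ 2) := by
        rw [← mul_assoc, Finset.mul_sum, Finset.sum_congr rfl fun i _ => hnorm i n,
          ← Finset.mul_sum, Finset.sum_add_distrib, ← Finset.mul_sum, ← Finset.mul_sum,
          Finset.sum_sub_distrib]
      have h4 : (M - 1) * l (n + 1) * a ≤ ((n + 1) * (M - (n + 1)) *
          (∑ i, ‖pairCreate (F i) (vacuum ι)‖ ^ 2 - ∑ i, ‖γ i‖ ^ 2)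
            + (M - 1) * (n + 1) ^ 2 * ∑ i, ‖γ i‖ ^ 2) * a := by
        have h5 := mul_le_mul_of_nonneg_left h2 (show (0 : ℝ) ≤ M - 1 by linarith)
        rw [h3] at h5
        linarith
      have h5 := le_of_mul_le_mul_right h4 h1
      refine h5.trans ?_
      have h6 : (0 : ℝ) ≤ (n + 1) * (M - (n + 1)) := mul_nonneg (by positivity) (by linarith)
      gcongr
    refine le_of_forall_pos_le_add fun ε hε => ?_
    have h1 : (0 : ℝ) ≤ n * (M - n) := mul_nonneg (by positivity) (by linarith)
    have h2 := key (ε / (n * (M - n) + 1)) (by positivity)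
    have h3 : (n : ℝ) * (M - n) * (ε / (n * (M - n) + 1)) ≤ ε := by
      rw [mul_div_assoc', div_le_iff₀ (by positivity)]
      nlinarith
    linarith
  -- The preceding inequality carries a factor `M - 1` and says nothing for `M = 1`; this direct
  -- comparison with one optimal pair covers that case in the BCS average.
  · refine le_of_forall_pos_le_add fun ε hε => ?_
    obtain ⟨z, B, F, hz, hz1, hF, hlt⟩ := hopt ε hε
    have h1 := hF.le_of_condensate h (n := 1) (hl 1 hM) (by
      rw [hC0, pow_one]; intro h0; rw [h0] at hz1; simp at hz1)
    rw [hC0, pow_one, hz1] at h1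
    simp at h1
    linarith
  -- An explicit trial pair, the projection of `W` without correction term. It need not be optimal,
  -- but its velocities can be estimated uniformly in the system size.
  · intro F hF
    have hd : ∀ a b, DifferentiableAt ℝ (fun t => (P t * W * (P t)ᵀ) a b) 0 :=
      differentiableAt_mul_entry (differentiableAt_mul_entry h.differentiableAt
        fun _ _ => differentiableAt_const _) fun a b => h.differentiableAt b a
    have h0 : P 0 * W * (P 0)ᵀ = W := by rw [hW.mul_left, hW.mul_right]
    have hmem : ∀ t, pairCreate (P t * W * (P t)ᵀ) (vacuum ι) ∈ filledStates (P t) S 2 := by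
      intro t
      rw [← hvac]
      exact h.vacate_mem_filledStates (hS t) hWmem.2.1 hWS
    have hu : DifferentiableAt ℝ (fun t => pairCreate (P t * W * (P t)ᵀ) (vacuum ι)) 0 := by
      have := differentiableAt_pairCreate_pow hd (vacuum ι) 1
      simpa only [pow_one] using this
    have hv : ∀ i, HasDerivAt (fun t => bilinear (T i t) (pairCreate (P t * W * (P t)ᵀ) (vacuum ι)))
        (pairCreate (F i) (vacuum ι)) 0 := by
      intro i
      simp only [bilinear_pairCreate_vacuum]
      have := hasDerivAt_pairCreate (hF i) (hasDerivAt_const (0 : ℝ) (vacuum ι))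
      simpa only [map_zero, zero_add, pairAction] using this
    have := h.familyEnergy_le_of_trial hlp hu.continuousAt (by simp only [h0]; exact hW0) hmem hv
      (by simp only [h0]; exact hWzero)
    simpa only [h0] using this

/-! ### Uniformity of the pairing -/

lemma mul_conjTranspose_comm {P M : Matrix ι ι ℂ} (hP : P.IsHermitian) (hPM : P * M = M * Pᵀ) :
    M * Pᵀ * Mᴴ = M * Mᴴ * P := by
  have h1 : Pᵀᴴ = Pᵀ := hP.transpose.eq
  have h2 : Mᴴ * P = Pᵀ * Mᴴ := by
    have := congrArg Matrix.conjTranspose hPM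
    rwa [Matrix.conjTranspose_mul, Matrix.conjTranspose_mul, hP.eq, h1] at this
  rw [Matrix.mul_assoc, ← h2, Matrix.mul_assoc]

/-- If the pairings `M` and `M M† M` agree up to a factor on the filled subspace, then `M` pairs all
filled states with the same amplitude. -/
lemma exists_isUniformPairing {P M : Matrix ι ι ℂ} (hP : P.IsHermitian) (hPP : P * P = P)
    (hM : Mᵀ = -M) (hPM : P * M = M * Pᵀ) (hinj : ∀ v, P *ᵥ v = v → Mᴴ *ᵥ v = 0 → v = 0) {n : ℕ}
    (hn : 1 ≤ n) (htr : P.trace = 2 * n) {z : ℂ}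
    (hz : M * Mᴴ * M * Pᵀ = z • (M * Pᵀ)) : ∃ c : ℝ, 0 < c ∧ IsUniformPairing P (M * Pᵀ) c n := by
  have h0 := mul_conjTranspose_comm hP hPM
  -- `M Mᴴ` has the same kernel as `Mᴴ`, and injectivity makes this kernel trivial on the range of
  -- `P`.
  have hzero : ∀ X : Matrix ι ι ℂ, P * X = X → M * Mᴴ * X = 0 → X = 0 := by
    intro X hX hRX
    have h1 : (Mᴴ * X)ᴴ * (Mᴴ * X) = 0 := by
      rw [Matrix.conjTranspose_mul, Matrix.conjTranspose_conjTranspose, Matrix.mul_assoc,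
        ← Matrix.mul_assoc M, hRX, Matrix.mul_zero]
    have h2 : Mᴴ * X = 0 := Matrix.conjTranspose_mul_self_eq_zero.mp h1
    ext a b
    have h3 := hinj (X.col b) ?_ ?_
    · exact congrFun h3 a
    · ext c
      exact congrFun (congrFun hX c) b
    · ext c
      exact congrFun (congrFun h2 c) b
  have hPR : P * (M * Mᴴ) = M * Mᴴ * P := by
    rw [← Matrix.mul_assoc, hPM, h0]
  -- Multiplying the proportionality by `Mᴴ` from the right gives this identity with an additional
  -- factor `M Mᴴ` on the left, which can be cancelled.
  have h1 : M * Mᴴ * P = z • P := by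
    rw [← sub_eq_zero]
    refine hzero _ ?_ ?_
    · rw [Matrix.mul_sub, ← Matrix.mul_assoc, hPR, Matrix.mul_assoc, hPP, Matrix.mul_smul, hPP]
    · have h2 := congrArg (· * Mᴴ) hz
      simp only [Matrix.smul_mul] at h2
      rw [h0, Matrix.mul_assoc (M * Mᴴ) M, Matrix.mul_assoc (M * Mᴴ), h0] at h2
      rw [Matrix.mul_sub, h2, Matrix.mul_smul, sub_self]
  have hn0 : (2 * n : ℂ) ≠ 0 := by
    have : (n : ℂ) ≠ 0 := by exact_mod_cast (by omega : n ≠ 0)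
    simpa
  -- Taking traces shows that the scalar is real and nonnegative.
  have h2 : z * (2 * n) = ((∑ a, ∑ b, ‖(Mᴴ * P) a b‖ ^ 2 : ℝ) : ℂ) := by
    rw [← trace_conjTranspose_mul_self_re, ← htr, ← smul_eq_mul, ← Matrix.trace_smul, ← h1,
      Matrix.conjTranspose_mul, Matrix.conjTranspose_conjTranspose, hP.eq, Matrix.mul_assoc P,
      ← Matrix.mul_assoc M, ← Matrix.mul_assoc, hPR, Matrix.mul_assoc (M * Mᴴ), hPP]
  set r : ℝ := (∑ a, ∑ b, ‖(Mᴴ * P) a b‖ ^ 2) / (2 * n) with hr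
  have hzr : z = r := by
    rw [hr]; push_cast
    rw [eq_div_iff hn0, h2]; push_cast; rfl
  have hr0 : 0 ≤ r := by positivity
  have hr1 : r ≠ 0 := by
    intro h3
    rw [hzr, h3, Complex.ofReal_zero, zero_smul] at h1
    have h4 := hzero P hPP h1
    rw [h4, Matrix.trace_zero] at htr
    exact hn0 htr.symm
  refine ⟨r, lt_of_le_of_ne hr0 hr1.symm, ?_, ?_, ?_, htr⟩
  · rw [Matrix.transpose_mul, Matrix.transpose_transpose, hM, Matrix.mul_neg, hPM]
  · rw [← Matrix.mul_assoc, hPM, Matrix.mul_assoc, ← Matrix.transpose_mul, hPP]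
  · have h3 : Pᵀᴴ = Pᵀ := hP.transpose.eq
    rw [Matrix.conjTranspose_mul, h3, Matrix.mul_assoc, ← Matrix.mul_assoc Pᵀ,
      ← Matrix.transpose_mul, hPP, ← Matrix.mul_assoc, h0, h1, hzr]

/-- Zero modes of an operator `T` within the filled subspace for which `M` is a zero mode of `T` and
of `T†`. -/
lemma pairAction_zero_modes {P M T : Matrix ι ι ℂ} (hPM : P * M = M * Pᵀ) (hT : T * P = T)
    (h1 : pairAction T M = 0) (h2 : pairAction Tᴴ M = 0) :
    pairAction T (M * Pᵀ) = 0 ∧ pairAction T (M * Mᴴ * M * Pᵀ) = 0 := by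
  have h3 : Pᵀ * Tᵀ = Tᵀ := by rw [← Matrix.transpose_mul, hT]
  have hTM : T * M = -(M * Tᵀ) := eq_neg_of_add_eq_zero_left h1
  have hMT : Mᴴ * T = -(Tᵀ * Mᴴ) := by
    have h4 : Tᴴ * M = -(M * Tᴴᵀ) := eq_neg_of_add_eq_zero_left h2
    have h5 := congrArg Matrix.conjTranspose h4
    rw [Matrix.conjTranspose_neg, Matrix.conjTranspose_mul, Matrix.conjTranspose_mul,
      Matrix.conjTranspose_conjTranspose] at h5
    have h6 : Tᴴᵀᴴ = Tᵀ := by ext; simp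
    rwa [h6] at h5
  have hTMP : T * (M * Pᵀ) = -(M * Tᵀ) := by
    rw [← hPM, ← Matrix.mul_assoc, hT, hTM]
  refine ⟨?_, ?_⟩
  · rw [pairAction, hTMP, Matrix.mul_assoc, h3]; simp
  · have hTR : T * (M * Mᴴ) = M * Mᴴ * T := by
      rw [← Matrix.mul_assoc, hTM, Matrix.neg_mul, Matrix.mul_assoc, Matrix.mul_assoc, hMT,
        Matrix.mul_neg]
    rw [pairAction, Matrix.mul_assoc (M * Mᴴ), ← Matrix.mul_assoc, hTR, Matrix.mul_assoc (M * Mᴴ),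
      hTMP, Matrix.mul_assoc (M * Mᴴ) (M * Pᵀ), Matrix.mul_assoc M Pᵀ, h3]
    simp

/-- Nesting moves `P` through `M` as `Pᵀ`, so projecting the operator sandwiches the whole pair
action between `P` and `Pᵀ`. -/
lemma pairAction_projected {P M S : Matrix ι ι ℂ} (hPM : P * M = M * Pᵀ)
    (h : pairAction S M = 0) : pairAction (P * S * P) M = 0 := by
  have h1 : pairAction (P * S * P) M = P * pairAction S M * Pᵀ := by
    simp only [pairAction, Matrix.transpose_mul, Matrix.mul_add, Matrix.add_mul]
    congr 1
    · rw [Matrix.mul_assoc _ P M, hPM]; simp only [Matrix.mul_assoc]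
    · rw [← Matrix.mul_assoc M, ← hPM]; simp only [Matrix.mul_assoc]
  rw [h1, h]; simp

lemma pairAction_smul (z : ℂ) (T M : Matrix ι ι ℂ) : pairAction (z • T) M = z • pairAction T M := by
  simp [pairAction]

lemma pairAction_sum {κ : Type*} (s : Finset κ) (T : κ → Matrix ι ι ℂ) (M : Matrix ι ι ℂ) :
    pairAction (∑ i ∈ s, T i) M = ∑ i ∈ s, pairAction (T i) M := by
  simp only [pairAction, Matrix.transpose_sum, Finset.sum_mul, Finset.mul_sum,
    Finset.sum_add_distrib]

/-! ### Crystal momenta -/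

open scoped MatrixOrder in
lemma exists_conjTranspose_mul_self {gen : Type*} [Fintype gen] {V : Matrix gen gen ℂ}
    (h : V.PosSemidef) : ∃ B : Matrix gen gen ℂ, V = Bᴴ * B := by
  classical
  exact CStarAlgebra.nonneg_iff_eq_star_mul_self.mp h.nonneg

section Mesh

variable {d : ℕ} {L : Fin d → ℕ} [∀ i, NeZero (L i)]

/-- Momenta are determined by their integer labels up to reciprocal lattice vectors. -/
lemma Mesh.exists_val_eq (n : Mesh L) (z : Fin d → ℤ) (h : ∀ i, (z i : ZMod (L i)) = n i) :
    ∃ m : Fin d → ℤ, n.val = fun i => 2 * Real.pi * z i / L i + 2 * Real.pi * m i := by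
  have h1 : ∀ i, (L i : ℤ) ∣ (n i).val - z i := by
    intro i
    rw [← ZMod.intCast_zmod_eq_zero_iff_dvd]
    push_cast
    rw [h i, ZMod.natCast_zmod_val, sub_self]
  choose m hm using h1
  refine ⟨m, ?_⟩
  ext i
  have h2 : ((n i).val : ℝ) = z i + L i * m i := by
    have := hm i
    have h3 : ((n i).val : ℤ) = z i + L i * m i := by linarith
    exact_mod_cast h3
  have h4 : (L i : ℝ) ≠ 0 := by exact_mod_cast NeZero.ne (L i)
  rw [Mesh.val, h2]
  field_simp

/-- Mesh momenta have representatives in `[0, 2π)`, and negation leaves this range. The discrepancy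
is a reciprocal lattice vector, which the periodic embedding absorbs. -/
lemma Mesh.exists_val_neg (n : Mesh L) :
    ∃ m : Fin d → ℤ, (-n).val = fun i => (-n.val) i + 2 * Real.pi * m i := by
  obtain ⟨m, hm⟩ := Mesh.exists_val_eq (-n) (fun i => -((n i).val : ℤ)) (by simp)
  refine ⟨m, hm.trans ?_⟩
  ext i
  simp only [Mesh.val, Pi.neg_apply]
  push_cast
  ring

lemma card_mesh : Fintype.card (Mesh L) = volume L := by
  rw [Fintype.card_pi, volume]
  exact Finset.prod_congr rfl fun i _ => ZMod.card (L i)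

lemma volume_pos : 0 < volume L := Finset.prod_pos fun i _ => Nat.pos_of_ne_zero (NeZero.ne (L i))

end Mesh

/-! ### Matrices which map momenta to momenta -/

section Block

variable {K orb : Type*} [Fintype K] [DecidableEq K] [Fintype orb]

/-- A single-particle operator with matrix elements between the momenta `k` and `f k` only. -/
def blockMatrix (f : K → K) (X : K → K → Matrix orb orb ℂ) : Matrix (K × orb) (K × orb) ℂ :=
  Matrix.of fun x y => if y.1 = f x.1 then X x.1 y.1 x.2 y.2 else 0

lemma blockMatrix_congr {f : K → K} {X Y : K → K → Matrix orb orb ℂ}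
    (h : ∀ k, X k (f k) = Y k (f k)) : blockMatrix f X = blockMatrix f Y := by
  ext x y
  simp only [blockMatrix, Matrix.of_apply]
  split_ifs with h1
  · rw [h1, h]
  · rfl

lemma blockMatrix_mul (f g : K → K) (X Y : K → K → Matrix orb orb ℂ) :
    blockMatrix f X * blockMatrix g Y
      = blockMatrix (g ∘ f) fun k k' => X k (f k) * Y (f k) k' := by
  ext x y
  simp only [blockMatrix, Matrix.mul_apply, Matrix.of_apply, Fintype.sum_prod_type]
  rw [Finset.sum_eq_single (f x.1)]
  · by_cases h : y.1 = g (f x.1) <;> simp [h]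
  · intro k _ hk
    simp [hk]
  · simp

lemma blockMatrix_add (f : K → K) (X Y : K → K → Matrix orb orb ℂ) :
    blockMatrix f X + blockMatrix f Y = blockMatrix f fun k k' => X k k' + Y k k' := by
  ext x y
  simp only [blockMatrix, Matrix.add_apply, Matrix.of_apply]
  split_ifs <;> simp

lemma blockMatrix_zero (f : K → K) :
    blockMatrix f (fun _ _ => (0 : Matrix orb orb ℂ)) = 0 := by
  ext x y
  simp [blockMatrix]

lemma blockMatrix_neg (f : K → K) (X : K → K → Matrix orb orb ℂ) :
    -blockMatrix f X = blockMatrix f fun k k' => -X k k' := by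
  ext x y
  simp only [blockMatrix, Matrix.neg_apply, Matrix.of_apply]
  split_ifs <;> simp

lemma blockMatrix_transpose {f g : K → K} (hfg : ∀ k k', k = f k' ↔ k' = g k)
    (X : K → K → Matrix orb orb ℂ) :
    (blockMatrix f X)ᵀ = blockMatrix g fun k k' => (X k' k)ᵀ := by
  ext x y
  simp only [blockMatrix, Matrix.transpose_apply, Matrix.of_apply, hfg]

lemma blockMatrix_conjTranspose {f g : K → K} (hfg : ∀ k k', k = f k' ↔ k' = g k)
    (X : K → K → Matrix orb orb ℂ) :
    (blockMatrix f X)ᴴ = blockMatrix g fun k k' => (X k' k)ᴴ := by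
  ext x y
  simp only [blockMatrix, Matrix.conjTranspose_apply, Matrix.of_apply, hfg]
  split_ifs <;> simp

end Block

/-! ### The model on the momentum mesh: nesting, vertices and the Hamiltonian as a sum of squares -/

namespace QGNModel

variable {d : ℕ} {orb gen : Type*} [Fintype orb] [DecidableEq orb] [Fintype gen]
  (𝓜 : QGNModel d orb gen) (L : Fin d → ℕ) [∀ i, NeZero (L i)]

lemma flatProj_eq (A : Fin d → ℝ) :
    𝓜.flatProj L A = blockMatrix id fun k _ => 𝓜.proj (k.val + A) := by
  ext x y
  simp only [flatProj, blockMatrix, Matrix.of_apply, id, eq_comm]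

lemma vertexMatrix_eq (A : Fin d → ℝ) (I : gen) (q : Mesh L) : 𝓜.vertexMatrix L A I q
    = blockMatrix (fun k => k + q) fun k k' => 𝓜.vertex I (k.val + A) (k'.val + A) := rfl

lemma flatProj_isHermitian (A : Fin d → ℝ) : (𝓜.flatProj L A).IsHermitian := by
  rw [Matrix.IsHermitian, flatProj_eq, blockMatrix_conjTranspose (g := id) (by simp [eq_comm])]
  exact blockMatrix_congr fun k => 𝓜.proj_isHermitian _

lemma flatProj_idem (A : Fin d → ℝ) : 𝓜.flatProj L A * 𝓜.flatProj L A = 𝓜.flatProj L A := by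
  rw [flatProj_eq, blockMatrix_mul]
  exact blockMatrix_congr fun k => 𝓜.proj_idem _

lemma flatProj_trace (A : Fin d → ℝ) : (𝓜.flatProj L A).trace = 2 * (𝓜.maxPairs L : ℂ) := by
  have h : ∀ k : Mesh L, ∑ α, 𝓜.proj (k.val + A) α α = 2 * 𝓜.nPair := fun k =>
    𝓜.proj_trace (k.val + A)
  simp only [Matrix.trace, Matrix.diag, flatProj, Matrix.of_apply, if_true, Fintype.sum_prod_type,
    h, Finset.sum_const, Finset.card_univ, card_mesh, maxPairs]
  push_cast
  rw [nsmul_eq_mul]; ring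

/-- The pair wave function `N_{αβ}` of two particles with opposite momenta. -/
def nestMatrix : Matrix (Mesh L × orb) (Mesh L × orb) ℂ :=
  blockMatrix (fun k => -k) fun _ _ => 𝓜.nest

lemma nestMatrix_transpose : (𝓜.nestMatrix L)ᵀ = -𝓜.nestMatrix L := by
  rw [nestMatrix, blockMatrix_transpose (g := fun k => -k) (fun k k' => eq_neg_iff_add_eq_zero.trans
    (by rw [eq_neg_iff_add_eq_zero, add_comm])), blockMatrix_neg, 𝓜.nest_antisymm]

lemma proj_val_neg (k : Mesh L) : 𝓜.proj (-k).val = 𝓜.proj (-k.val) := by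
  obtain ⟨m, hm⟩ := Mesh.exists_val_neg k
  rw [hm, 𝓜.proj_periodic]

lemma flatProj_mul_nestMatrix :
    𝓜.flatProj L 0 * 𝓜.nestMatrix L = 𝓜.nestMatrix L * (𝓜.flatProj L 0)ᵀ := by
  rw [flatProj_eq, nestMatrix, blockMatrix_transpose (g := id) (by simp [eq_comm]),
    blockMatrix_mul, blockMatrix_mul]
  refine blockMatrix_congr fun k => ?_
  simp only [Function.comp, id, add_zero]
  rw [𝓜.nest_nesting, proj_val_neg]

lemma vertexMatrix_conjTranspose (A : Fin d → ℝ) (I : gen) (q : Mesh L) :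
    (𝓜.vertexMatrix L A I q)ᴴ = 𝓜.vertexMatrix L A I (-q) := by
  rw [vertexMatrix_eq, vertexMatrix_eq, blockMatrix_conjTranspose (g := fun k => k + -q)
    (fun k k' => by rw [eq_add_neg_iff_add_eq, eq_comm])]
  exact blockMatrix_congr fun k => 𝓜.vertex_hermitian _ _ _

/-- Both terms of the pair action connect `k` with `-(k + q)`, and on this block their sum is the
commutation condition at the momenta `k` and `k + q`. -/
lemma pairAction_vertexMatrix (I : gen) (q : Mesh L) :
    pairAction (𝓜.vertexMatrix L 0 I q) (𝓜.nestMatrix L) = 0 := by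
  rw [pairAction, vertexMatrix_eq, nestMatrix, blockMatrix_transpose (g := fun k => k - q)
    (fun k k' => by rw [eq_sub_iff_add_eq, eq_comm]), blockMatrix_mul, blockMatrix_mul]
  have h : (fun k => -k) ∘ (fun k : Mesh L => k + q) = (fun k => k - q) ∘ fun k => -k := by
    ext k : 1; simp only [Function.comp]; abel
  rw [h, blockMatrix_add, ← blockMatrix_zero ((fun k => k - q) ∘ fun k : Mesh L => -k)]
  refine blockMatrix_congr fun k => ?_
  simp only [Function.comp, add_zero]
  have h1 : -k - q = -(k + q) := by abel
  obtain ⟨m, hm⟩ := Mesh.exists_val_neg k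
  obtain ⟨m', hm'⟩ := Mesh.exists_val_neg (k + q)
  rw [h1, hm, hm', 𝓜.vertex_periodic, 𝓜.vertex_commute]

lemma flatProj_mulVec_injective (v : Mesh L × orb → ℂ) (hv : 𝓜.flatProj L 0 *ᵥ v = v)
    (h : (𝓜.nestMatrix L)ᴴ *ᵥ v = 0) : v = 0 := by
  ext x
  obtain ⟨k, α⟩ := x
  have h1 : 𝓜.proj k.val *ᵥ (fun β => v (k, β)) = fun β => v (k, β) := by
    ext β
    have := congrFun hv (k, β)
    simpa [Matrix.mulVec, dotProduct, flatProj, Fintype.sum_prod_type] using this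
  have h2 : 𝓜.nestᴴ *ᵥ (fun β => v (k, β)) = 0 := by
    ext β
    have := congrFun h (-k, β)
    rw [nestMatrix, blockMatrix_conjTranspose (g := fun k => -k) (fun k k' =>
      eq_neg_iff_add_eq_zero.trans (by rw [eq_neg_iff_add_eq_zero, add_comm]))] at this
    simpa [Matrix.mulVec, dotProduct, blockMatrix, Fintype.sum_prod_type] using this
  exact congrFun (𝓜.nest_injective _ _ h1 h2) α

/-- A square root of the coupling. -/
def couplingRoot (q : Fin d → ℝ) : Matrix gen gen ℂ :=
  (exists_conjTranspose_mul_self (𝓜.coupling_posSemidef q)).choose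

lemma coupling_eq (q : Fin d → ℝ) : 𝓜.coupling q = (𝓜.couplingRoot q)ᴴ * 𝓜.couplingRoot q :=
  (exists_conjTranspose_mul_self (𝓜.coupling_posSemidef q)).choose_spec

/-- The single-particle operators projected onto the flat bands. -/
def projVertex (A : Fin d → ℝ) (I : gen) (q : Mesh L) :
    Matrix (Mesh L × orb) (Mesh L × orb) ℂ :=
  𝓜.flatProj L A * 𝓜.vertexMatrix L A I q * 𝓜.flatProj L A

/-- Single-particle operators `T_i` for which the Hamiltonian is `∑ T_i† T_i`. -/
def rootVertex (i : Mesh L × gen) (A : Fin d → ℝ) : Matrix (Mesh L × orb) (Mesh L × orb) ℂ :=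
  ((Real.sqrt (volume L))⁻¹ : ℂ) • ∑ J, 𝓜.couplingRoot i.1.val i.2 J • 𝓜.projVertex L A J i.1

lemma sum_coupling {E : Type*} [AddCommGroup E] [Module ℂ E] (q : Fin d → ℝ) (x : gen → gen → E) :
    ∑ I, ∑ J, 𝓜.coupling q I J • x I J
      = ∑ K, ∑ I, ∑ J, (star (𝓜.couplingRoot q K I) * 𝓜.couplingRoot q K J) • x I J := by
  simp only [coupling_eq, Matrix.mul_apply, Matrix.conjTranspose_apply, Finset.sum_smul]
  rw [Finset.sum_congr rfl fun I _ => Finset.sum_comm, Finset.sum_comm]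

/-- At each `q` the coupling is a Gram matrix. Distributing its root and the root of `𝖵⁻¹` over both
bilinears completes the squares. -/
lemma hamiltonian_apply (A : Fin d → ℝ) (ψ : Fock (Mesh L × orb)) :
    𝓜.hamiltonian L A ψ = ∑ i, LinearMap.adjoint (bilinear (𝓜.rootVertex L i A))
      (bilinear (𝓜.rootVertex L i A) ψ) := by
  have hV : ((Real.sqrt (volume L))⁻¹ : ℂ) * ((Real.sqrt (volume L))⁻¹ : ℂ)
      = (volume L : ℂ)⁻¹ := by
    rw [← mul_inv, ← Complex.ofReal_mul, Real.mul_self_sqrt (Nat.cast_nonneg _), Complex.ofReal_natCast]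
  have h1 : ∀ i : Mesh L × gen, bilinear (𝓜.rootVertex L i A) = ((Real.sqrt (volume L))⁻¹ : ℂ) •
      ∑ J, 𝓜.couplingRoot i.1.val i.2 J • 𝓜.projectedBilinear L A J i.1 := by
    intro i
    rw [rootVertex, bilinear_smul, bilinear_sum]
    simp only [bilinear_smul]
    rfl
  have h2 : star ((Real.sqrt (volume L))⁻¹ : ℂ) = ((Real.sqrt (volume L))⁻¹ : ℂ) := by
    rw [star_inv₀]; simp
  rw [hamiltonian, LinearMap.smul_apply, LinearMap.sum_apply, Fintype.sum_prod_type,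
    Finset.smul_sum]
  refine Finset.sum_congr rfl fun q _ => ?_
  rw [sum_coupling, LinearMap.sum_apply, Finset.smul_sum]
  refine Finset.sum_congr rfl fun K _ => ?_
  rw [h1]
  simp only [map_smulₛₗ, map_sum, LinearMap.smul_apply, LinearMap.sum_apply, LinearMap.comp_apply,
    Finset.smul_sum, smul_smul, starRingEnd_apply, RingHom.id_apply]
  rw [Finset.sum_comm]
  refine Finset.sum_congr rfl fun J _ => Finset.sum_congr rfl fun I _ => ?_
  have h3 : ((volume L : ℂ)⁻¹ * (star (𝓜.couplingRoot q.val K I) * 𝓜.couplingRoot q.val K J))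
      = ((Real.sqrt (volume L))⁻¹ : ℂ) * 𝓜.couplingRoot q.val K J
        * star (((Real.sqrt (volume L))⁻¹ : ℂ) * 𝓜.couplingRoot q.val K I) := by
    rw [← hV, star_mul', h2]
    ring
  rw [h3]

lemma inner_hamiltonian (A : Fin d → ℝ) (ψ : Fock (Mesh L × orb)) :
    (inner ℂ ψ (𝓜.hamiltonian L A ψ)).re = ∑ i, ‖bilinear (𝓜.rootVertex L i A) ψ‖ ^ 2 := by
  rw [hamiltonian_apply, inner_sum, Complex.re_sum]
  refine Finset.sum_congr rfl fun i _ => ?_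
  rw [LinearMap.adjoint_inner_right, inner_self_eq_ofReal, Complex.ofReal_re]

/-- States with zero total momentum. -/
def zeroMomentum : Submodule ℂ (Fock (Mesh L × orb)) :=
  gradedSector (fun x : Mesh L × orb => x.1) 0

lemma groundEnergy_eq (N : ℕ) (e : Fin d → ℝ) (t : ℝ) : 𝓜.groundEnergy L N (t • e)
    = familyEnergy (fun t => 𝓜.flatProj L (t • e)) (fun i t => 𝓜.rootVertex L i (t • e)) ⊤ N t := by
  rw [groundEnergy, lowestEnergy, familyEnergy]
  congr 1
  ext x
  simp only [inner_hamiltonian]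
  refine exists_congr fun ψ => and_congr_left fun _ => ?_
  exact ⟨fun h => ⟨h.1, h.2, trivial⟩, fun h => ⟨h.1, h.2.1⟩⟩

lemma mem_pairSector (A : Fin d → ℝ) (ψ : Fock (Mesh L × orb)) :
    ψ ∈ 𝓜.pairSector L A ↔ ψ ∈ filledStates (𝓜.flatProj L A) (zeroMomentum L) 2 :=
  ⟨fun h => ⟨h.1.1, h.1.2, h.2⟩, fun h => ⟨⟨h.1, h.2.1⟩, h.2.2⟩⟩

/-- Total momentum `Q` corresponds to the flat connection `Q / 2`, so the pair runs through the same
family at half speed. -/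
lemma pairEnergy_eq (e : Fin d → ℝ) (t : ℝ) : 𝓜.pairEnergy L (t • e)
    = familyEnergy (fun t => 𝓜.flatProj L (t • e)) (fun i t => 𝓜.rootVertex L i (t • e))
      (zeroMomentum L) 2 (1 / 2 * t) := by
  rw [pairEnergy, lowestEnergy, familyEnergy, smul_smul]
  congr 1
  ext x
  simp only [inner_hamiltonian, mem_pairSector]

end QGNModel

lemma eq_zero_of_isLittleO {f : ℝ → ℝ} {l : ℝ}
    (h : (fun t => f t - l * t ^ 2) =o[𝓝 0] fun t : ℝ => t ^ 2) : f 0 = 0 := by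
  have := (h.def one_pos).self_of_nhds
  simpa using this

lemma blockMatrix_ne_zero {K orb : Type*} [Fintype K] [DecidableEq K] [Fintype orb] {f : K → K}
    {X : K → K → Matrix orb orb ℂ} {a b : K × orb} (h : blockMatrix f X a b ≠ 0) :
    b.1 = f a.1 := by
  by_contra h'
  exact h (by simp [blockMatrix, h'])

/-! ### Uniform condensate and curvatures at fixed system size -/

namespace QGNModel

variable {d : ℕ} {orb gen : Type*} [Fintype orb] [DecidableEq orb] [Fintype gen]
  (𝓜 : QGNModel d orb gen) (L : Fin d → ℕ) [∀ i, NeZero (L i)]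

lemma flatProj_mul_rootVertex (i : Mesh L × gen) (A : Fin d → ℝ) :
    𝓜.flatProj L A * 𝓜.rootVertex L i A = 𝓜.rootVertex L i A := by
  simp only [rootVertex, projVertex, Matrix.mul_smul, Finset.mul_sum, ← Matrix.mul_assoc,
    flatProj_idem]

lemma rootVertex_mul_flatProj (i : Mesh L × gen) (A : Fin d → ℝ) :
    𝓜.rootVertex L i A * 𝓜.flatProj L A = 𝓜.rootVertex L i A := by
  simp only [rootVertex, projVertex, Matrix.smul_mul, Finset.sum_mul, Matrix.mul_assoc,
    flatProj_idem]

lemma differentiable_line (k e : Fin d → ℝ) : Differentiable ℝ fun t : ℝ => k + t • e := by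
  fun_prop

lemma differentiableAt_flatProj (e : Fin d → ℝ) (a b : Mesh L × orb) :
    DifferentiableAt ℝ (fun t : ℝ => 𝓜.flatProj L (t • e) a b) 0 := by
  simp only [flatProj, Matrix.of_apply]
  split_ifs
  · exact (((𝓜.proj_contDiff a.2 b.2).differentiable two_ne_zero).comp
      (differentiable_line a.1.val e)) 0
  · exact differentiableAt_const _

lemma differentiableAt_vertexMatrix (I : gen) (q : Mesh L) (e : Fin d → ℝ) (a b : Mesh L × orb) :
    DifferentiableAt ℝ (fun t : ℝ => 𝓜.vertexMatrix L (t • e) I q a b) 0 := by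
  simp only [vertexMatrix, Matrix.of_apply]
  split_ifs
  · exact (((𝓜.vertex_contDiff I a.2 b.2).differentiable two_ne_zero).comp
      ((differentiable_line a.1.val e).prodMk (differentiable_line b.1.val e))) 0
  · exact differentiableAt_const _

lemma differentiableAt_projVertex (I : gen) (q : Mesh L) (e : Fin d → ℝ) (a b : Mesh L × orb) :
    DifferentiableAt ℝ (fun t : ℝ => 𝓜.projVertex L (t • e) I q a b) 0 :=
  differentiableAt_mul_entry (differentiableAt_mul_entry (𝓜.differentiableAt_flatProj L e)
    (𝓜.differentiableAt_vertexMatrix L I q e)) (𝓜.differentiableAt_flatProj L e) a b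

lemma rootVertex_apply (i : Mesh L × gen) (A : Fin d → ℝ) (a b : Mesh L × orb) :
    𝓜.rootVertex L i A a b = ((Real.sqrt (volume L))⁻¹ : ℂ) *
      ∑ J, 𝓜.couplingRoot i.1.val i.2 J * 𝓜.projVertex L A J i.1 a b := by
  simp [rootVertex, Matrix.sum_apply]

lemma isProjectedFamily (e : Fin d → ℝ) :
    IsProjectedFamily (fun t : ℝ => 𝓜.flatProj L (t • e))
      (fun i (t : ℝ) => 𝓜.rootVertex L i (t • e)) where
  isHermitian _ := 𝓜.flatProj_isHermitian L _
  idem _ := 𝓜.flatProj_idem L _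
  differentiableAt := 𝓜.differentiableAt_flatProj L e
  mul_left _ _ := 𝓜.flatProj_mul_rootVertex L _ _
  differentiableAt_op i a b := by
    simp only [rootVertex_apply]
    exact (DifferentiableAt.fun_sum fun J _ =>
      (𝓜.differentiableAt_projVertex L J i.1 e a b).const_mul _).const_mul _

lemma bilinear_one_sub_flatProj_mem (A : Fin d → ℝ) {ψ : Fock (Mesh L × orb)}
    (hψ : ψ ∈ zeroMomentum L) : bilinear (1 - 𝓜.flatProj L A) ψ ∈ zeroMomentum L := by
  refine bilinear_mem_gradedSector (fun a b hab => ?_) hψ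
  by_contra h
  refine hab ?_
  have h1 : a ≠ b := fun h' => h (by rw [h'])
  simp [flatProj, h, h1]

/-- Hermiticity of the local bilinears exchanges `q` and `-q` under adjoints, so the adjoint
operators act trivially on the nesting pair as well. This second half is what produces a further
zero mode. -/
lemma pairAction_rootVertex (i : Mesh L × gen) :
    pairAction (𝓜.rootVertex L i 0) (𝓜.nestMatrix L) = 0 ∧
    pairAction (𝓜.rootVertex L i 0)ᴴ (𝓜.nestMatrix L) = 0 := by
  have h : ∀ J q, pairAction (𝓜.projVertex L 0 J q) (𝓜.nestMatrix L) = 0 := fun J q =>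
    pairAction_projected (𝓜.flatProj_mul_nestMatrix L) (𝓜.pairAction_vertexMatrix L J q)
  have h' : ∀ J q, (𝓜.projVertex L 0 J q)ᴴ = 𝓜.projVertex L 0 J (-q) := by
    intro J q
    rw [projVertex, Matrix.conjTranspose_mul, Matrix.conjTranspose_mul,
      (𝓜.flatProj_isHermitian L 0).eq, vertexMatrix_conjTranspose, projVertex, Matrix.mul_assoc]
  constructor
  · simp only [rootVertex, pairAction_smul, pairAction_sum, h, smul_zero, Finset.sum_const_zero]
  · simp only [rootVertex, Matrix.conjTranspose_smul, Matrix.conjTranspose_sum, h', pairAction_smul,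
      pairAction_sum, h, smul_zero, Finset.sum_const_zero]

/-- The wave function of the condensed pair. -/
def condensate : Matrix (Mesh L × orb) (Mesh L × orb) ℂ := 𝓜.nestMatrix L * (𝓜.flatProj L 0)ᵀ

lemma mem_pairSector_of_momentum {C : Matrix (Mesh L × orb) (Mesh L × orb) ℂ} (hC : Cᵀ = -C)
    (hPC : 𝓜.flatProj L 0 * C = C) (hk : ∀ a b, C a b ≠ 0 → a.1 + b.1 = 0) :
    pairCreate C (vacuum _) ∈ filledStates (𝓜.flatProj L 0) (zeroMomentum L) 2 := by
  have h1 := pairCreate_pow_vacuum_mem_supportedOn (𝓜.flatProj_isHermitian L 0)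
    (𝓜.flatProj_idem L 0) hC hPC 1
  have h2 := pairCreate_pow_vacuum_mem_numberSector C 1
  rw [pow_one] at h1 h2
  refine ⟨h1, h2, ?_⟩
  have := pairCreate_mem_gradedSector (g := fun x : Mesh L × orb => x.1) hk vacuum_mem_gradedSector
  rwa [add_zero] at this

lemma hamiltonian_eq_zero {A : Fin d → ℝ} {ψ : Fock (Mesh L × orb)}
    (h : ∀ i, bilinear (𝓜.rootVertex L i A) ψ = 0) : 𝓜.hamiltonian L A ψ = 0 := by
  rw [hamiltonian_apply]
  exact Finset.sum_eq_zero fun i _ => by rw [h, map_zero]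

lemma bilinear_rootVertex_pairCreate_eq_zero {C : Matrix (Mesh L × orb) (Mesh L × orb) ℂ}
    (h : ∀ i, pairAction (𝓜.rootVertex L i 0) C = 0) (i : Mesh L × gen) :
    bilinear (𝓜.rootVertex L i 0) (pairCreate C (vacuum _)) = 0 := by
  have := h i
  rw [pairAction] at this
  rw [bilinear_pairCreate_vacuum, this, pairCreate_zero, LinearMap.zero_apply]

/-- Uniqueness of the zero-energy pair makes the pairing uniform. -/
lemma exists_condensate_isUniformPairing (hp : 1 ≤ 𝓜.nPair) (hu : 𝓜.HasUniquePair L) :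
    ∃ c : ℝ, 0 < c ∧ IsUniformPairing (𝓜.flatProj L 0) (𝓜.condensate L) c (𝓜.maxPairs L) ∧
      (∀ i, pairAction (𝓜.rootVertex L i 0) (𝓜.condensate L) = 0) ∧
      pairCreate (𝓜.condensate L) (vacuum _) ∈ zeroMomentum L ∧
      ∀ ψ ∈ filledStates (𝓜.flatProj L 0) (zeroMomentum L) 2,
        (∀ i, bilinear (𝓜.rootVertex L i 0) ψ = 0) →
          ∃ z : ℂ, ψ = z • pairCreate (𝓜.condensate L) (vacuum _) := by
  set P := 𝓜.flatProj L 0 with hPdef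
  set M := 𝓜.nestMatrix L with hMdef
  have hP : P.IsHermitian := 𝓜.flatProj_isHermitian L 0
  have hPP : P * P = P := 𝓜.flatProj_idem L 0
  have hPM : P * M = M * Pᵀ := 𝓜.flatProj_mul_nestMatrix L
  have hM : Mᵀ = -M := 𝓜.nestMatrix_transpose L
  have hn : 1 ≤ 𝓜.maxPairs L := Nat.mul_pos hp volume_pos
  have htr : P.trace = 2 * (𝓜.maxPairs L : ℂ) := 𝓜.flatProj_trace L 0
  have hinj := 𝓜.flatProj_mulVec_injective L
  have hneg : ∀ k k' : Mesh L, k = -k' ↔ k' = -k := fun k k' =>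
    eq_neg_iff_add_eq_zero.trans (by rw [eq_neg_iff_add_eq_zero, add_comm])
  have hz : ∀ i, pairAction (𝓜.rootVertex L i 0) (M * Pᵀ) = 0 ∧
      pairAction (𝓜.rootVertex L i 0) (M * Mᴴ * M * Pᵀ) = 0 := fun i =>
    pairAction_zero_modes hPM (𝓜.rootVertex_mul_flatProj L i 0) (𝓜.pairAction_rootVertex L i).1
      (𝓜.pairAction_rootVertex L i).2
  have hR : P * (M * Mᴴ) = M * Mᴴ * P := by
    rw [← Matrix.mul_assoc, hPM, mul_conjTranspose_comm hP hPM]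
  have hW1 : (M * Pᵀ)ᵀ = -(M * Pᵀ) := by
    rw [Matrix.transpose_mul, Matrix.transpose_transpose, hM, Matrix.mul_neg, hPM]
  have hW2 : (M * Mᴴ * M * Pᵀ)ᵀ = -(M * Mᴴ * M * Pᵀ) := by
    have h1 : Mᴴᵀ = -Mᴴ := by
      have h2 := congrArg Matrix.conjTranspose hM
      rw [Matrix.conjTranspose_neg] at h2
      rw [← h2]
      ext; simp
    rw [Matrix.transpose_mul, Matrix.transpose_transpose, Matrix.transpose_mul,
      Matrix.transpose_mul, hM, h1, Matrix.mul_assoc (M * Mᴴ), ← hPM,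
      ← Matrix.mul_assoc (M * Mᴴ) P M, ← hR]
    simp [Matrix.mul_assoc]
  have hPW1 : P * (M * Pᵀ) = M * Pᵀ := by
    rw [← Matrix.mul_assoc, hPM, Matrix.mul_assoc, ← Matrix.transpose_mul, hPP]
  have hPW2 : P * (M * Mᴴ * M * Pᵀ) = M * Mᴴ * M * Pᵀ := by
    rw [Matrix.mul_assoc (M * Mᴴ), ← Matrix.mul_assoc P, hR, Matrix.mul_assoc (M * Mᴴ), hPW1]
  have hk1 : ∀ a b, (M * Pᵀ) a b ≠ 0 → a.1 + b.1 = 0 := by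
    intro a b h
    rw [hMdef, nestMatrix, hPdef, flatProj_eq, blockMatrix_transpose (g := id) (by simp [eq_comm]),
      blockMatrix_mul] at h
    rw [blockMatrix_ne_zero h]; simp
  have hk2 : ∀ a b, (M * Mᴴ * M * Pᵀ) a b ≠ 0 → a.1 + b.1 = 0 := by
    intro a b h
    rw [hMdef, nestMatrix, blockMatrix_conjTranspose (g := fun k => -k) hneg, hPdef, flatProj_eq,
      blockMatrix_transpose (g := id) (by simp [eq_comm]), blockMatrix_mul, blockMatrix_mul,
      blockMatrix_mul] at h
    rw [blockMatrix_ne_zero h]; simp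
  have hW0 : M * Pᵀ ≠ 0 := by
    intro h0
    have h1 : Mᴴ * P = 0 := by
      have h2 := congrArg Matrix.conjTranspose (hPM.trans h0)
      rwa [Matrix.conjTranspose_mul, hP.eq, Matrix.conjTranspose_zero] at h2
    have h2 : P = 0 := by
      ext a b
      refine congrFun (hinj (P.col b) ?_ ?_) a
      · ext c; exact congrFun (congrFun hPP c) b
      · ext c; exact congrFun (congrFun h1 c) b
    rw [h2, Matrix.trace_zero] at htr
    have h3 : (𝓜.maxPairs L : ℂ) = 0 := by linear_combination -htr / 2
    have h4 : 𝓜.maxPairs L = 0 := by exact_mod_cast h3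
    omega
  have hψ0 : pairCreate (M * Pᵀ) (vacuum _) ≠ 0 := by
    intro h0
    refine hW0 (pairCreate_vacuum_injective hW1 (by simp) ?_)
    rw [h0, pairCreate_zero, LinearMap.zero_apply]
  have hψ1 := 𝓜.mem_pairSector_of_momentum L hW1 hPW1 hk1
  have hψ2 := 𝓜.mem_pairSector_of_momentum L hW2 hPW2 hk2
  obtain ⟨φ, hφ⟩ := hu
  have hφ' : ∀ ψ ∈ filledStates P (zeroMomentum L) 2, (∀ i, bilinear (𝓜.rootVertex L i 0) ψ = 0) →
      ∃ z : ℂ, ψ = z • φ := fun ψ h1 h2 =>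
    hφ ψ ((𝓜.mem_pairSector L 0 ψ).mpr h1) (𝓜.hamiltonian_eq_zero L h2)
  obtain ⟨z₁, hz₁⟩ := hφ' _ hψ1
    (𝓜.bilinear_rootVertex_pairCreate_eq_zero L fun i => (hz i).1)
  have hz₁0 : z₁ ≠ 0 := by
    rintro rfl
    exact hψ0 (by rw [hz₁, zero_smul])
  -- The abstract generator `φ` is exchanged for the condensed pair, which is a nonzero multiple of
  -- it.
  have hspan : ∀ ψ ∈ filledStates P (zeroMomentum L) 2,
      (∀ i, bilinear (𝓜.rootVertex L i 0) ψ = 0) →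
        ∃ z : ℂ, ψ = z • pairCreate (M * Pᵀ) (vacuum _) := by
    intro ψ h1 h2
    obtain ⟨z, rfl⟩ := hφ' ψ h1 h2
    refine ⟨z * z₁⁻¹, ?_⟩
    rw [hz₁, smul_smul, mul_assoc, inv_mul_cancel₀ hz₁0, mul_one]
  obtain ⟨z, hz'⟩ := hspan _ hψ2
    (𝓜.bilinear_rootVertex_pairCreate_eq_zero L fun i => (hz i).2)
  -- The two zero-momentum zero modes are proportional. As an identity of wave functions this is the
  -- eigenvalue equation that forces equal pair amplitudes.
  have hprop : M * Mᴴ * M * Pᵀ = z • (M * Pᵀ) := by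
    refine pairCreate_vacuum_injective hW2 ?_ ?_
    · rw [Matrix.transpose_smul, hW1, smul_neg]
    · rw [hz', pairCreate_smul, LinearMap.smul_apply]
  obtain ⟨c, hc, hU⟩ := exists_isUniformPairing hP hPP hM hPM hinj hn htr hprop
  exact ⟨c, hc, hU, fun i => (hz i).1, hψ1.2.2, hspan⟩

/-- Existence of the curvatures at fixed system size, and the bounds between them. -/
theorem exists_curvatures (hp : 1 ≤ 𝓜.nPair) (hu : 𝓜.HasUniquePair L) (e : Fin d → ℝ) :
    ∃ (c lp : ℝ) (l : ℕ → ℝ), 0 < c ∧ 0 ≤ lp ∧ 𝓜.IsInversePairMass L e (lp / 2) ∧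
      (∀ n ≤ 𝓜.maxPairs L, 𝓜.IsStiffness L (2 * n) e (l n / (2 * volume L))) ∧
      (∀ n ≤ 𝓜.maxPairs L, ((𝓜.maxPairs L : ℝ) - 1) * l n
        ≤ n * (𝓜.maxPairs L - n) * (lp - l (𝓜.maxPairs L) / (𝓜.maxPairs L : ℝ) ^ 2)
          + (𝓜.maxPairs L - 1) * n ^ 2 * (l (𝓜.maxPairs L) / (𝓜.maxPairs L : ℝ) ^ 2)) ∧
      l (𝓜.maxPairs L) = ∑ i, ‖deriv (fun t : ℝ => (𝓜.rootVertex L i (t • e)).trace) 0‖ ^ 2 ∧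
      l 1 ≤ lp ∧
      IsUniformPairing (𝓜.flatProj L 0) (𝓜.condensate L) c (𝓜.maxPairs L) ∧
      ∀ F : Mesh L × gen → Matrix (Mesh L × orb) (Mesh L × orb) ℂ,
        (∀ i a b, HasDerivAt (fun t : ℝ => pairAction (𝓜.rootVertex L i (t • e))
          (𝓜.flatProj L (t • e) * 𝓜.condensate L * (𝓜.flatProj L (t • e))ᵀ) a b) (F i a b) 0) →
        lp * ‖pairCreate (𝓜.condensate L) (vacuum _)‖ ^ 2
          ≤ ∑ i, ‖pairCreate (F i) (vacuum _)‖ ^ 2 := by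
  obtain ⟨c, hc, hU, hzero, hWS, huniq⟩ := 𝓜.exists_condensate_isUniformPairing L hp hu
  have h0 : (0 : ℝ) • e = 0 := zero_smul _ _
  obtain ⟨lp, l, hlp0, hlp, hl, hineq, hfull, h1, htrial⟩ :=
    FlatBand.exists_curvatures (𝓜.isProjectedFamily L e) (M := 𝓜.maxPairs L)
      (Nat.mul_pos hp volume_pos) (fun t => 𝓜.flatProj_trace L _) (W := 𝓜.condensate L) (c := c)
      (by simpa only [h0] using hU) hc (by simpa only [h0] using hzero) (S := zeroMomentum L)
      (fun t ψ hψ => 𝓜.bilinear_one_sub_flatProj_mem L _ hψ) hWS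
      (by simpa only [h0] using huniq)
  have hV : (volume L : ℝ) ≠ 0 := by exact_mod_cast (volume_pos (L := L)).ne'
  refine ⟨c, lp, l, hc, hlp0, ?_, ?_, hineq, hfull, h1, hU, htrial⟩
  -- At half speed the coefficient of `t²` is `lp / 4`, so the second derivative is `lp / 2`.
  · have h2 := isLittleO_comp_const_mul hlp (1 / 2)
    have h3 := hasSecondDerivAtZero_of_isLittleO (eq_zero_of_isLittleO h2) h2
    rw [IsInversePairMass]
    simp only [pairEnergy_eq]
    convert h3 using 1
    ring
  · intro n hn
    have h2 := hasSecondDerivAtZero_of_isLittleO (eq_zero_of_isLittleO (hl n hn)) (hl n hn)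
    rw [IsStiffness]
    simp only [groundEnergy_eq]
    convert h2 using 1
    field_simp
    ring

lemma groundEnergy_zero (A : Fin d → ℝ) : 𝓜.groundEnergy L 0 A = 0 := by
  have h := 𝓜.groundEnergy_eq L 0 A 1
  rw [one_smul] at h
  rw [h, familyEnergy]
  have h1 : {x | ∃ ψ ∈ filledStates (𝓜.flatProj L ((1 : ℝ) • A)) ⊤ 0, ‖ψ‖ = 1 ∧
      x = ∑ i, ‖bilinear (𝓜.rootVertex L i ((1 : ℝ) • A)) ψ‖ ^ 2} ⊆ {0} := by
    rintro x ⟨ψ, hψ, -, rfl⟩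
    rw [eq_smul_vacuum hψ.2.1]
    simp
  rcases Set.subset_singleton_iff_eq.mp h1 with h2 | h2 <;> rw [h2] <;> simp

lemma isStiffness_zero (e : Fin d → ℝ) : 𝓜.IsStiffness L 0 e 0 := by
  refine ⟨0, ?_⟩
  simp [groundEnergy_zero]

/-- Without flat bands there is no two-particle state, and the infimum over the empty set is `0` by
convention. -/
lemma isInversePairMass_zero (hp : 𝓜.nPair = 0) (e : Fin d → ℝ) : 𝓜.IsInversePairMass L e 0 := by
  have hproj : ∀ A, 𝓜.flatProj L A = 0 := by
    intro A
    have h1 := 𝓜.flatProj_trace L A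
    rw [maxPairs, hp, zero_mul, Nat.cast_zero, mul_zero] at h1
    refine Matrix.trace_conjTranspose_mul_self_eq_zero_iff.mp ?_
    rw [(𝓜.flatProj_isHermitian L A).eq, flatProj_idem, h1]
  have h : ∀ t : ℝ, 𝓜.pairEnergy L (t • e) = 0 := by
    intro t
    rw [pairEnergy_eq, familyEnergy]
    have h1 : {x | ∃ ψ ∈ filledStates (𝓜.flatProj L ((1 / 2 * t) • e)) (zeroMomentum L) 2,
        ‖ψ‖ = 1 ∧ x = ∑ i, ‖bilinear (𝓜.rootVertex L i ((1 / 2 * t) • e)) ψ‖ ^ 2} = ∅ := by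
      ext x
      simp only [Set.mem_ofPred_eq, Set.mem_empty_iff_false, iff_false]
      rintro ⟨ψ, hψ, hψ1, -⟩
      have h2 := number_apply hψ.2.1
      have h3 : ∀ a, annihilate a ψ = 0 := by
        intro a
        have := hψ.1 a
        rw [hproj, sub_zero] at this
        simpa [Matrix.one_apply] using this
      simp only [h3, map_zero, Finset.sum_const_zero] at h2
      have h4 : ψ = 0 := (smul_eq_zero.mp h2.symm).resolve_left (by norm_num)
      rw [h4] at hψ1
      simp at hψ1
    rw [h1, Real.sInf_empty]
  have h0 : 𝓜.pairEnergy L 0 = 0 := by simpa using h 0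
  refine ⟨0, ?_⟩
  simp [h, h0]

end QGNModel

/-! ### Fixed particle number and number distributions -/

/-- These are the partition of unity and the moment identities of the Bernstein polynomials. The
second-order identity gives the factorial moment of `n (n - 1)`, to which the mean is added. -/
lemma sum_binomial_moments (M : ℕ) (ν : ℝ) :
    ∑ n ∈ Finset.range (M + 1), (M.choose n : ℝ) * ν ^ n * (1 - ν) ^ (M - n) = 1 ∧
    ∑ n ∈ Finset.range (M + 1), (M.choose n : ℝ) * ν ^ n * (1 - ν) ^ (M - n) * n = M * ν ∧
    ∑ n ∈ Finset.range (M + 1), (M.choose n : ℝ) * ν ^ n * (1 - ν) ^ (M - n) * (n : ℝ) ^ 2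
      = M * (M - 1) * ν ^ 2 + M * ν := by
  have h0 := congrArg (Polynomial.eval ν) (bernsteinPolynomial.sum ℝ M)
  have h1 := congrArg (Polynomial.eval ν) (bernsteinPolynomial.sum_smul ℝ M)
  have h2 := congrArg (Polynomial.eval ν) (bernsteinPolynomial.sum_mul_smul ℝ M)
  simp only [bernsteinPolynomial, Polynomial.eval_finsetSum, Polynomial.eval_mul,
    Polynomial.eval_pow, Polynomial.eval_sub, Polynomial.eval_one, Polynomial.eval_X,
    Polynomial.eval_natCast, nsmul_eq_mul] at h0 h1 h2
  have h1' : ∑ n ∈ Finset.range (M + 1), (M.choose n : ℝ) * ν ^ n * (1 - ν) ^ (M - n) * n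
      = M * ν := by
    rw [← h1]
    exact Finset.sum_congr rfl fun n _ => by ring
  refine ⟨h0, h1', ?_⟩
  have h3 : ((M * (M - 1) : ℕ) : ℝ) = M * (M - 1) := by
    rcases M with _ | M <;> simp
  rw [← h3, ← h2, ← h1', ← Finset.sum_add_distrib]
  refine Finset.sum_congr rfl fun n _ => ?_
  have h4 : ((n * (n - 1) : ℕ) : ℝ) = n * (n - 1) := by
    rcases n with _ | n <;> simp
  rw [h4]
  ring

/-- The average of `n (M - n)` is `M (M - 1) ν (1 - ν)`, so the factor `M - 1` cancels, and the
extra `M ν` in the second moment removes the `1 / M` corrections. For `M = 1` the hypothesis is void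
and `l 1 ≤ lp` takes its place. -/
lemma sum_binomial_le {M : ℕ} (hM : 1 ≤ M) {l : ℕ → ℝ} {lp : ℝ}
    (h : ∀ n ≤ M, ((M : ℝ) - 1) * l n
        ≤ n * (M - n) * (lp - l M / (M : ℝ) ^ 2) + (M - 1) * n ^ 2 * (l M / (M : ℝ) ^ 2))
    (h0 : l 0 = 0) (h1 : l 1 ≤ lp) {ν : ℝ} (hν0 : 0 ≤ ν) (hν1 : ν ≤ 1) :
    ∑ n ∈ Finset.range (M + 1), (M.choose n : ℝ) * ν ^ n * (1 - ν) ^ (M - n) * l n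
      ≤ M * ν * (1 - ν) * lp + ν ^ 2 * l M := by
  rcases hM.eq_or_lt with rfl | hM2
  · simp only [Finset.sum_range_succ, Finset.sum_range_zero, h0]
    norm_num
    nlinarith [mul_nonneg (mul_nonneg hν0 (sub_nonneg.mpr hν1)) (sub_nonneg.mpr h1)]
  · obtain ⟨m0, m1, m2⟩ := sum_binomial_moments M ν
    set b : ℕ → ℝ := fun n => (M.choose n : ℝ) * ν ^ n * (1 - ν) ^ (M - n)
    have hM1 : (0 : ℝ) < M - 1 := by
      have : (1 : ℝ) < M := by exact_mod_cast hM2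
      linarith
    have hM0 : (M : ℝ) ≠ 0 := by linarith
    set r : ℝ := l M / (M : ℝ) ^ 2 with hr
    have hlM : l M = r * (M : ℝ) ^ 2 := by rw [hr]; field_simp
    have key : ((M : ℝ) - 1) * ∑ n ∈ Finset.range (M + 1), b n * l n
        ≤ ∑ n ∈ Finset.range (M + 1), ((lp - r) * (M * (b n * n) - b n * (n : ℝ) ^ 2)
          + (M - 1) * r * (b n * (n : ℝ) ^ 2)) := by
      rw [Finset.mul_sum]
      refine Finset.sum_le_sum fun n hn => ?_
      have hb : 0 ≤ b n := by
        have := sub_nonneg.mpr hν1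
        positivity
      have := mul_le_mul_of_nonneg_left (h n (by simpa [Nat.lt_succ_iff] using hn)) hb
      linarith
    rw [Finset.sum_add_distrib, ← Finset.mul_sum, Finset.sum_sub_distrib, ← Finset.mul_sum,
      ← Finset.mul_sum, m1, m2] at key
    refine le_of_mul_le_mul_left (key.trans (le_of_eq ?_)) hM1
    rw [hlM]
    ring

namespace QGNModel

variable {d : ℕ} {orb gen : Type*} [Fintype orb] [DecidableEq orb] [Fintype gen]
  (𝓜 : QGNModel d orb gen) (L : Fin d → ℕ) [∀ i, NeZero (L i)]

lemma filling_two_mul (n : ℕ) : 𝓜.filling L (2 * n) = n / (𝓜.maxPairs L : ℝ) := by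
  rw [filling, nFlat, maxPairs]
  push_cast
  rw [mul_assoc, mul_div_mul_left _ _ two_ne_zero]

lemma nFlat_div_two : (𝓜.nFlat : ℝ) / 2 = 𝓜.nPair := by
  rw [nFlat]
  push_cast
  ring

lemma stiffness_unique {N : ℕ} {e : Fin d → ℝ} {D D' : ℝ} (h : 𝓜.IsStiffness L N e D)
    (h' : 𝓜.IsStiffness L N e D') : D = D' := by
  have hV : (volume L : ℝ) ≠ 0 := by exact_mod_cast (volume_pos (L := L)).ne'
  exact mul_left_cancel₀ (mul_ne_zero four_ne_zero hV) (h.unique h')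

/-- The curvatures exist for every system size and obey the bounds at fixed particle number and for
the number distribution of a BCS state. -/
theorem finite_size_bounds (hu : 𝓜.HasUniquePair L) (e : Fin d → ℝ) :
    ∃ (w : ℝ) (D : ℕ → ℝ), 𝓜.IsInversePairMass L e w ∧
      (∀ n ≤ 𝓜.maxPairs L, 𝓜.IsStiffness L (2 * n) e (D n)) ∧
      (∀ n ≤ 𝓜.maxPairs L,
        (1 - 1 / (𝓜.maxPairs L : ℝ)) * D n ≤
          (𝓜.nFlat : ℝ) / 2 * 𝓜.filling L (2 * n) * (1 - 𝓜.filling L (2 * n)) * w +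
            𝓜.filling L (2 * n) * (𝓜.filling L (2 * n) - 1 / (𝓜.maxPairs L : ℝ)) *
              D (𝓜.maxPairs L)) ∧
      (∀ ν : ℝ, 0 ≤ ν → ν ≤ 1 →
        ∑ n ∈ Finset.range (𝓜.maxPairs L + 1),
            ((𝓜.maxPairs L).choose n : ℝ) * ν ^ n * (1 - ν) ^ (𝓜.maxPairs L - n) * D n ≤
          (𝓜.nFlat : ℝ) / 2 * ν * (1 - ν) * w + ν ^ 2 * D (𝓜.maxPairs L)) := by
  simp only [filling_two_mul, nFlat_div_two]
  have hV : (0 : ℝ) < volume L := by exact_mod_cast volume_pos (L := L)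
  rcases Nat.eq_zero_or_pos 𝓜.nPair with hp | hp
  · have hM : 𝓜.maxPairs L = 0 := by rw [maxPairs, hp, zero_mul]
    refine ⟨0, fun _ => 0, 𝓜.isInversePairMass_zero L hp e, fun n hn => ?_, fun n _ => ?_,
      fun ν _ _ => ?_⟩
    · obtain rfl : n = 0 := by omega
      exact 𝓜.isStiffness_zero L e
    · simp
    · simp
  · obtain ⟨c, lp, l, -, -, hw, hl, hineq, -, h1, -⟩ := 𝓜.exists_curvatures L hp hu e
    have hMV : (𝓜.maxPairs L : ℝ) = 𝓜.nPair * volume L := by rw [maxPairs]; push_cast; ring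
    have hM : 1 ≤ 𝓜.maxPairs L := Nat.mul_pos hp volume_pos
    have hM0 : (0 : ℝ) < 𝓜.maxPairs L := by exact_mod_cast hM
    have hl0 : l 0 = 0 := by
      have h2 := 𝓜.stiffness_unique L (hl 0 (Nat.zero_le _)) (𝓜.isStiffness_zero L e)
      exact (div_eq_zero_iff.mp h2).resolve_right (by positivity)
    have hp' : (𝓜.nPair : ℝ) = 𝓜.maxPairs L / volume L := by rw [hMV]; field_simp
    refine ⟨lp / 2, fun n => l n / (2 * volume L), hw, hl, fun n hn => ?_, fun ν hν0 hν1 => ?_⟩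
    · rw [hp']
      refine le_of_mul_le_mul_left ?_ (by positivity : 0 < 2 * (volume L : ℝ) * 𝓜.maxPairs L)
      refine (le_of_eq ?_).trans ((hineq n hn).trans (le_of_eq ?_))
      · field_simp
      · field_simp
        ring
    · rw [hp']
      refine le_of_mul_le_mul_left ?_ (by positivity : 0 < 2 * (volume L : ℝ))
      refine (le_of_eq ?_).trans
        ((sum_binomial_le hM hineq hl0 h1 hν0 hν1).trans (le_of_eq ?_))
      · rw [Finset.mul_sum]
        refine Finset.sum_congr rfl fun n _ => ?_
        field_simp
      · field_simp

end QGNModel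

/-! ### Periodic functions of the crystal momentum -/

section Periodic

variable {E : Type*} [NormedAddCommGroup E] [NormedSpace ℝ E]

/-- Periodicity with respect to a set of translations. -/
def IsPeriodicOn (Γ : Set E) (f : E → ℂ) : Prop := ∀ v ∈ Γ, ∀ x, f (x + v) = f x

lemma IsPeriodicOn.fderiv_apply {Γ : Set E} {f : E → ℂ} (hf : IsPeriodicOn Γ f) (e : E) :
    IsPeriodicOn Γ fun x => fderiv ℝ f x e := by
  intro v hv x
  have h : (fun y => f (y + v)) = f := funext fun y => hf v hv y
  change fderiv ℝ f (x + v) e = _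
  rw [← fderiv_comp_add_right, h]

lemma IsPeriodicOn.exists_norm_le {Γ K : Set E} {f : E → ℂ} (hf : IsPeriodicOn Γ f)
    (hc : Continuous f) (hK : IsCompact K) (hΓ : ∀ x, ∃ v ∈ Γ, x + v ∈ K) :
    ∃ C : ℝ, 0 ≤ C ∧ ∀ x, ‖f x‖ ≤ C := by
  obtain ⟨C, hC⟩ := hK.exists_bound_of_continuousOn hc.continuousOn
  refine ⟨max C 0, le_max_right _ _, fun x => ?_⟩
  obtain ⟨v, hv, hx⟩ := hΓ x
  rw [← hf v hv x]
  exact (hC _ hx).trans (le_max_left _ _)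

/-- Second-order Taylor estimate along a segment. -/
lemma norm_sub_sub_smul_fderiv_le {f : E → ℂ} (hf : ContDiff ℝ 2 f) {e : E} {C : ℝ}
    (hC : ∀ x, ‖fderiv ℝ (fun y => fderiv ℝ f y e) x e‖ ≤ C) (x : E) {h : ℝ} (hh : 0 ≤ h) :
    ‖f (x + h • e) - f x - h • fderiv ℝ f x e‖ ≤ C * h ^ 2 := by
  have hC0 : 0 ≤ C := (norm_nonneg _).trans (hC x)
  have hline : ∀ s : ℝ, HasDerivAt (fun s : ℝ => x + s • e) e s := fun s => by
    simpa using ((hasDerivAt_id s).smul_const e).const_add x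
  have hg : Differentiable ℝ fun y => fderiv ℝ f y e :=
    ((hf.fderiv_right (m := 1) (by norm_num)).clm_apply contDiff_const).differentiable one_ne_zero
  have h1 : ∀ s : ℝ, HasDerivAt (fun s : ℝ => f (x + s • e)) (fderiv ℝ f (x + s • e) e) s :=
    fun s => ((hf.differentiable two_ne_zero) _).hasFDerivAt.comp_hasDerivAt s (hline s)
  have h2 : ∀ s : ℝ, HasDerivAt (fun s : ℝ => fderiv ℝ f (x + s • e) e)
      (fderiv ℝ (fun y => fderiv ℝ f y e) (x + s • e) e) s :=
    fun s => (hg _).hasFDerivAt.comp_hasDerivAt (f := fun s : ℝ => x + s • e) s (hline s)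
  have h3 : ∀ s ∈ Set.Icc 0 h, ‖fderiv ℝ f (x + s • e) e - fderiv ℝ f x e‖ ≤ C * h := by
    intro s hs
    have := norm_image_sub_le_of_norm_deriv_le_segment' (a := 0) (b := h)
      (fun s _ => (h2 s).hasDerivWithinAt) (fun s _ => hC _) s hs
    simp only [zero_smul, add_zero, sub_zero] at this
    exact this.trans (mul_le_mul_of_nonneg_left hs.2 hC0)
  have h4 := norm_image_sub_le_of_norm_deriv_le_segment' (a := 0) (b := h) (C := C * h)
    (f := fun s : ℝ => f (x + s • e) - s • fderiv ℝ f x e)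
    (f' := fun s => fderiv ℝ f (x + s • e) e - fderiv ℝ f x e)
    (fun s _ => ((h1 s).sub
      (by simpa using (hasDerivAt_id s).smul_const (fderiv ℝ f x e))).hasDerivWithinAt)
    (fun s hs => h3 s ⟨hs.1, hs.2.le⟩) h ⟨hh, le_rfl⟩
  simp only [zero_smul, add_zero, sub_zero] at h4
  rw [sub_right_comm]
  linarith

end Periodic

/-- The reciprocal lattice. -/
def reciprocalLattice (d : ℕ) : Set (Fin d → ℝ) :=
  Set.range fun (m : Fin d → ℤ) i => 2 * Real.pi * m i

/-- A closed Brillouin zone. -/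
def brillouinZone (d : ℕ) : Set (Fin d → ℝ) := Set.pi Set.univ fun _ => Set.Icc 0 (2 * Real.pi)

lemma isCompact_brillouinZone (d : ℕ) : IsCompact (brillouinZone d) :=
  isCompact_univ_pi fun _ => isCompact_Icc

lemma exists_add_mem_brillouinZone {d : ℕ} (x : Fin d → ℝ) :
    ∃ v ∈ reciprocalLattice d, x + v ∈ brillouinZone d := by
  refine ⟨_, ⟨fun i => -toIcoDiv Real.two_pi_pos 0 (x i), rfl⟩, fun i _ => ?_⟩
  have h := toIcoMod_mem_Ico Real.two_pi_pos 0 (x i)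
  rw [toIcoMod, zero_add] at h
  have h2 : (x + fun i => 2 * Real.pi * ((-toIcoDiv Real.two_pi_pos 0 (x i) : ℤ) : ℝ)) i
      = x i - toIcoDiv Real.two_pi_pos 0 (x i) • (2 * Real.pi) := by
    simp only [Pi.add_apply, zsmul_eq_mul]
    push_cast
    ring
  rw [h2]
  exact ⟨h.1, h.2.le⟩

section Mesh

variable {d : ℕ}

/-- A shift by one mesh step permutes the mesh up to reciprocal lattice vectors. -/
lemma sum_mesh_shift {f : (Fin d → ℝ) → ℂ} (hf : IsPeriodicOn (reciprocalLattice d) f)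
    (L : Fin d → ℕ) [∀ i, NeZero (L i)] (i : Fin d) :
    ∑ k : Mesh L, f (k.val + (2 * Real.pi / L i) • Pi.single i 1) = ∑ k : Mesh L, f k.val := by
  rw [← Equiv.sum_comp (Equiv.addRight (Pi.single i 1 : Mesh L)) fun k : Mesh L => f k.val]
  refine Finset.sum_congr rfl fun k _ => ?_
  obtain ⟨m, hm⟩ := Mesh.exists_val_eq (k + Pi.single i 1)
    (fun j => (k j).val + (Pi.single i 1 : Fin d → ℤ) j) (by
      intro j
      rcases eq_or_ne j i with rfl | hj <;> simp [*])
  rw [Equiv.coe_addRight, hm]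
  refine Eq.trans ?_ (hf _ ⟨m, rfl⟩ _).symm
  congr 1
  ext j
  have : (L j : ℝ) ≠ 0 := by exact_mod_cast NeZero.ne (L j)
  rcases eq_or_ne j i with rfl | hj
  · simp [Mesh.val]
    field_simp
  · simp [Mesh.val, hj]

/-- Riemann sums of derivatives of periodic functions are small. -/
lemma exists_norm_sum_fderiv_le {f : (Fin d → ℝ) → ℂ} (hf : ContDiff ℝ 2 f)
    (hp : IsPeriodicOn (reciprocalLattice d) f) (e : Fin d → ℝ) :
    ∃ C : ℝ, 0 ≤ C ∧ ∀ (L : Fin d → ℕ) [∀ i, NeZero (L i)] (ℓ : ℕ), 0 < ℓ → (∀ i, ℓ ≤ L i) →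
      ‖∑ k : Mesh L, fderiv ℝ f k.val e‖ ≤ C * volume L / ℓ := by
  have h1 : ∀ i : Fin d, ∃ C : ℝ, 0 ≤ C ∧ ∀ x,
      ‖fderiv ℝ (fun y => fderiv ℝ f y (Pi.single i 1)) x (Pi.single i 1)‖ ≤ C := fun i =>
    ((hp.fderiv_apply _).fderiv_apply _).exists_norm_le
      ((((hf.fderiv_right (m := 1) (by norm_num)).clm_apply contDiff_const).fderiv_right
        (m := 0) (by norm_num)).clm_apply contDiff_const).continuous
      (isCompact_brillouinZone d) exists_add_mem_brillouinZone
  choose C hC0 hC using h1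
  refine ⟨∑ i, |e i| * (C i * (2 * Real.pi)),
    Finset.sum_nonneg fun i _ => mul_nonneg (abs_nonneg _) (mul_nonneg (hC0 i) Real.two_pi_pos.le),
    fun L _ ℓ hℓ hL => ?_⟩
  have hV : (0 : ℝ) < volume L := by exact_mod_cast volume_pos (L := L)
  have hℓ' : (0 : ℝ) < ℓ := by exact_mod_cast hℓ
  have h2 : ∀ i, ‖∑ k : Mesh L, fderiv ℝ f k.val (Pi.single i 1)‖
      ≤ C i * (2 * Real.pi) * volume L / ℓ := by
    intro i
    have hLi : (ℓ : ℝ) ≤ L i := by exact_mod_cast hL i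
    have hLi0 : (0 : ℝ) < L i := hℓ'.trans_le hLi
    set h : ℝ := 2 * Real.pi / L i with hh
    have hh0 : 0 < h := div_pos Real.two_pi_pos hLi0
    -- By shift invariance the finite differences sum to zero, so only second-order Taylor
    -- remainders are left: `𝖵` terms of size `C h²`, to be divided by `h`.
    have h3 : h • ∑ k : Mesh L, fderiv ℝ f k.val (Pi.single i 1)
        = -∑ k : Mesh L, (f (k.val + h • Pi.single i 1) - f k.val
          - h • fderiv ℝ f k.val (Pi.single i 1)) := by
      rw [Finset.sum_sub_distrib, Finset.sum_sub_distrib, sum_mesh_shift hp, sub_self, zero_sub,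
        neg_neg, Finset.smul_sum]
    have h4 : h * ‖∑ k : Mesh L, fderiv ℝ f k.val (Pi.single i 1)‖
        ≤ volume L * (C i * h ^ 2) := by
      rw [← abs_of_pos hh0, ← Real.norm_eq_abs, ← norm_smul, Real.norm_of_nonneg hh0.le, h3,
        norm_neg]
      refine (norm_sum_le _ _).trans ((Finset.sum_le_sum fun k _ =>
        norm_sub_sub_smul_fderiv_le hf (hC i) k.val hh0.le).trans (le_of_eq ?_))
      rw [Finset.sum_const, Finset.card_univ, card_mesh, nsmul_eq_mul]
    have h5 : ‖∑ k : Mesh L, fderiv ℝ f k.val (Pi.single i 1)‖ ≤ volume L * (C i * h) := by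
      refine le_of_mul_le_mul_left (h4.trans (le_of_eq ?_)) hh0
      ring
    refine h5.trans ?_
    have h6 : h ≤ 2 * Real.pi / ℓ := div_le_div_of_nonneg_left Real.two_pi_pos.le hℓ' hLi
    calc (volume L : ℝ) * (C i * h) ≤ volume L * (C i * (2 * Real.pi / ℓ)) :=
          mul_le_mul_of_nonneg_left (mul_le_mul_of_nonneg_left h6 (hC0 i)) hV.le
      _ = _ := by ring
  have h7 : ∀ x, fderiv ℝ f x e = ∑ i, e i • fderiv ℝ f x (Pi.single i 1) := by
    intro x
    conv_lhs => rw [pi_eq_sum_univ' e]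
    rw [map_sum]
    refine Finset.sum_congr rfl fun i _ => ?_
    rw [map_smul]
  simp only [h7]
  rw [Finset.sum_comm, Finset.sum_mul, Finset.sum_div]
  refine (norm_sum_le _ _).trans (Finset.sum_le_sum fun i _ => ?_)
  rw [← Finset.smul_sum, norm_smul, Real.norm_eq_abs]
  refine (mul_le_mul_of_nonneg_left (h2 i) (abs_nonneg _)).trans (le_of_eq ?_)
  ring

end Mesh

/-! ### The stiffness of the filled bands -/

namespace QGNModel

variable {d : ℕ} {orb gen : Type*} [Fintype orb] [DecidableEq orb] [Fintype gen]
  (𝓜 : QGNModel d orb gen) (L : Fin d → ℕ) [∀ i, NeZero (L i)]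

lemma projVertex_eq (A : Fin d → ℝ) (J : gen) (q : Mesh L) : 𝓜.projVertex L A J q
    = blockMatrix (fun k => k + q) fun k k' => 𝓜.proj (k.val + A)
        * 𝓜.vertex J (k.val + A) (k'.val + A) * 𝓜.proj (k'.val + A) := by
  rw [projVertex, flatProj_eq, vertexMatrix_eq, blockMatrix_mul, blockMatrix_mul]
  exact blockMatrix_congr fun k => rfl

/-- A bilinear that transfers nonzero momentum has no diagonal blocks. -/
lemma trace_projVertex (A : Fin d → ℝ) (J : gen) (q : Mesh L) : (𝓜.projVertex L A J q).trace
    = if q = 0 then ∑ k : Mesh L, (𝓜.proj (k.val + A) * 𝓜.vertex J (k.val + A) (k.val + A)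
        * 𝓜.proj (k.val + A)).trace else 0 := by
  rw [projVertex_eq]
  simp only [Matrix.trace, Matrix.diag, blockMatrix, Matrix.of_apply, Fintype.sum_prod_type,
    left_eq_add]
  split_ifs <;> simp

/-- The expectation value of a bilinear in the filled bands at fixed momentum. -/
def filledVertex (J : gen) (k : Fin d → ℝ) : ℂ := (𝓜.proj k * 𝓜.vertex J k k * 𝓜.proj k).trace

lemma filledVertex_contDiff (J : gen) : ContDiff ℝ 2 (𝓜.filledVertex J) := by
  unfold filledVertex
  simp only [Matrix.trace, Matrix.diag, Matrix.mul_apply]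
  exact ContDiff.sum fun α _ => ContDiff.sum fun β _ =>
    (ContDiff.sum fun γ _ => (𝓜.proj_contDiff α γ).mul
      ((𝓜.vertex_contDiff J γ β).comp (contDiff_id.prodMk contDiff_id))).mul (𝓜.proj_contDiff β α)

lemma filledVertex_periodic (J : gen) :
    IsPeriodicOn (reciprocalLattice d) (𝓜.filledVertex J) := by
  rintro _ ⟨m, rfl⟩ k
  have h1 := 𝓜.proj_periodic k m
  have h2 := 𝓜.vertex_periodic J k k m m
  change (𝓜.proj (fun i => k i + 2 * Real.pi * m i)
    * 𝓜.vertex J (fun i => k i + 2 * Real.pi * m i) (fun i => k i + 2 * Real.pi * m i)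
    * 𝓜.proj (fun i => k i + 2 * Real.pi * m i)).trace = _
  rw [h1, h2, filledVertex]

lemma hasDerivAt_trace_projVertex (e : Fin d → ℝ) (J : gen) (q : Mesh L) :
    HasDerivAt (fun t : ℝ => (𝓜.projVertex L (t • e) J q).trace)
      (if q = 0 then ∑ k : Mesh L, fderiv ℝ (𝓜.filledVertex J) k.val e else 0) 0 := by
  simp only [trace_projVertex]
  split_ifs
  · refine HasDerivAt.fun_sum fun k _ => ?_
    have h1 : HasDerivAt (fun t : ℝ => k.val + t • e) e 0 := by
      simpa using ((hasDerivAt_id (0 : ℝ)).smul_const e).const_add k.val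
    have h2 := (((𝓜.filledVertex_contDiff J).differentiable two_ne_zero)
      (k.val + (0 : ℝ) • e)).hasFDerivAt.comp_hasDerivAt (0 : ℝ) h1
    rw [zero_smul, add_zero] at h2
    exact h2
  · exact hasDerivAt_const _ _

lemma deriv_trace_rootVertex (e : Fin d → ℝ) (i : Mesh L × gen) :
    deriv (fun t : ℝ => (𝓜.rootVertex L i (t • e)).trace) 0
      = if i.1 = 0 then ((Real.sqrt (volume L))⁻¹ : ℂ) * ∑ J, 𝓜.couplingRoot 0 i.2 J
          * ∑ k : Mesh L, fderiv ℝ (𝓜.filledVertex J) k.val e else 0 := by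
  simp only [rootVertex, Matrix.trace_smul, Matrix.trace_sum, smul_eq_mul]
  refine HasDerivAt.deriv ?_
  refine ((HasDerivAt.fun_sum fun J _ =>
    (𝓜.hasDerivAt_trace_projVertex L e J i.1).const_mul _).const_mul _).congr_deriv ?_
  split_ifs with h
  · have h0 : (0 : Mesh L).val = 0 := by ext; simp [Mesh.val]
    rw [h, h0]
  · simp

/-- The filled bands have a stiffness which vanishes with the system size. -/
theorem exists_stiffness_filled_le (e : Fin d → ℝ) :
    ∃ C : ℝ, 0 ≤ C ∧ ∀ (L : Fin d → ℕ) [∀ i, NeZero (L i)] (ℓ : ℕ), 0 < ℓ → (∀ i, ℓ ≤ L i) →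
      𝓜.HasUniquePair L → ∀ D, 𝓜.IsStiffness L (2 * 𝓜.maxPairs L) e D → 0 ≤ D ∧ D ≤ C / ℓ := by
  choose G hG0 hG using fun J =>
    exists_norm_sum_fderiv_le (𝓜.filledVertex_contDiff J) (𝓜.filledVertex_periodic J) e
  set B : ℝ := ∑ I, (∑ J, ‖𝓜.couplingRoot 0 I J‖ * G J) ^ 2 with hB
  have hB0 : 0 ≤ B := Finset.sum_nonneg fun _ _ => sq_nonneg _
  refine ⟨B / 2, by positivity, fun L _ ℓ hℓ hL hu D hD => ?_⟩
  have hℓ1 : (1 : ℝ) ≤ ℓ := by exact_mod_cast hℓ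
  have hℓ0 : (0 : ℝ) < ℓ := by linarith
  have hV : (0 : ℝ) < volume L := by exact_mod_cast volume_pos (L := L)
  rcases Nat.eq_zero_or_pos 𝓜.nPair with hp | hp
  · have hM : 𝓜.maxPairs L = 0 := by rw [maxPairs, hp, zero_mul]
    rw [hM, mul_zero] at hD
    rw [𝓜.stiffness_unique L hD (𝓜.isStiffness_zero L e)]
    exact ⟨le_rfl, by positivity⟩
  · obtain ⟨c, lp, l, -, -, -, hl, -, hfull, -⟩ := 𝓜.exists_curvatures L hp hu e
    rw [𝓜.stiffness_unique L hD (hl _ le_rfl), hfull, Fintype.sum_prod_type]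
    simp only [deriv_trace_rootVertex]
    refine ⟨by positivity, ?_⟩
    rw [Finset.sum_eq_single (0 : Mesh L) (fun q _ hq => by simp [hq]) (by simp)]
    simp only [if_true]
    -- Normalization contributes `1 / 𝖵` and the mesh sums contribute `(𝖵 / ℓ)²`. After division by
    -- `2 𝖵` the stiffness is of order `1 / ℓ²`, which is weakened below to `1 / ℓ`.
    have h1 : ∀ I, ‖((Real.sqrt (volume L))⁻¹ : ℂ) * ∑ J, 𝓜.couplingRoot 0 I J
          * ∑ k : Mesh L, fderiv ℝ (𝓜.filledVertex J) k.val e‖ ^ 2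
        ≤ (volume L / ℓ ^ 2) * (∑ J, ‖𝓜.couplingRoot 0 I J‖ * G J) ^ 2 := by
      intro I
      have h2 : ‖∑ J, 𝓜.couplingRoot 0 I J * ∑ k : Mesh L, fderiv ℝ (𝓜.filledVertex J) k.val e‖
          ≤ (∑ J, ‖𝓜.couplingRoot 0 I J‖ * G J) * (volume L / ℓ) := by
        rw [Finset.sum_mul]
        refine (norm_sum_le _ _).trans (Finset.sum_le_sum fun J _ => ?_)
        rw [norm_mul]
        refine (mul_le_mul_of_nonneg_left (hG J L ℓ hℓ hL) (norm_nonneg _)).trans (le_of_eq ?_)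
        ring
      have h3 := pow_le_pow_left₀ (norm_nonneg _) h2 2
      rw [norm_mul, mul_pow, norm_inv, Complex.norm_real, Real.norm_of_nonneg (Real.sqrt_nonneg _),
        inv_pow, Real.sq_sqrt hV.le]
      refine (mul_le_mul_of_nonneg_left h3 (inv_nonneg.mpr hV.le)).trans (le_of_eq ?_)
      field_simp
    have h4 := Finset.sum_le_sum fun I (_ : I ∈ Finset.univ) => h1 I
    rw [← Finset.mul_sum, ← hB] at h4
    refine (div_le_div_of_nonneg_right h4 (by positivity)).trans ?_
    have h5 : volume L / (ℓ : ℝ) ^ 2 * B / (2 * volume L) = B / 2 / ℓ * (1 / ℓ) := by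
      field_simp
    rw [h5]
    exact mul_le_of_le_one_right (by positivity) ((div_le_one hℓ0).mpr hℓ1)

end QGNModel

/-! ### Uniform bounds for local families of matrices -/

section Local

variable {K orb : Type*} [Fintype K] [DecidableEq K] [Fintype orb]

/-- A differentiable family of matrices with matrix elements between the momenta `k` and `f k` only,
which together with their derivatives at `0` are bounded by `B`. -/
structure IsLocalFamily (f : K → K) (X : ℝ → Matrix (K × orb) (K × orb) ℂ)
    (X' : Matrix (K × orb) (K × orb) ℂ) (B : ℝ) : Prop where
  zero : ∀ t a b, b.1 ≠ f a.1 → X t a b = 0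
  hasDerivAt : ∀ a b, HasDerivAt (fun t => X t a b) (X' a b) 0
  norm_le : ∀ a b, ‖X 0 a b‖ ≤ B
  norm_deriv_le : ∀ a b, ‖X' a b‖ ≤ B

namespace IsLocalFamily

variable {f g : K → K} {X Y : ℝ → Matrix (K × orb) (K × orb) ℂ}
  {X' Y' : Matrix (K × orb) (K × orb) ℂ} {B C : ℝ}

lemma deriv_zero (h : IsLocalFamily f X X' B) {a b : K × orb} (hab : b.1 ≠ f a.1) : X' a b = 0 := by
  have h1 := h.hasDerivAt a b
  simp only [h.zero _ a b hab] at h1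
  exact h1.unique (hasDerivAt_const _ _)

/-- Only one intermediate momentum contributes, so the number of terms is the number of orbitals,
independent of the system size. -/
lemma norm_mul_apply_le {X Y : Matrix (K × orb) (K × orb) ℂ} {B C : ℝ} (hB : 0 ≤ B)
    (hX0 : ∀ a b, b.1 ≠ f a.1 → X a b = 0) (hX : ∀ a b, ‖X a b‖ ≤ B) (hY : ∀ a b, ‖Y a b‖ ≤ C)
    (a b : K × orb) : ‖(X * Y) a b‖ ≤ Fintype.card orb * (B * C) := by
  rw [Matrix.mul_apply, Fintype.sum_prod_type, Finset.sum_eq_single (f a.1)]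
  · refine (norm_sum_le _ _).trans ((Finset.sum_le_sum (g := fun _ => B * C) fun α _ =>
      ?_).trans (le_of_eq ?_))
    · rw [norm_mul]
      exact mul_le_mul (hX _ _) (hY _ _) (norm_nonneg _) hB
    · rw [Finset.sum_const, Finset.card_univ, nsmul_eq_mul]
  · intro k _ hk
    exact Finset.sum_eq_zero fun α _ => by rw [hX0 _ _ hk, zero_mul]
  · simp

lemma mul (h : IsLocalFamily f X X' B) (h' : IsLocalFamily g Y Y' C) (hB : 0 ≤ B) (hC : 0 ≤ C) :
    IsLocalFamily (g ∘ f) (fun t => X t * Y t) (X' * Y 0 + X 0 * Y')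
      (2 * Fintype.card orb * B * C) where
  zero t a b hab := by
    rw [Matrix.mul_apply]
    refine Finset.sum_eq_zero fun c _ => ?_
    by_cases hc : c.1 = f a.1
    · rw [h'.zero t c b (by rw [hc]; exact hab), mul_zero]
    · rw [h.zero t a c hc, zero_mul]
  hasDerivAt := hasDerivAt_mul_entry h.hasDerivAt h'.hasDerivAt
  norm_le a b := by
    have h1 := norm_mul_apply_le hB (h.zero 0) h.norm_le h'.norm_le a b
    have h2 : 0 ≤ (Fintype.card orb : ℝ) * (B * C) := by positivity
    linarith
  norm_deriv_le a b := by
    have h1 := norm_mul_apply_le hB (h.zero 0) h.norm_le h'.norm_deriv_le a b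
    have h2 := norm_mul_apply_le hB (fun _ _ => h.deriv_zero) h.norm_deriv_le h'.norm_le a b
    rw [Matrix.add_apply]
    linarith [norm_add_le ((X' * Y 0) a b) ((X 0 * Y') a b)]

lemma add (h : IsLocalFamily f X X' B) (h' : IsLocalFamily f Y Y' C) :
    IsLocalFamily f (fun t => X t + Y t) (X' + Y') (B + C) where
  zero t a b hab := by rw [Matrix.add_apply, h.zero t a b hab, h'.zero t a b hab, add_zero]
  hasDerivAt a b := (h.hasDerivAt a b).add (h'.hasDerivAt a b)
  norm_le a b := (norm_add_le _ _).trans (add_le_add (h.norm_le a b) (h'.norm_le a b))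
  norm_deriv_le a b :=
    (norm_add_le _ _).trans (add_le_add (h.norm_deriv_le a b) (h'.norm_deriv_le a b))

lemma transpose (h : IsLocalFamily f X X' B) (hfg : ∀ k k', k = f k' ↔ k' = g k) :
    IsLocalFamily g (fun t => (X t)ᵀ) X'ᵀ B where
  zero t a b hab := h.zero t b a fun h1 => hab ((hfg _ _).mp h1)
  hasDerivAt a b := h.hasDerivAt b a
  norm_le a b := h.norm_le b a
  norm_deriv_le a b := h.norm_deriv_le b a

lemma const {X : Matrix (K × orb) (K × orb) ℂ} (h0 : ∀ a b, b.1 ≠ f a.1 → X a b = 0)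
    (hB : 0 ≤ B) (h : ∀ a b, ‖X a b‖ ≤ B) : IsLocalFamily f (fun _ => X) 0 B where
  zero _ := h0
  hasDerivAt _ _ := hasDerivAt_const _ _
  norm_le := h
  norm_deriv_le _ _ := by simpa using hB

lemma congr_fun (h : IsLocalFamily f X X' B) (hfg : ∀ k, f k = g k) : IsLocalFamily g X X' B := by
  rwa [← funext hfg]

lemma linear_combination {γ : Type*} [Fintype γ] {X : γ → ℝ → Matrix (K × orb) (K × orb) ℂ}
    {X' : γ → Matrix (K × orb) (K × orb) ℂ} (h : ∀ j, IsLocalFamily f (X j) (X' j) B)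
    (z : ℂ) {w : γ → ℂ} {r : ℝ} (hw : ∀ j, ‖w j‖ ≤ r) (hr : 0 ≤ r) :
    IsLocalFamily f (fun t => z • ∑ j, w j • X j t) (z • ∑ j, w j • X' j)
      (‖z‖ * (Fintype.card γ * (r * B))) := by
  have key : ∀ Y : γ → Matrix (K × orb) (K × orb) ℂ, ∀ a b, (∀ j, ‖Y j a b‖ ≤ B) →
      ‖(z • ∑ j, w j • Y j) a b‖ ≤ ‖z‖ * (Fintype.card γ * (r * B)) := by
    intro Y a b hY
    rw [Matrix.smul_apply, norm_smul, Matrix.sum_apply]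
    refine mul_le_mul_of_nonneg_left ?_ (norm_nonneg _)
    refine (norm_sum_le _ _).trans ((Finset.sum_le_sum (g := fun _ => r * B) fun j _ =>
      ?_).trans (le_of_eq ?_))
    · rw [Matrix.smul_apply, norm_smul]
      exact mul_le_mul (hw j) (hY j) (norm_nonneg _) hr
    · rw [Finset.sum_const, Finset.card_univ, nsmul_eq_mul]
  refine ⟨fun t a b hab => ?_, fun a b => ?_, fun a b => key _ a b fun j => (h j).norm_le a b,
    fun a b => key _ a b fun j => (h j).norm_deriv_le a b⟩
  · simp [Matrix.sum_apply, (h _).zero t a b hab]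
  · simp only [Matrix.smul_apply, Matrix.sum_apply, smul_eq_mul]
    exact (HasDerivAt.fun_sum fun j _ => ((h j).hasDerivAt a b).const_mul _).const_mul _

/-- Each row has nonzero entries at a single momentum only, so the number of momenta enters
linearly. -/
lemma sum_norm_sq_deriv_le (h : IsLocalFamily f X X' B) :
    ∑ a, ∑ b, ‖X' a b‖ ^ 2 ≤ Fintype.card K * (Fintype.card orb : ℝ) ^ 2 * B ^ 2 := by
  have h1 : ∀ a, ∑ b, ‖X' a b‖ ^ 2 ≤ Fintype.card orb * B ^ 2 := by
    intro a
    rw [Fintype.sum_prod_type, Finset.sum_eq_single (f a.1)]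
    · refine (Finset.sum_le_sum fun α _ =>
        pow_le_pow_left₀ (norm_nonneg _) (h.norm_deriv_le a (f a.1, α)) 2).trans (le_of_eq ?_)
      rw [Finset.sum_const, Finset.card_univ, nsmul_eq_mul]
    · intro k _ hk
      exact Finset.sum_eq_zero fun α _ => by simp [h.deriv_zero (a := a) (b := (k, α)) hk]
    · simp
  refine (Finset.sum_le_sum fun a _ => h1 a).trans (le_of_eq ?_)
  rw [Finset.sum_const, Finset.card_univ, nsmul_eq_mul, Fintype.card_prod]
  push_cast
  ring

end IsLocalFamily

end Local

/-! ### The pair mass is bounded away from zero -/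

lemma exists_uniform_bound {γ X : Type*} [Fintype γ] {f : γ → X → ℂ}
    (h : ∀ j, ∃ C : ℝ, 0 ≤ C ∧ ∀ x, ‖f j x‖ ≤ C) :
    ∃ C : ℝ, 0 ≤ C ∧ ∀ j x, ‖f j x‖ ≤ C := by
  choose C hC0 hC using h
  exact ⟨∑ j, C j, Finset.sum_nonneg fun j _ => hC0 j, fun j x =>
    (hC j x).trans (Finset.single_le_sum (fun j _ => hC0 j) (Finset.mem_univ j))⟩

namespace QGNModel

variable {d : ℕ} {orb gen : Type*} [Fintype orb] [DecidableEq orb] [Fintype gen]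
  (𝓜 : QGNModel d orb gen) (L : Fin d → ℕ) [∀ i, NeZero (L i)]

/-- Periodicity reduces the entries and their directional derivatives to a compact Brillouin zone,
which gives one constant for all meshes. -/
lemma exists_flatProj_bound (e : Fin d → ℝ) :
    ∃ B : ℝ, 0 ≤ B ∧ ∀ (L : Fin d → ℕ) [∀ i, NeZero (L i)], ∃ X',
      IsLocalFamily id (fun t : ℝ => 𝓜.flatProj L (t • e)) X' B := by
  have hper : ∀ α β, IsPeriodicOn (reciprocalLattice d) fun k => 𝓜.proj k α β := by
    rintro α β _ ⟨m, rfl⟩ k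
    exact congrFun (congrFun (𝓜.proj_periodic k m) α) β
  obtain ⟨B, hB0, hB⟩ := exists_uniform_bound (f := fun (x : orb × orb) k => 𝓜.proj k x.1 x.2)
    fun x => (hper x.1 x.2).exists_norm_le (𝓜.proj_contDiff _ _).continuous
      (isCompact_brillouinZone d) exists_add_mem_brillouinZone
  obtain ⟨B', hB'0, hB'⟩ := exists_uniform_bound
    (f := fun (x : orb × orb) k => fderiv ℝ (fun k => 𝓜.proj k x.1 x.2) k e)
    fun x => ((hper x.1 x.2).fderiv_apply e).exists_norm_le
      (((𝓜.proj_contDiff _ _).fderiv_right (m := 1) (by norm_num)).clm_apply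
        contDiff_const).continuous
      (isCompact_brillouinZone d) exists_add_mem_brillouinZone
  refine ⟨max B B', le_max_of_le_left hB0, fun L _ => ⟨Matrix.of fun a b => if a.1 = b.1 then
    fderiv ℝ (fun k => 𝓜.proj k a.2 b.2) a.1.val e else 0, ?_, ?_, ?_, ?_⟩⟩
  · intro t a b hab
    exact if_neg (Ne.symm hab)
  · intro a b
    simp only [flatProj, Matrix.of_apply]
    split_ifs
    · have h1 : HasDerivAt (fun t : ℝ => a.1.val + t • e) e 0 := by
        simpa using ((hasDerivAt_id (0 : ℝ)).smul_const e).const_add a.1.val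
      have h2 := (((𝓜.proj_contDiff a.2 b.2).differentiable two_ne_zero)
        (a.1.val + (0 : ℝ) • e)).hasFDerivAt.comp_hasDerivAt (0 : ℝ) h1
      rw [zero_smul, add_zero] at h2
      exact h2
    · exact hasDerivAt_const _ _
  · intro a b
    simp only [flatProj, Matrix.of_apply]
    split_ifs
    · exact (hB (a.2, b.2) _).trans (le_max_left _ _)
    · simpa using Or.inl hB0
  · intro a b
    simp only [Matrix.of_apply]
    split_ifs
    · exact (hB' (a.2, b.2) _).trans (le_max_right _ _)
    · simpa using Or.inl hB0

lemma exists_vertexMatrix_bound (e : Fin d → ℝ) :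
    ∃ B : ℝ, 0 ≤ B ∧ ∀ (L : Fin d → ℕ) [∀ i, NeZero (L i)] (J : gen) (q : Mesh L), ∃ X',
      IsLocalFamily (fun k => k + q) (fun t : ℝ => 𝓜.vertexMatrix L (t • e) J q) X' B := by
  have hK : IsCompact (brillouinZone d ×ˢ brillouinZone d) :=
    (isCompact_brillouinZone d).prod (isCompact_brillouinZone d)
  have hΓ : ∀ x : (Fin d → ℝ) × (Fin d → ℝ), ∃ v ∈ reciprocalLattice d ×ˢ reciprocalLattice d,
      x + v ∈ brillouinZone d ×ˢ brillouinZone d := by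
    intro x
    obtain ⟨v, hv, hx⟩ := exists_add_mem_brillouinZone x.1
    obtain ⟨v', hv', hx'⟩ := exists_add_mem_brillouinZone x.2
    exact ⟨(v, v'), ⟨hv, hv'⟩, hx, hx'⟩
  have hper : ∀ J α β, IsPeriodicOn (reciprocalLattice d ×ˢ reciprocalLattice d)
      fun p : (Fin d → ℝ) × (Fin d → ℝ) => 𝓜.vertex J p.1 p.2 α β := by
    rintro J α β ⟨_, _⟩ ⟨⟨m, rfl⟩, ⟨m', rfl⟩⟩ p
    exact congrFun (congrFun (𝓜.vertex_periodic J p.1 p.2 m m') α) β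
  obtain ⟨B, hB0, hB⟩ := exists_uniform_bound
    (f := fun (x : gen × orb × orb) (p : (Fin d → ℝ) × (Fin d → ℝ)) =>
      𝓜.vertex x.1 p.1 p.2 x.2.1 x.2.2)
    fun x => (hper x.1 x.2.1 x.2.2).exists_norm_le (𝓜.vertex_contDiff _ _ _).continuous hK hΓ
  obtain ⟨B', hB'0, hB'⟩ := exists_uniform_bound (f := fun (x : gen × orb × orb) p => fderiv ℝ
      (fun p : (Fin d → ℝ) × (Fin d → ℝ) => 𝓜.vertex x.1 p.1 p.2 x.2.1 x.2.2) p (e, e))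
    fun x => ((hper x.1 x.2.1 x.2.2).fderiv_apply (e, e)).exists_norm_le
      (((𝓜.vertex_contDiff _ _ _).fderiv_right (m := 1) (by norm_num)).clm_apply
        contDiff_const).continuous hK hΓ
  refine ⟨max B B', le_max_of_le_left hB0, fun L _ J q => ⟨Matrix.of fun a b => if b.1 = a.1 + q then
    fderiv ℝ (fun p : (Fin d → ℝ) × (Fin d → ℝ) => 𝓜.vertex J p.1 p.2 a.2 b.2)
      (a.1.val, b.1.val) (e, e) else 0, ?_, ?_, ?_, ?_⟩⟩
  · intro t a b hab
    simp [vertexMatrix, hab]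
  · intro a b
    simp only [vertexMatrix, Matrix.of_apply]
    split_ifs
    · have h1 : ∀ k : Fin d → ℝ, HasDerivAt (fun t : ℝ => k + t • e) e 0 := fun k => by
        simpa using ((hasDerivAt_id (0 : ℝ)).smul_const e).const_add k
      have h2 := (((𝓜.vertex_contDiff J a.2 b.2).differentiable two_ne_zero)
        (a.1.val + (0 : ℝ) • e, b.1.val + (0 : ℝ) • e)).hasFDerivAt.comp_hasDerivAt (0 : ℝ)
          ((h1 a.1.val).prodMk (h1 b.1.val))
      rw [zero_smul, add_zero, add_zero] at h2
      exact h2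
    · exact hasDerivAt_const _ _
  · intro a b
    simp only [vertexMatrix, Matrix.of_apply]
    split_ifs
    · exact (hB (J, a.2, b.2) (_, _)).trans (le_max_left _ _)
    · simpa using Or.inl hB0
  · intro a b
    simp only [Matrix.of_apply]
    split_ifs
    · exact (hB' (J, a.2, b.2) _).trans (le_max_right _ _)
    · simpa using Or.inl hB0

/-- The roots are chosen separately at each `q`, without continuity. Their column norms squared are
nevertheless the diagonal entries of the coupling, which are continuous and periodic. -/
lemma exists_couplingRoot_bound : ∃ B : ℝ, 0 ≤ B ∧ ∀ q I J, ‖𝓜.couplingRoot q I J‖ ≤ B := by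
  obtain ⟨B, hB0, hB⟩ := exists_uniform_bound (f := fun J q => 𝓜.coupling q J J) fun J =>
    IsPeriodicOn.exists_norm_le (Γ := reciprocalLattice d)
      (by
        rintro _ ⟨m, rfl⟩ q
        exact congrFun (congrFun (𝓜.coupling_periodic q m) J) J)
      (𝓜.coupling_continuous J J) (isCompact_brillouinZone d) exists_add_mem_brillouinZone
  refine ⟨Real.sqrt B, Real.sqrt_nonneg _, fun q I J => Real.le_sqrt_of_sq_le ?_⟩
  have h1 : 𝓜.coupling q J J = ((∑ K, ‖𝓜.couplingRoot q K J‖ ^ 2 : ℝ) : ℂ) := by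
    rw [coupling_eq, Matrix.mul_apply]
    push_cast
    refine Finset.sum_congr rfl fun K _ => ?_
    rw [← Complex.conj_mul']; rfl
  have h2 := hB J q
  rw [h1, Complex.norm_real, Real.norm_of_nonneg (by positivity)] at h2
  exact (Finset.single_le_sum (f := fun K => ‖𝓜.couplingRoot q K J‖ ^ 2)
    (fun _ _ => sq_nonneg _) (Finset.mem_univ I)).trans h2

/-- The factor `𝖵^(-1/2)` is kept explicit, because it must later cancel against a count of matrix
entries. -/
lemma exists_rootVertex_bound (e : Fin d → ℝ) :
    ∃ B : ℝ, 0 ≤ B ∧ ∀ (L : Fin d → ℕ) [∀ i, NeZero (L i)] (i : Mesh L × gen), ∃ X',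
      IsLocalFamily (fun k => k + i.1) (fun t : ℝ => 𝓜.rootVertex L i (t • e)) X'
        ((Real.sqrt (volume L))⁻¹ * B) := by
  obtain ⟨B₁, hB₁, h₁⟩ := 𝓜.exists_flatProj_bound e
  obtain ⟨B₂, hB₂, h₂⟩ := 𝓜.exists_vertexMatrix_bound e
  obtain ⟨B₃, hB₃, h₃⟩ := 𝓜.exists_couplingRoot_bound
  refine ⟨Fintype.card gen * (B₃ * (2 * Fintype.card orb * (2 * Fintype.card orb * B₁ * B₂) * B₁)),
    by positivity, fun L _ i => ?_⟩
  obtain ⟨P', hP'⟩ := h₁ L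
  choose S' hS' using fun J => h₂ L J i.1
  have h4 := fun J => (hP'.mul (hS' J) hB₁ hB₂).mul hP' (by positivity) hB₁
  have h5 := IsLocalFamily.linear_combination h4 ((Real.sqrt (volume L))⁻¹ : ℂ)
    (h₃ i.1.val i.2) hB₃
  rw [norm_inv, Complex.norm_real, Real.norm_of_nonneg (Real.sqrt_nonneg _)] at h5
  exact ⟨_, h5.congr_fun fun _ => rfl⟩

lemma condensate_eq_zero {a b : Mesh L × orb} (h : b.1 ≠ -a.1) : 𝓜.condensate L a b = 0 := by
  by_contra h'
  rw [condensate, nestMatrix, flatProj_eq, blockMatrix_transpose (g := id) (by simp [eq_comm]),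
    blockMatrix_mul] at h'
  exact h (blockMatrix_ne_zero h')

end QGNModel

/-- The diagonal of `W Wᴴ = κ P` is the squared norm of the rows of `W`, so a uniform condensate is
bounded entrywise by its amplitude. -/
lemma IsUniformPairing.norm_apply_le {P W : Matrix ι ι ℂ} {κ B : ℝ} {M : ℕ}
    (h : IsUniformPairing P W κ M) (hκ : 0 ≤ κ) (hB : ∀ a, ‖P a a‖ ≤ B) (a b : ι) :
    ‖W a b‖ ≤ Real.sqrt κ * Real.sqrt B := by
  rw [← Real.sqrt_mul hκ]
  refine Real.le_sqrt_of_sq_le ?_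
  have h1 : ((∑ b, ‖W a b‖ ^ 2 : ℝ) : ℂ) = κ * P a a := by
    have := congrFun (congrFun h.mul_conjTranspose a) a
    rw [Matrix.mul_apply, Matrix.smul_apply, smul_eq_mul] at this
    rw [← this]
    push_cast
    refine Finset.sum_congr rfl fun b _ => ?_
    rw [← Complex.mul_conj']; rfl
  have h2 := congrArg norm h1
  rw [Complex.norm_real, Real.norm_of_nonneg (by positivity), norm_mul, Complex.norm_real,
    Real.norm_of_nonneg hκ] at h2
  refine (Finset.single_le_sum (f := fun b => ‖W a b‖ ^ 2) (fun _ _ => sq_nonneg _)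
    (Finset.mem_univ b)).trans (h2.le.trans (mul_le_mul_of_nonneg_left (hB a) hκ))

namespace QGNModel

variable {d : ℕ} {orb gen : Type*} [Fintype orb] [DecidableEq orb] [Fintype gen]
  (𝓜 : QGNModel d orb gen) (L : Fin d → ℕ) [∀ i, NeZero (L i)]

/-- The derivatives of the action of the projected bilinears on the condensed pair are bounded, per
unit of the pair amplitude, uniformly in the system size. -/
lemma exists_pairAction_bound (e : Fin d → ℝ) :
    ∃ B : ℝ, 0 ≤ B ∧ ∀ (L : Fin d → ℕ) [∀ i, NeZero (L i)] (c : ℝ) (M : ℕ), 0 ≤ c →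
      IsUniformPairing (𝓜.flatProj L 0) (𝓜.condensate L) c M → ∀ i : Mesh L × gen, ∃ F,
        IsLocalFamily (fun k => -k - i.1) (fun t : ℝ => pairAction (𝓜.rootVertex L i (t • e))
          (𝓜.flatProj L (t • e) * 𝓜.condensate L * (𝓜.flatProj L (t • e))ᵀ)) F
          ((Real.sqrt (volume L))⁻¹ * Real.sqrt c * B) := by
  obtain ⟨B₁, hB₁, h₁⟩ := 𝓜.exists_flatProj_bound e
  obtain ⟨B₂, hB₂, h₂⟩ := 𝓜.exists_rootVertex_bound e
  refine ⟨2 * (2 * Fintype.card orb * B₂ * (2 * Fintype.card orb * (2 * Fintype.card orb * B₁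
    * Real.sqrt B₁) * B₁)), by positivity, fun L _ c M hc hW i => ?_⟩
  obtain ⟨P', hP'⟩ := h₁ L
  obtain ⟨T', hT'⟩ := h₂ L i
  have hPa : ∀ a, ‖𝓜.flatProj L 0 a a‖ ≤ B₁ := fun a => by simpa using hP'.norm_le a a
  have hWc := IsLocalFamily.const (f := fun k : Mesh L => -k)
    (fun a b => 𝓜.condensate_eq_zero L (a := a) (b := b))
    (by positivity) (hW.norm_apply_le hc hPa)
  have hPt := hP'.transpose (g := id) (by simp [eq_comm])
  have hTt := hT'.transpose (g := fun k => k - i.1) fun k k' => by rw [eq_sub_iff_add_eq, eq_comm]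
  have hC := (hP'.mul hWc hB₁ (by positivity)).mul hPt (by positivity) hB₁
  have h3 := hT'.mul hC (by positivity) (by positivity)
  have h4 := hC.mul hTt (by positivity) (by positivity)
  have h5 := (h3.congr_fun (g := fun k => -k - i.1) fun k => by simp; abel).add
    (h4.congr_fun (g := fun k => -k - i.1) fun k => rfl)
  refine ⟨_, Eq.mp (congrArg (IsLocalFamily _ _ _) ?_) h5⟩
  ring

/-- The inverse pair mass is bounded uniformly in the system size. -/
theorem exists_inversePairMass_le (e : Fin d → ℝ) :
    ∃ C : ℝ, 0 ≤ C ∧ ∀ (L : Fin d → ℕ) [∀ i, NeZero (L i)], 𝓜.HasUniquePair L →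
      ∀ w, 𝓜.IsInversePairMass L e w → 0 ≤ w ∧ w ≤ C := by
  obtain ⟨B, hB0, hB⟩ := 𝓜.exists_pairAction_bound e
  refine ⟨Fintype.card gen * (Fintype.card orb : ℝ) ^ 2 * B ^ 2, by positivity,
    fun L _ hu w hw => ?_⟩
  rcases Nat.eq_zero_or_pos 𝓜.nPair with hp | hp
  · rw [hw.unique (𝓜.isInversePairMass_zero L hp e)]
    exact ⟨le_rfl, by positivity⟩
  · obtain ⟨c, lp, l, hc, hlp, hlpw, -, -, -, -, hW, htrial⟩ := 𝓜.exists_curvatures L hp hu e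
    rw [hw.unique hlpw]
    refine ⟨by positivity, ?_⟩
    have hV : (0 : ℝ) < volume L := by exact_mod_cast volume_pos (L := L)
    choose F hF using hB L c _ hc.le hW
    have h1 := htrial F fun i => (hF i).hasDerivAt
    have hanti : ∀ i, (F i)ᵀ = -F i := by
      intro i
      ext a b
      have h2 := (hF i).hasDerivAt b a
      have h3 : ∀ t : ℝ, pairAction (𝓜.rootVertex L i (t • e))
          (𝓜.flatProj L (t • e) * 𝓜.condensate L * (𝓜.flatProj L (t • e))ᵀ) b a
          = -pairAction (𝓜.rootVertex L i (t • e))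
          (𝓜.flatProj L (t • e) * 𝓜.condensate L * (𝓜.flatProj L (t • e))ᵀ) a b := by
        intro t
        refine congrFun (congrFun (pairAction_antisymm ?_) a) b
        simp only [Matrix.transpose_mul, Matrix.transpose_transpose, hW.antisymm, Matrix.neg_mul,
          Matrix.mul_neg, Matrix.mul_assoc]
      simp only [h3] at h2
      exact h2.unique ((hF i).hasDerivAt a b).neg
    -- The linear count of nonzero entries cancels the squared factor `𝖵^(-1/2)`, so each bilinear
    -- contributes a multiple of `c` independent of the volume.
    have hF2 : ∀ i, ‖pairCreate (F i) (vacuum _)‖ ^ 2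
        ≤ 2 * ((Fintype.card orb : ℝ) ^ 2 * (c * B ^ 2)) := by
      intro i
      rw [norm_sq_pairCreate_vacuum (hanti i)]
      refine mul_le_mul_of_nonneg_left ((hF i).sum_norm_sq_deriv_le.trans (le_of_eq ?_)) two_pos.le
      rw [card_mesh, mul_pow, mul_pow, inv_pow, Real.sq_sqrt hV.le, Real.sq_sqrt hc.le]
      field_simp
    -- Both the number of bilinears and this norm are proportional to `𝖵`, and both sides are linear
    -- in `c`. Volume and amplitude therefore cancel, although `c` may depend on the system size.
    have hnorm : ‖pairCreate (𝓜.condensate L) (vacuum _)‖ ^ 2 = 4 * c * 𝓜.maxPairs L := by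
      have := hW.norm_sq_pow_vacuum_succ 0
      simpa using this
    have h4 := h1.trans (Finset.sum_le_sum fun i _ => hF2 i)
    rw [hnorm, Finset.sum_const, Finset.card_univ, Fintype.card_prod, card_mesh, nsmul_eq_mul,
      maxPairs] at h4
    push_cast at h4
    have hp1 : (1 : ℝ) ≤ 𝓜.nPair := by exact_mod_cast hp
    have h5 : 4 * c * volume L * (lp * 1) ≤ 4 * c * volume L * (lp * 𝓜.nPair) :=
      mul_le_mul_of_nonneg_left (mul_le_mul_of_nonneg_left hp1 hlp) (by positivity)
    refine le_of_mul_le_mul_left ?_ (by positivity : 0 < 4 * c * (volume L : ℝ))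
    have h6 : 0 ≤ 4 * c * volume L * (Fintype.card gen * (Fintype.card orb : ℝ) ^ 2 * B ^ 2) := by
      positivity
    linarith

/-- For large systems the bound holds up to a correction that vanishes with the system size. -/
theorem exists_large_system_bound (hd : 1 ≤ d) (e : Fin d → ℝ) {ε : ℝ} (hε : 0 < ε) :
    ∃ L₀ : ℕ, ∀ (L : Fin d → ℕ) [∀ i, NeZero (L i)],
      (∀ i, L₀ ≤ L i) → 𝓜.HasUniquePair L →
        ∀ n ≤ 𝓜.maxPairs L, ∀ D w : ℝ,
          𝓜.IsStiffness L (2 * n) e D → 𝓜.IsInversePairMass L e w →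
            D ≤ (𝓜.nFlat : ℝ) / 2 * 𝓜.filling L (2 * n) * (1 - 𝓜.filling L (2 * n)) * w + ε := by
  obtain ⟨C, hC0, hC⟩ := 𝓜.exists_stiffness_filled_le e
  obtain ⟨C', hC'0, hC'⟩ := 𝓜.exists_inversePairMass_le e
  -- The error terms are `C` from the filled bands and `nPair * C'` from the prefactor `1 - 1 / M`.
  -- The factor 2 pays for `1 - r ≥ 1 / 2`, which the shift to `ℓ + 2` guarantees.
  obtain ⟨ℓ, hℓ⟩ := exists_nat_gt (2 * (C + 𝓜.nPair * C') / ε)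
  refine ⟨ℓ + 2, fun L _ hL hu n hn D w hD hw => ?_⟩
  obtain ⟨w', D', hw', hD', hineq, -⟩ := 𝓜.finite_size_bounds L hu e
  obtain rfl := hw.unique hw'
  obtain rfl := 𝓜.stiffness_unique L hD (hD' n hn)
  rcases Nat.eq_zero_or_pos 𝓜.nPair with hp | hp
  · have hM : 𝓜.maxPairs L = 0 := by rw [maxPairs, hp, zero_mul]
    obtain rfl : n = 0 := by omega
    rw [𝓜.stiffness_unique L hD (𝓜.isStiffness_zero L e), filling_two_mul]
    simpa using hε.le
  -- The number of pairs is at least one side length, which requires at least one dimension.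
  have hℓV : ℓ + 2 ≤ 𝓜.maxPairs L := by
    refine (hL ⟨0, hd⟩).trans ((Nat.le_of_dvd volume_pos
      (Finset.dvd_prod_of_mem L (Finset.mem_univ _))).trans ?_)
    exact Nat.le_mul_of_pos_left _ hp
  obtain ⟨hDf0, hDf⟩ := hC L (ℓ + 2) (by omega) hL hu _ (hD' _ le_rfl)
  obtain ⟨hw0, hwC⟩ := hC' L hu w hw
  have h := hineq n hn
  rw [nFlat_div_two, filling_two_mul] at h ⊢
  have hM : (ℓ : ℝ) + 2 ≤ 𝓜.maxPairs L := by exact_mod_cast hℓV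
  have hnM : (n : ℝ) ≤ 𝓜.maxPairs L := by exact_mod_cast hn
  set M := (𝓜.maxPairs L : ℝ)
  set p := (𝓜.nPair : ℝ)
  have hp0 : (0 : ℝ) ≤ p := Nat.cast_nonneg _
  have hℓ0 : (0 : ℝ) ≤ ℓ := Nat.cast_nonneg _
  have hM0 : 0 < M := by linarith
  set ν : ℝ := n / M
  have hν0 : 0 ≤ ν := by positivity
  have hν1 : ν ≤ 1 := div_le_one_of_le₀ hnM hM0.le
  set X : ℝ := p * ν * (1 - ν) * w with hX
  have hX0 : 0 ≤ X := mul_nonneg (mul_nonneg (mul_nonneg hp0 hν0) (by linarith)) hw0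
  have hXC : X ≤ p * C' := by
    have h1 : ν * (1 - ν) ≤ 1 := by nlinarith
    have h2 : ν * (1 - ν) * w ≤ C' :=
      (mul_le_of_le_one_left hw0 h1).trans hwC
    calc X = p * (ν * (1 - ν) * w) := by rw [hX]; ring
      _ ≤ p * C' := mul_le_mul_of_nonneg_left h2 hp0
  have hY : ν * (ν - 1 / M) * D' (𝓜.maxPairs L) ≤ C / (ℓ + 2) := by
    have h1 : ν * (ν - 1 / M) ≤ 1 := by
      have : 0 ≤ 1 / M := by positivity
      nlinarith
    refine (mul_le_of_le_one_left hDf0 h1).trans (hDf.trans (le_of_eq ?_))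
    push_cast
    rfl
  set r : ℝ := 1 / (ℓ + 2) with hr
  have hr0 : 0 < r := by positivity
  have hMr : 1 / M ≤ r := one_div_le_one_div_of_le (by positivity) hM
  have hr2 : r ≤ 1 / 2 := one_div_le_one_div_of_le two_pos (by linarith)
  have hεr : 2 * (C + p * C') * r ≤ ε := by
    rw [div_lt_iff₀ hε] at hℓ
    rw [hr, mul_one_div, div_le_iff₀ (by positivity)]
    nlinarith
  have hY' : C / (ℓ + 2) = C * r := by rw [hr, mul_one_div]
  rw [hY'] at hY
  -- Arguing by contradiction avoids dividing by `1 - 1 / M`: a larger stiffness, multiplied by `1 -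
  -- r`, would exceed the fixed-number bound.
  by_contra! hlt
  have h3 : X + ε ≤ D' n := hlt.le
  have h4 : (1 - r) * (X + ε) ≤ (1 - 1 / M) * D' n :=
    mul_le_mul (by linarith) h3 (by linarith) (by linarith)
  have h5 : r * X ≤ r * (p * C') := mul_le_mul_of_nonneg_left hXC hr0.le
  nlinarith

end QGNModel

end FlatBand

end

theorem mainTheorem3 {d : ℕ} {orb gen : Type*} [Fintype orb] [DecidableEq orb] [Fintype gen]
    (𝓜 : FlatBand.QGNModel d orb gen) (e : Fin d → ℝ) :
    -- every system size: the curvatures exist and obey the bound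
    (∀ (L : Fin d → ℕ) [∀ i, NeZero (L i)], 𝓜.HasUniquePair L →
      ∃ (w : ℝ) (D : ℕ → ℝ), 𝓜.IsInversePairMass L e w ∧
        (∀ n ≤ 𝓜.maxPairs L, 𝓜.IsStiffness L (2 * n) e (D n)) ∧
        -- fixed particle number
        (∀ n ≤ 𝓜.maxPairs L,
          (1 - 1 / (𝓜.maxPairs L : ℝ)) * D n ≤
            (𝓜.nFlat : ℝ) / 2 * 𝓜.filling L (2 * n) * (1 - 𝓜.filling L (2 * n)) * w +
              𝓜.filling L (2 * n) * (𝓜.filling L (2 * n) - 1 / (𝓜.maxPairs L : ℝ)) *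
                D (𝓜.maxPairs L)) ∧
        -- number distribution of a BCS state with mean filling ν
        (∀ ν : ℝ, 0 ≤ ν → ν ≤ 1 →
          ∑ n ∈ Finset.range (𝓜.maxPairs L + 1),
              ((𝓜.maxPairs L).choose n : ℝ) * ν ^ n * (1 - ν) ^ (𝓜.maxPairs L - n) * D n ≤
            (𝓜.nFlat : ℝ) / 2 * ν * (1 - ν) * w + ν ^ 2 * D (𝓜.maxPairs L))) ∧
    -- large systems: the bound holds up to a correction that vanishes with the system size
    (1 ≤ d → ∀ ε : ℝ, 0 < ε → ∃ L₀ : ℕ, ∀ (L : Fin d → ℕ) [∀ i, NeZero (L i)],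
      (∀ i, L₀ ≤ L i) → 𝓜.HasUniquePair L →
        ∀ n ≤ 𝓜.maxPairs L, ∀ D w : ℝ,
          𝓜.IsStiffness L (2 * n) e D → 𝓜.IsInversePairMass L e w →
            D ≤ (𝓜.nFlat : ℝ) / 2 * 𝓜.filling L (2 * n) * (1 - 𝓜.filling L (2 * n)) * w + ε) := by
  exact ⟨fun L _ hu => 𝓜.finite_size_bounds L hu e,
    fun hd _ hε => 𝓜.exists_large_system_bound hd e hε⟩
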